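/- All graphs are finite and simple. For a graph $H$ let $m(H)$ be the maximum, over all integers $k\ge 0$, of the number of vertices of $H$ having degree exactly $k$; $\ln$ is the natural logarithm. **Theorem.** (1) There is a function $\eta:\mathbb N\to\mathbb R$ with $\eta(n)\to 0$ as $n\to\infty$ such that every graph $G$ with $n$ vertices and minimum degree $\delta$ has a spanning subgraph $H$ with $$m(H)\le (1+\eta(n))\left\lceil \frac{n}{\delta+1}\right\rceil+2 .$$ (2) There is an $N$ such that every graph $G$ with $n\ge N$ vertices and minimum degree $\delta$ satisfying $\delta^{1.24}\ge n$ has a spanning subgraph $H$ with $$m(H)\le \left\lceil \frac{n}{\delta+1}\right\rceil+2 .$$ (3) For every $\varepsilon\in(0,1/4)$ there is an $N=N(\varepsilon)$ such that for every graph $G$ with $n\ge N$ vertices and minimum degree $\delta$ the following hold. (a) If $\delta\ge (\ln n)^{2/\varepsilon}(\ln\ln n)^{1/\varepsilon}$, then $G$ has a spanning subgraph $H$ with $$m(H)\le \left\lceil \frac n\delta+\frac{5\sqrt{(n/\delta)\ln n}}{\delta^{1/4}}\right\rceil+\left\lfloor\frac{2016\,n\ln n\,\ln\ln n}{\delta^{1+\varepsilon}}\right\rfloor+1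 .$$ (b) If $\delta^{1+\varepsilon}>2016\,n\ln n\,\ln\ln n$, then $G$ has a spanning subgraph $H$ with $$m(H)\le \left\lceil \frac{n}{\delta+1}\right\rceil+2 .$$ -/

import Mathlib

open Filter Topology

universe u

namespace IrregularSubgraph

open Classical in
/-- `m(G, k)`: the number of vertices of degree `k` in `G`. -/
noncomputable def degCount {V : Type*} [Fintype V] (G : SimpleGraph V) (k : ℕ) : ℕ :=
  (Finset.univ.filter fun v : V => G.degree v = k).card

/-- `m(G) = max_k m(G, k)`: the maximum number of vertices of the same degree in `G`. -/
noncomputable def maxDegCount {V : Type*} [Fintype V] (G : SimpleGraph V) : ℕ :=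
  ⨆ k : ℕ, degCount G k

theorem bddAbove_degCount {V : Type*} [Fintype V] (G : SimpleGraph V) :
    BddAbove (Set.range (degCount G)) := by
  refine ⟨Fintype.card V, ?_⟩
  rintro _ ⟨k, rfl⟩
  exact Finset.card_le_univ _

/-- The supremum defining `m(G)` is over a bounded family, hence is a genuine maximum. -/
theorem maxDegCount_le_iff {V : Type*} [Fintype V] (G : SimpleGraph V) (b : ℕ) :
    maxDegCount G ≤ b ↔ ∀ k : ℕ, degCount G k ≤ b :=
  ciSup_le_iff (bddAbove_degCount G)

end IrregularSubgraph

/-! Give each vertex a random ξ in [0,1] and keep the edge uv when ξ_u + ξ_v ≥ 1. The new degree of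
v is then about ξ_v d(v), hence spread over a range of length at least about δ, and a fixed degree
should occur about n/δ times. The work lies in making this exact, by two different methods according
to the size of δ.

When δ is a large multiple of ln n, random fluctuations are corrected by hand
(`exists_subgraph_of_large_degree`). With p = 1/P, random colours put most vertices into a main
class 3, and fractions 8p, p, 64p into the classes 0, 1, 2. A second random label reserves a sparse
set of edges between class 3 and the rest. All other edges at class 3 obey the threshold rule.
Chernoff bounds make every neighbourhood count typical, and the number of vertices with ξ_v d(v) in
any short window is at most slightly above its mean. Spreading the vertices of a window over its
degrees (`exists_slots`) gives each vertex a target degree. A main vertex reaches its target exactly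
by choosing reserved edges. The disturbance caused in the small classes is repaired cyclically
(`exists_completion`): class 0 chooses edges to class 1, class 1 to class 2, class 2 to class 0.
Only the last step can spoil an earlier one. It is therefore arranged that each class-0 vertex
receives about half of its edges from class 2, an amount that can be allowed for in advance. The
price is that a class-2 vertex reaches one of two targets, and only up to a bounded error
(`exists_two_valued_subgraph`, a greedy half-integral assignment followed by Beck–Fiala rounding).
Spacing the targets of the small classes by residues modulo 32 absorbs these errors, so a degree is
shared by one window family of the small classes and the main class only.

The main class has density 1 - 73p, which leaves room for the deviations and for passing from n/δ to
n/(δ+1). The small classes add O(pn/δ) per degree. The Chernoff bounds allow p of order (ln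
n/δ)^{1/4}, so the error is O((n/δ)(ln n/δ)^{1/4}). It is below 1 in the dense ranges and is
dominated by the explicit error of part (3).

When δ ≤ n^{1/20}, pass to an edge-minimal spanning subgraph of minimum degree at least δ. Every
edge then has an end of degree δ, so few vertices have large degree (`card_heavy_mul_le`). For a
vertex of small degree D, the threshold degree is the rank of its own label among D + 1 exchangeable
labels, hence nearly uniform on D + 1 ≥ δ + 1 values (`card_threshold_eq_mul_le`). Vertices of large
degree use an independent label on each edge. Most pairs of small-degree vertices are then
independent, and Chebyshev's inequality with a union bound over the possible degrees suffices. -/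

namespace IrregularSubgraph

/-! ### Rounding and two-valued bipartite subgraphs -/

/-- One step of the rounding procedure: moving along a kernel direction until a floating variable
becomes integral. -/
theorem exists_move_to_boundary {ι : Type*} [Fintype ι] (y d : ι → ℝ)
    (hy : ∀ e, 0 ≤ y e ∧ y e ≤ 1) (hne : ∃ e, d e ≠ 0) :
    ∃ θ : ℝ, (∀ e, 0 ≤ y e + θ * d e ∧ y e + θ * d e ≤ 1) ∧
      ∃ e, d e ≠ 0 ∧ (y e + θ * d e = 0 ∨ y e + θ * d e = 1) := by
  classical
  -- For d e ≠ 0, `r e` is the largest θ ≥ 0 for which coordinate e stays in [0, 1]; the minimiser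
  -- is the first coordinate to hit the boundary.
  set r : ι → ℝ := fun e => if 0 < d e then (1 - y e) / d e else y e / (-d e) with hr
  obtain ⟨e₀, he₀⟩ := hne
  obtain ⟨e₁, he₁, hmin⟩ := Finset.exists_min_image (Finset.univ.filter fun e => d e ≠ 0) r
    ⟨e₀, by simp [he₀]⟩
  simp only [Finset.mem_filter, Finset.mem_univ, true_and] at he₁ hmin
  have hr0 : ∀ e, d e ≠ 0 → 0 ≤ r e := by
    intro e he
    simp only [hr]
    split_ifs with h
    · exact div_nonneg (by linarith [(hy e).2]) h.le
    · exact div_nonneg (hy e).1 (by linarith [not_lt.1 h])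
  refine ⟨r e₁, fun e => ?_, e₁, he₁, ?_⟩
  · by_cases he : d e = 0
    · simpa [he] using hy e
    · have h1 := hmin e he
      have h2 := hr0 e₁ he₁
      by_cases h : 0 < d e
      · have h3 : r e = (1 - y e) / d e := by simp [hr, h]
        rw [h3, le_div_iff₀ h] at h1
        exact ⟨by nlinarith [(hy e).1, mul_nonneg h2 h.le], by linarith⟩
      · have h' : 0 < -d e := by
          have := lt_of_le_of_ne (not_lt.1 h) he
          linarith
        have h3 : r e = y e / (-d e) := by simp [hr, h]
        rw [h3, le_div_iff₀ h'] at h1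
        exact ⟨by linarith, by nlinarith [(hy e).2, mul_nonneg h2 h'.le]⟩
  · by_cases h : 0 < d e₁
    · right
      have h3 : r e₁ = (1 - y e₁) / d e₁ := by simp [hr, h]
      rw [h3, div_mul_cancel₀ _ he₁]; ring
    · left
      have h3 : r e₁ = y e₁ / (-d e₁) := by simp [hr, h]
      rw [h3, div_neg, neg_mul, div_mul_cancel₀ _ he₁]; ring

/-- Beck–Fiala rounding for set systems in which every element lies in at most two sets. -/
theorem exists_rounding {ι W : Type*} [Fintype ι] [Fintype W] [DecidableEq W] (s : ι → Finset W)
    (hs : ∀ e, (s e).card ≤ 2) (y : ι → ℝ) (hy : ∀ e, 0 ≤ y e ∧ y e ≤ 1) :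
    ∃ z : ι → ℝ, (∀ e, z e = 0 ∨ z e = 1) ∧ (∀ e, y e = 0 ∨ y e = 1 → z e = y e) ∧
      ∀ w, |∑ e with w ∈ s e, (z e - y e)| < 2 := by
  classical
  induction hk : (Finset.univ.filter fun e => ¬ (y e = 0 ∨ y e = 1)).card
    using Nat.strong_induction_on generalizing y with
  | _ k ih =>
  set Φ := Finset.univ.filter fun e => ¬ (y e = 0 ∨ y e = 1) with hΦ
  rcases Φ.eq_empty_or_nonempty with hemp | hnon
  · refine ⟨y, fun e => ?_, fun _ _ => rfl, fun w => by simp⟩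
    by_contra h
    have : e ∈ Φ := by simpa [hΦ] using h
    simp [hemp] at this
  -- Only sets with at least three floating elements are kept balanced. Since each element lies in
  -- at most two sets, 3|big| ≤ 2|Φ|, so there are fewer constraints than floating variables and a
  -- nonzero direction preserves all of them.
  set big : Finset W := Finset.univ.filter fun w => 3 ≤ (Φ.filter fun e => w ∈ s e).card with hbig
  have hcard : big.card < Φ.card := by
    have h1 : 3 * big.card ≤ ∑ w ∈ big, (Φ.filter fun e => w ∈ s e).card := by
      rw [mul_comm, ← smul_eq_mul]
      exact Finset.card_nsmul_le_sum _ _ _ fun w hw => (Finset.mem_filter.1 hw).2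
    have h2 : ∑ w ∈ big, (Φ.filter fun e => w ∈ s e).card ≤ ∑ e ∈ Φ, (s e).card := by
      simp_rw [Finset.card_filter]
      rw [Finset.sum_comm]
      refine Finset.sum_le_sum fun e _ => ?_
      rw [← Finset.card_filter]
      exact Finset.card_le_card fun w hw => (Finset.mem_filter.1 hw).2
    have h3 : ∑ e ∈ Φ, (s e).card ≤ Φ.card * 2 := Finset.sum_le_card_nsmul _ _ _ fun e _ => hs e
    have h4 := hnon.card_pos
    omega
  let f : ({e // e ∈ Φ} → ℝ) →ₗ[ℝ] ({w // w ∈ big} → ℝ) :=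
    { toFun := fun d w => ∑ e : {e // e ∈ Φ}, if (w : W) ∈ s e then d e else 0
      map_add' := by
        intro a b; ext w
        simp only [Pi.add_apply, ← Finset.sum_add_distrib]
        exact Finset.sum_congr rfl fun e _ => by split_ifs <;> simp
      map_smul' := by
        intro a b; ext w
        simp only [Pi.smul_apply, smul_eq_mul, RingHom.id_apply, Finset.mul_sum]
        exact Finset.sum_congr rfl fun e _ => by split_ifs <;> simp }
  obtain ⟨d₀, hd₀, hd₀ne⟩ : ∃ d ∈ LinearMap.ker f, d ≠ 0 := by
    have hk := LinearMap.ker_ne_bot_of_finrank_lt (f := f) (by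
      rw [Module.finrank_fintype_fun_eq_card, Module.finrank_fintype_fun_eq_card]
      simpa using hcard)
    exact Submodule.exists_mem_ne_zero_of_ne_bot hk
  set d : ι → ℝ := fun e => if h : e ∈ Φ then d₀ ⟨e, h⟩ else 0 with hd
  have hdΦ : ∀ e, d e ≠ 0 → e ∈ Φ := by
    intro e he; by_contra h; exact he (by simp [hd, h])
  have hfloat : ∀ e ∈ Φ, 0 < y e ∧ y e < 1 := by
    intro e he
    have := (Finset.mem_filter.1 he).2
    push Not at this
    exact ⟨lt_of_le_of_ne (hy e).1 (Ne.symm this.1), lt_of_le_of_ne (hy e).2 this.2⟩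
  have hdw : ∀ w ∈ big, ∑ e with w ∈ s e, d e = 0 := by
    intro w hw
    have h1 : f d₀ ⟨w, hw⟩ = 0 := by rw [LinearMap.mem_ker.1 hd₀]; rfl
    have h2 : f d₀ ⟨w, hw⟩ = ∑ e ∈ Φ, if w ∈ s e then d e else 0 := by
      rw [← Finset.sum_coe_sort Φ]
      exact Finset.sum_congr rfl fun e _ => by simp [hd]
    rw [h2] at h1
    rw [Finset.sum_filter]
    refine Eq.trans (Eq.symm ?_) h1
    refine Finset.sum_subset (Finset.subset_univ _) fun e _ he => ?_
    simp [hd, he]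
  obtain ⟨θ, hθ, e₁, he₁, hb⟩ := exists_move_to_boundary y d hy (by
      by_contra h
      push Not at h
      apply hd₀ne; ext ⟨e, he⟩
      simpa [hd, he] using h e)
  obtain ⟨z, hz1, hz2, hz3⟩ := ih _ (by
    rw [← hk]
    refine Finset.card_lt_card ⟨fun e he => ?_, fun hsub => ?_⟩
    · simp only [Finset.mem_filter, Finset.mem_univ, true_and] at he
      by_contra h
      apply he
      have : d e = 0 := by by_contra h'; exact h (hdΦ e h')
      rw [this, mul_zero, add_zero]
      simp only [hΦ, Finset.mem_filter, Finset.mem_univ, true_and, not_not] at h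
      exact h
    · have := hsub (hdΦ e₁ he₁)
      simp only [Finset.mem_filter, Finset.mem_univ, true_and] at this
      exact this hb) (fun e => y e + θ * d e) hθ rfl
  refine ⟨z, hz1, fun e he => ?_, fun w => ?_⟩
  · have : d e = 0 := by
      by_contra h'
      exact (Finset.mem_filter.1 (hdΦ e h')).2 he
    have h2 := hz2 e
    simp only [this, mul_zero, add_zero] at h2
    exact h2 he
  · by_cases hw : w ∈ big
    · have h1 := hz3 w
      have h2 : ∑ e with w ∈ s e, (z e - y e) = ∑ e with w ∈ s e, (z e - (y e + θ * d e)) := by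
        rw [← sub_eq_zero, ← Finset.sum_sub_distrib]
        have : ∀ e, z e - y e - (z e - (y e + θ * d e)) = θ * d e := fun e => by ring
        simp_rw [this, ← Finset.mul_sum, hdw w hw, mul_zero]
      rw [h2]; exact h1
    -- A set with at most two floating elements needs no constraint: each of them changes by less
    -- than 1 in the whole remaining process and nothing else in the set moves.
    · have hw' : (Φ.filter fun e => w ∈ s e).card ≤ 2 := by
        simp only [hbig, Finset.mem_filter, Finset.mem_univ, true_and] at hw
        omega
      have hz2' : ∀ e, e ∉ Φ → z e - y e = 0 := by
        intro e he
        have hd0 : d e = 0 := by by_contra h'; exact he (hdΦ e h')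
        have h2 := hz2 e
        simp only [hd0, mul_zero, add_zero] at h2
        simp only [hΦ, Finset.mem_filter, Finset.mem_univ, true_and, not_not] at he
        rw [h2 he, sub_self]
      have h2 : ∑ e with w ∈ s e, (z e - y e) = ∑ e ∈ Φ.filter (fun e => w ∈ s e), (z e - y e) := by
        symm
        refine Finset.sum_subset (Finset.filter_subset_filter _ (Finset.subset_univ _)) ?_
        intro e he he'
        refine hz2' e fun h => he' ?_
        simp only [Finset.mem_filter] at he ⊢
        exact ⟨h, he.2⟩
      rw [h2]
      rcases (Φ.filter fun e => w ∈ s e).eq_empty_or_nonempty with h0 | h0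
      · simp [h0]
      refine lt_of_le_of_lt (Finset.abs_sum_le_sum_abs _ _) ?_
      calc ∑ e ∈ Φ.filter (fun e => w ∈ s e), |z e - y e|
          < ∑ e ∈ Φ.filter (fun e => w ∈ s e), (1 : ℝ) := by
            refine Finset.sum_lt_sum_of_nonempty h0 fun e he => ?_
            have := hfloat e (Finset.mem_filter.1 he).1
            rcases hz1 e with h | h <;> rw [h, abs_lt] <;> constructor <;> linarith
        _ = ((Φ.filter fun e => w ∈ s e).card : ℝ) := by simp
        _ ≤ 2 := by exact_mod_cast hw'

/-- A half-integral assignment (doubled, so with values `0, 1, 2`) on a bipartite graph, in which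
every left vertex attains one of two prescribed values around the middle and every right vertex
stays within a half of its middle value. -/
theorem exists_half_integral {α β : Type*} [Fintype α] [DecidableEq α] [DecidableEq β]
    (N : α → Finset β) (tl tu : α → ℕ)
    (h1 : ∀ u, (N u).card ≤ 4 * tl u) (h2 : ∀ u, 2 * tl u ≤ (N u).card)
    (h3 : ∀ u, (N u).card ≤ 2 * tu u) (h4 : ∀ u, 4 * tu u ≤ 3 * (N u).card) :
    ∃ Y : α → β → ℤ, (∀ u v, 0 ≤ Y u v ∧ Y u v ≤ 2) ∧
      (∀ u, ∑ v ∈ N u, Y u v = 2 * tl u ∨ ∑ v ∈ N u, Y u v = 2 * tu u) ∧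
      ∀ v, ∑ u with v ∈ N u, Y u v = ((Finset.univ.filter fun u => v ∈ N u).card : ℤ) ∨
        ∑ u with v ∈ N u, Y u v = ((Finset.univ.filter fun u => v ∈ N u).card : ℤ) + 1 := by
  set D : β → ℤ := fun v => ((Finset.univ.filter fun u => v ∈ N u).card : ℤ) with hD
  suffices H : ∀ S : Finset α, ∃ Y : α → β → ℤ, (∀ u v, 0 ≤ Y u v ∧ Y u v ≤ 2) ∧
      (∀ u ∈ S, ∑ v ∈ N u, Y u v = 2 * tl u ∨ ∑ v ∈ N u, Y u v = 2 * tu u) ∧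
      (∀ u, u ∉ S → ∀ v, Y u v = 1) ∧
      ∀ v, ∑ u with v ∈ N u, Y u v = D v ∨ ∑ u with v ∈ N u, Y u v = D v + 1 by
    obtain ⟨Y, a, b, _, c⟩ := H Finset.univ
    exact ⟨Y, a, fun u => b u (Finset.mem_univ u), c⟩
  -- Left vertices are treated one at a time, starting from Y = 1. The invariant is that each right
  -- sum is D v or D v + 1.
  intro S
  induction S using Finset.induction_on with
  | empty =>
    exact ⟨fun _ _ => 1, by simp, by simp, by simp, fun v => Or.inl (by simp [hD])⟩
  | insert u₀ S hu₀ ih =>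
    obtain ⟨Y, hY, hYS, hY1, hYv⟩ := ih
    have key : ∀ (K : Finset β) (c : ℤ), K ⊆ N u₀ → 0 ≤ c → c ≤ 2 →
        (((N u₀).card : ℤ) + (c - 1) * K.card = 2 * tl u₀ ∨
          ((N u₀).card : ℤ) + (c - 1) * K.card = 2 * tu u₀) →
        (∀ v ∈ K, ∑ u with v ∈ N u, Y u v + (c - 1) = D v ∨
          ∑ u with v ∈ N u, Y u v + (c - 1) = D v + 1) →
        ∃ Y : α → β → ℤ, (∀ u v, 0 ≤ Y u v ∧ Y u v ≤ 2) ∧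
          (∀ u ∈ insert u₀ S, ∑ v ∈ N u, Y u v = 2 * tl u ∨ ∑ v ∈ N u, Y u v = 2 * tu u) ∧
          (∀ u, u ∉ insert u₀ S → ∀ v, Y u v = 1) ∧
          ∀ v, ∑ u with v ∈ N u, Y u v = D v ∨ ∑ u with v ∈ N u, Y u v = D v + 1 := by
      intro K c hK hc0 hc2 hsum hcol
      refine ⟨fun u v => if u = u₀ ∧ v ∈ K then c else Y u v, fun u v => ?_, fun u hu => ?_,
        fun u hu v => ?_, fun v => ?_⟩
      · beta_reduce; split_ifs
        · exact ⟨hc0, hc2⟩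
        · exact hY u v
      · rcases Finset.mem_insert.1 hu with rfl | hu
        · have : ∑ v ∈ N u, (if u = u ∧ v ∈ K then c else Y u v) =
              ((N u).card : ℤ) + (c - 1) * K.card := by
            have h : ∀ v, (if u = u ∧ v ∈ K then c else Y u v)
                = 1 + if v ∈ K then c - 1 else 0 := by
              intro v
              rw [hY1 u hu₀ v]
              by_cases hv : v ∈ K <;> simp [hv]
            rw [Finset.sum_congr rfl fun v _ => h v]
            rw [Finset.sum_add_distrib, Finset.sum_ite_mem, Finset.inter_eq_right.2 hK]
            simp; ring
          rw [this]; exact hsum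
        · have hne : u ≠ u₀ := fun h => hu₀ (h ▸ hu)
          simpa [hne] using hYS u hu
      · have hne : u ≠ u₀ := fun h => hu (h ▸ Finset.mem_insert_self _ _)
        simpa [hne] using hY1 u (fun h => hu (Finset.mem_insert_of_mem h)) v
      · by_cases hv : v ∈ K
        · have : ∑ u with v ∈ N u, (if u = u₀ ∧ v ∈ K then c else Y u v) =
              ∑ u with v ∈ N u, Y u v + (c - 1) := by
            have h : ∀ u, (if u = u₀ ∧ v ∈ K then c else Y u v)
                = Y u v + if u = u₀ then c - 1 else 0 := by
              intro u
              by_cases hu : u = u₀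
              · subst hu; simp [hv, hY1 u hu₀ v]
              · simp [hu]
            rw [Finset.sum_congr rfl fun u _ => h u]
            rw [Finset.sum_add_distrib, Finset.sum_ite_eq']
            simp [hK hv]
          rw [this]; exact hcol v hv
        · simpa [hv] using hYv v
    set Lo := (N u₀).filter fun v => ∑ u with v ∈ N u, Y u v = D v with hLo
    set Hi := (N u₀).filter fun v => ¬ ∑ u with v ∈ N u, Y u v = D v with hHi
    have hcard : Lo.card + Hi.card = (N u₀).card := Finset.card_filter_add_card_filter_not _
    have := h1 u₀
    have := h2 u₀
    have := h3 u₀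
    have := h4 u₀
    -- Majority choice: if at least half of the neighbours of u₀ sit at D, enough of them can be
    -- raised to reach the upper value; otherwise enough of those at D + 1 can be lowered to reach
    -- the lower value. `h1` and `h4` say that half of the neighbours always suffice.
    by_cases hcase : (N u₀).card ≤ 2 * Lo.card
    · obtain ⟨K, hK, hKc⟩ := Finset.exists_subset_card_eq
        (show 2 * tu u₀ - (N u₀).card ≤ Lo.card by omega)
      refine key K 2 (hK.trans (Finset.filter_subset _ _)) (by norm_num) le_rfl (Or.inr ?_) ?_
      · rw [hKc]; omega
      · intro v hv
        right
        rw [(Finset.mem_filter.1 (hK hv)).2]; ring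
    · obtain ⟨K, hK, hKc⟩ := Finset.exists_subset_card_eq
        (show (N u₀).card - 2 * tl u₀ ≤ Hi.card by omega)
      refine key K 0 (hK.trans (Finset.filter_subset _ _)) le_rfl (by norm_num) (Or.inl ?_) ?_
      · rw [hKc]; omega
      · intro v hv
        left
        rw [(hYv v).resolve_left (Finset.mem_filter.1 (hK hv)).2]; ring

/-- An integral version of `exists_half_integral`, with bounded errors. -/
theorem exists_two_valued_subgraph {α β : Type*} [Fintype α] [Fintype β] [DecidableEq α]
    [DecidableEq β] (N : α → Finset β) (tl tu : α → ℕ)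
    (h1 : ∀ u, (N u).card ≤ 4 * tl u) (h2 : ∀ u, 2 * tl u ≤ (N u).card)
    (h3 : ∀ u, (N u).card ≤ 2 * tu u) (h4 : ∀ u, 4 * tu u ≤ 3 * (N u).card) :
    ∃ J : α → Finset β, (∀ u, J u ⊆ N u) ∧
      (∀ u, ((J u).card ≤ tl u + 1 ∧ tl u ≤ (J u).card + 1) ∨
        ((J u).card ≤ tu u + 1 ∧ tu u ≤ (J u).card + 1)) ∧
      ∀ v, (Finset.univ.filter fun u => v ∈ N u).card / 2 ≤
          (Finset.univ.filter fun u => v ∈ J u).card + 1 ∧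
        (Finset.univ.filter fun u => v ∈ J u).card ≤
          (Finset.univ.filter fun u => v ∈ N u).card / 2 + 2 := by
  obtain ⟨Y, hY, hYu, hYv⟩ := exists_half_integral N tl tu h1 h2 h3 h4
  -- Each edge lies in two sets, its row and its column. The strict error bound 2 becomes ±1 on
  -- rows, whose sums before rounding are integers, and the interval from -1 to +2 on columns, whose
  -- sums are D/2 or (D+1)/2.
  obtain ⟨z, hz1, -, hz⟩ := exists_rounding (ι := α × β) (W := α ⊕ β)
    (fun e => if e.2 ∈ N e.1 then {Sum.inl e.1, Sum.inr e.2} else ∅)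
    (fun e => by
      split_ifs
      · exact Finset.card_le_two
      · simp)
    (fun e => (Y e.1 e.2 : ℝ) / 2) (fun e => by
      have h := hY e.1 e.2
      have ha : (0 : ℝ) ≤ Y e.1 e.2 := by exact_mod_cast h.1
      have hb : (Y e.1 e.2 : ℝ) ≤ 2 := by exact_mod_cast h.2
      constructor <;> linarith)
  have hzi : ∀ e, z e = if z e = 1 then 1 else 0 := by
    intro e
    rcases hz1 e with h | h <;> simp [h]
  have hrow : ∀ u, |∑ v ∈ N u, (z (u, v) - (Y u v : ℝ) / 2)| < 2 := by
    intro u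
    have h := hz (Sum.inl u)
    convert h using 2
    refine Finset.sum_bij (fun v _ => (u, v)) ?_ ?_ ?_ ?_
    · intro v hv; simp [hv]
    · intro v _ v' _ h; simpa using h
    · rintro ⟨a, b⟩ hab
      simp only [Finset.mem_filter, Finset.mem_univ, true_and] at hab
      split_ifs at hab with hb
      · simp at hab; subst hab; exact ⟨b, hb, rfl⟩
      · simp at hab
    · intros; rfl
  have hcol : ∀ v, |∑ u with v ∈ N u, (z (u, v) - (Y u v : ℝ) / 2)| < 2 := by
    intro v
    have h := hz (Sum.inr v)
    convert h using 2
    refine Finset.sum_bij (fun u _ => (u, v)) ?_ ?_ ?_ ?_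
    · intro u hu; simp at hu; simp [hu]
    · intro v _ v' _ h; simpa using h
    · rintro ⟨a, b⟩ hab
      simp only [Finset.mem_filter, Finset.mem_univ, true_and] at hab
      split_ifs at hab with hb
      · simp at hab; subst hab; exact ⟨a, by simpa using hb, rfl⟩
      · simp at hab
    · intros; rfl
  refine ⟨fun u => (N u).filter fun v => z (u, v) = 1, fun u => Finset.filter_subset _ _,
    fun u => ?_, fun v => ?_⟩
  · have h := hrow u
    have hs : ∑ v ∈ N u, z (u, v) = (((N u).filter fun v => z (u, v) = 1).card : ℝ) := by
      rw [Finset.card_filter]; push_cast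
      exact Finset.sum_congr rfl fun v _ => hzi _
    rw [Finset.sum_sub_distrib, hs, ← Finset.sum_div, abs_lt] at h
    have aux : ∀ t : ℕ, ∑ v ∈ N u, Y u v = 2 * t →
        (((N u).filter fun v => z (u, v) = 1).card ≤ t + 1 ∧
          t ≤ ((N u).filter fun v => z (u, v) = 1).card + 1) := by
      intro t ht
      have ht' : ∑ v ∈ N u, (Y u v : ℝ) = 2 * t := by exact_mod_cast ht
      rw [ht'] at h
      have ha : (t : ℝ) < ((N u).filter fun v => z (u, v) = 1).card + 2 := by linarith [h.1]
      have hb : (((N u).filter fun v => z (u, v) = 1).card : ℝ) < t + 2 := by linarith [h.2]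
      have ha' : t < ((N u).filter fun v => z (u, v) = 1).card + 2 := by exact_mod_cast ha
      have hb' : ((N u).filter fun v => z (u, v) = 1).card < t + 2 := by exact_mod_cast hb
      omega
    exact (hYu u).imp (aux _) (aux _)
  · have h := hcol v
    have hfil : (Finset.univ.filter fun u => v ∈ (N u).filter fun v => z (u, v) = 1)
        = (Finset.univ.filter fun u => v ∈ N u).filter fun u => z (u, v) = 1 := by
      ext u; simp
    rw [hfil]
    have hs : ∑ u with v ∈ N u, z (u, v) =
        (((Finset.univ.filter fun u => v ∈ N u).filter fun u => z (u, v) = 1).card : ℝ) := by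
      rw [Finset.card_filter]; push_cast
      exact Finset.sum_congr rfl fun v _ => hzi _
    rw [Finset.sum_sub_distrib, hs, ← Finset.sum_div, abs_lt] at h
    set A := ((Finset.univ.filter fun u => v ∈ N u).filter fun u => z (u, v) = 1).card
    set D := (Finset.univ.filter fun u => v ∈ N u).card
    have hr : (D : ℝ) ≤ ∑ u with v ∈ N u, (Y u v : ℝ) ∧
        ∑ u with v ∈ N u, (Y u v : ℝ) ≤ D + 1 := by
      rcases hYv v with e | e
      · have : ∑ u with v ∈ N u, (Y u v : ℝ) = D := by exact_mod_cast e
        rw [this]; constructor <;> linarith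
      · have : ∑ u with v ∈ N u, (Y u v : ℝ) = D + 1 := by exact_mod_cast e
        rw [this]; constructor <;> linarith
    have ha : (D : ℝ) < 2 * A + 4 := by linarith [h.1, hr.1]
    have hb : 2 * (A : ℝ) < D + 5 := by linarith [h.2, hr.2]
    have ha' : D < 2 * A + 4 := by exact_mod_cast ha
    have hb' : 2 * A < D + 5 := by exact_mod_cast hb
    omega

/-! ### Graphs assembled from a symmetric rule and from edges picked by an endpoint -/

open Classical in
/-- The number of neighbours of `v` satisfying `p`. -/
noncomputable def nbrCount {V : Type*} [Fintype V] (G : SimpleGraph V) (v : V) (p : V → Prop) : ℕ :=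
  (Finset.univ.filter fun u => G.Adj v u ∧ p u).card

open Classical in
theorem degCount_eq {V : Type*} [Fintype V] (G : SimpleGraph V) (k : ℕ) :
    degCount G k = (Finset.univ.filter fun v : V => nbrCount G v (fun _ => True) = k).card := by
  unfold degCount nbrCount
  congr 1
  refine Finset.filter_congr fun v _ => ?_
  rw [← SimpleGraph.card_neighborFinset_eq_degree, SimpleGraph.neighborFinset_eq_filter]
  simp

theorem nbrCount_congr {V : Type*} [Fintype V] (G : SimpleGraph V) (v : V) {p q : V → Prop}
    (h : ∀ u, G.Adj v u → (p u ↔ q u)) : nbrCount G v p = nbrCount G v q := by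
  classical
  unfold nbrCount
  congr 1
  exact Finset.filter_congr fun u _ => and_congr_right fun hu => h u hu

section Assembly

variable {V : Type*} [Fintype V] (G : SimpleGraph V)

/-- The spanning subgraph made of the edges of `G` selected by the relation `base`, and the edges
picked by one of their endpoints. -/
def pickGraph (base : V → V → Prop) (hb : ∀ u v, base u v → base v u) (J : V → Finset V) :
    SimpleGraph V where
  Adj u v := G.Adj u v ∧ (base u v ∨ v ∈ J u ∨ u ∈ J v)
  symm := ⟨fun _ _ h => ⟨h.1.symm, h.2.elim (fun h => Or.inl (hb _ _ h)) fun h => Or.inr h.symm⟩⟩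
  loopless := ⟨fun u h => G.loopless.irrefl u h.1⟩

-- No edge is picked from both ends or picked while already in the base, so the three kinds of edges
-- at v are disjoint and their counts add up.
open Classical in
theorem nbrCount_pickGraph (base : V → V → Prop) (hb : ∀ u v, base u v → base v u)
    (J : V → Finset V) (hG : ∀ u, ∀ v ∈ J u, G.Adj u v) (hJ : ∀ u, ∀ v ∈ J u, u ∉ J v)
    (hbJ : ∀ u, ∀ v ∈ J u, ¬ base u v) (v : V) :
    nbrCount (pickGraph G base hb J) v (fun _ => True) = nbrCount G v (base v) + (J v).card +
      (Finset.univ.filter fun u => v ∈ J u).card := by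
  unfold nbrCount
  rw [← Finset.card_union_of_disjoint, ← Finset.card_union_of_disjoint]
  · congr 1
    ext u
    simp only [pickGraph, Finset.mem_filter, Finset.mem_univ, true_and, Finset.mem_union, and_true]
    constructor
    · rintro ⟨h, h1 | h1 | h1⟩
      exacts [Or.inl (Or.inl ⟨h, h1⟩), Or.inl (Or.inr h1), Or.inr h1]
    · rintro ((⟨h, h1⟩ | h1) | h1)
      exacts [⟨h, Or.inl h1⟩, ⟨hG _ _ h1, Or.inr (Or.inl h1)⟩, ⟨(hG _ _ h1).symm, Or.inr (Or.inr h1)⟩]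
  · rw [Finset.disjoint_left]
    intro u hu hu'
    simp only [Finset.mem_filter, Finset.mem_univ, true_and, Finset.mem_union] at hu hu'
    rcases hu with hu | hu
    · exact hbJ _ _ hu' (hb _ _ hu.2)
    · exact hJ _ _ hu hu'
  · rw [Finset.disjoint_left]
    intro u hu hu'
    simp only [Finset.mem_filter, Finset.mem_univ, true_and] at hu
    exact hbJ _ _ hu' hu.2

open Classical in
theorem exists_picks (p : V → V → Prop) (t : V → ℕ) (ht : ∀ v, t v ≤ nbrCount G v (p v)) :
    ∃ J : V → Finset V, (∀ u, ∀ v ∈ J u, G.Adj u v ∧ p u v) ∧ ∀ u, (J u).card = t u := by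
  choose J hJ using fun u => Finset.exists_subset_card_eq (ht u)
  refine ⟨J, fun u v hv => ?_, fun u => (hJ u).2⟩
  simpa using (hJ u).1 hv

/-- Completion of a partial subgraph on the classes `k⁻¹(3)`, `k⁻¹(0)`, `k⁻¹(1)`, `k⁻¹(2)`. Edges of
the relation `R` between class `3` and the others, and edges between the classes `0, 1, 2`, are
free; all other edges touching class `3` follow the rule `thr`. -/
theorem exists_completion (k : V → ℕ) (hk : ∀ v, k v = 0 ∨ k v = 1 ∨ k v = 2 ∨ k v = 3)
    (R thr : V → V → Prop) (hR : ∀ u v, R u v → R v u) (hthr : ∀ u v, thr u v → thr v u)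
    (T T' : V → ℕ)
    (hA : ∀ v, k v = 3 → nbrCount G v (fun u => (k u = 3 ∨ ¬ R v u) ∧ thr v u) ≤ T v ∧
      T v ≤ nbrCount G v (fun u => (k u = 3 ∨ ¬ R v u) ∧ thr v u) +
        nbrCount G v (fun u => k u ≠ 3 ∧ R v u))
    (h0 : ∀ v, k v = 0 → nbrCount G v (fun u => k u = 3 ∧ ¬ R v u ∧ thr v u) +
        nbrCount G v (fun u => k u = 3 ∧ R v u) + nbrCount G v (fun u => k u = 2) / 2 ≤ T v ∧
      T v ≤ nbrCount G v (fun u => k u = 3 ∧ ¬ R v u ∧ thr v u) +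
        nbrCount G v (fun u => k u = 2) / 2 + nbrCount G v (fun u => k u = 1))
    (h1 : ∀ v, k v = 1 → nbrCount G v (fun u => k u = 3 ∧ ¬ R v u ∧ thr v u) +
        nbrCount G v (fun u => k u = 3 ∧ R v u) + nbrCount G v (fun u => k u = 0) ≤ T v ∧
      T v ≤ nbrCount G v (fun u => k u = 3 ∧ ¬ R v u ∧ thr v u) +
        nbrCount G v (fun u => k u = 2))
    (h2 : ∀ v, k v = 2 →
      4 * (nbrCount G v (fun u => k u = 3 ∧ ¬ R v u ∧ thr v u) +
        nbrCount G v (fun u => k u = 3 ∧ R v u) + nbrCount G v (fun u => k u = 1)) +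
        nbrCount G v (fun u => k u = 0) ≤ 4 * T v ∧
      2 * T v ≤ 2 * nbrCount G v (fun u => k u = 3 ∧ ¬ R v u ∧ thr v u) +
        nbrCount G v (fun u => k u = 0))
    (h2' : ∀ v, k v = 2 →
      2 * (nbrCount G v (fun u => k u = 3 ∧ ¬ R v u ∧ thr v u) +
        nbrCount G v (fun u => k u = 3 ∧ R v u) + nbrCount G v (fun u => k u = 1)) +
        nbrCount G v (fun u => k u = 0) ≤ 2 * T' v ∧
      4 * T' v ≤ 4 * nbrCount G v (fun u => k u = 3 ∧ ¬ R v u ∧ thr v u) +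
        3 * nbrCount G v (fun u => k u = 0)) :
    ∃ H ≤ G, (∀ v, k v = 3 ∨ k v = 1 → nbrCount H v (fun _ => True) = T v) ∧
      (∀ v, k v = 0 → T v ≤ nbrCount H v (fun _ => True) + 1 ∧
        nbrCount H v (fun _ => True) ≤ T v + 2) ∧
      (∀ v, k v = 2 → (T v ≤ nbrCount H v (fun _ => True) + 1 ∧
        nbrCount H v (fun _ => True) ≤ T v + 1) ∨ (T' v ≤ nbrCount H v (fun _ => True) + 1 ∧
        nbrCount H v (fun _ => True) ≤ T' v + 1)) := by
  classical
  set f := fun v => nbrCount G v (fun u => (k u = 3 ∨ ¬ R v u) ∧ thr v u) with hf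
  set g := fun v => nbrCount G v (fun u => k u = 3 ∧ ¬ R v u ∧ thr v u) with hg
  set r := fun v => nbrCount G v (fun u => k u = 3 ∧ R v u) with hr
  set D : ℕ → V → ℕ := fun i v => nbrCount G v (fun u => k u = i) with hD
  change ∀ v, k v = 3 → f v ≤ T v ∧ T v ≤ f v + _ at hA
  change ∀ v, k v = 0 → g v + r v + D 2 v / 2 ≤ T v ∧ T v ≤ g v + D 2 v / 2 + D 1 v at h0
  change ∀ v, k v = 1 → g v + r v + D 0 v ≤ T v ∧ T v ≤ g v + D 2 v at h1
  change ∀ v, k v = 2 → 4 * (g v + r v + D 1 v) + D 0 v ≤ 4 * T v ∧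
    2 * T v ≤ 2 * g v + D 0 v at h2
  change ∀ v, k v = 2 → 2 * (g v + r v + D 1 v) + D 0 v ≤ 2 * T' v ∧
    4 * T' v ≤ 4 * g v + 3 * D 0 v at h2'
  have hinle : ∀ (J : V → Finset V) (p : V → V → Prop) (q : V → V → Prop) (i : ℕ)
      (_ : ∀ u, ∀ v ∈ J u, G.Adj u v ∧ p u v)
      (_ : ∀ u v, p u v → k u = i → q v u) (v : V),
      (Finset.univ.filter fun u => k u = i ∧ v ∈ J u).card ≤ nbrCount G v (q v) := by
    intro J p q i hJ hpq v
    refine Finset.card_le_card fun u hu => ?_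
    simp only [Finset.mem_filter, Finset.mem_univ, true_and] at hu ⊢
    exact ⟨(hJ u v hu.2).1.symm, hpq u v (hJ u v hu.2).2 hu.1⟩
  -- the picks of class 3
  obtain ⟨JA, hJA, hJAc⟩ := exists_picks G (fun v u => k u ≠ 3 ∧ R v u)
    -- The subtraction of naturals is not truncated, because `hA` gives f v ≤ T v; the hypotheses
    -- for the other classes play the same role below.
    (fun v => if k v = 3 then T v - f v else 0) (fun v => by
      split_ifs with h
      · have := hA v h; omega
      · exact Nat.zero_le _)
  set inA : V → ℕ := fun v => (Finset.univ.filter fun u => k u = 3 ∧ v ∈ JA u).card with hinA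
  have hinAr : ∀ v, inA v ≤ r v :=
    hinle JA _ (fun v u => k u = 3 ∧ R v u) 3 hJA fun u v h h' => ⟨h', hR _ _ h.2⟩
  -- the picks of class 0
  obtain ⟨J0, hJ0, hJ0c⟩ := exists_picks G (fun v u => k u = 1)
    -- The in-degree from class 2 is not yet known; its guaranteed approximate value D 2 v / 2 is
    -- subtracted in its place. This is the only source of error in class 0.
    (fun v => if k v = 0 then T v - g v - inA v - D 2 v / 2 else 0) (fun v => by
      split_ifs with h
      · have := h0 v h
        change _ ≤ D 1 v
        omega
      · exact Nat.zero_le _)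
  set in0 : V → ℕ := fun v => (Finset.univ.filter fun u => k u = 0 ∧ v ∈ J0 u).card with hin0
  have hin0r : ∀ v, in0 v ≤ D 0 v := hinle J0 _ (fun v u => k u = 0) 0 hJ0 fun u v _ h' => h'
  -- the picks of class 1
  obtain ⟨J1, hJ1, hJ1c⟩ := exists_picks G (fun v u => k u = 2)
    -- Both in-degrees of a class-1 vertex, from classes 3 and 0, are fixed by now, so its target is
    -- reached exactly.
    (fun v => if k v = 1 then T v - g v - inA v - in0 v else 0) (fun v => by
      split_ifs with h
      · have := h1 v h
        change _ ≤ D 2 v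
        omega
      · exact Nat.zero_le _)
  set in1 : V → ℕ := fun v => (Finset.univ.filter fun u => k u = 1 ∧ v ∈ J1 u).card with hin1
  have hin1r : ∀ v, in1 v ≤ D 1 v := hinle J1 _ (fun v u => k u = 1) 1 hJ1 fun u v _ h' => h'
  -- the picks of class 2
  set N : V → Finset V := fun v => if k v = 2 then
    Finset.univ.filter fun u => G.Adj v u ∧ k u = 0 else ∅ with hN
  have hN2 : ∀ v, k v = 2 → (N v).card = D 0 v := by
    intro v hv
    simp only [hN, hv, if_true, hD, nbrCount]
  have hNn : ∀ v, k v ≠ 2 → (N v).card = 0 := by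
    intro v hv
    simp only [hN, hv, if_false, Finset.card_empty]
  set tl : V → ℕ := fun v => if k v = 2 then T v - g v - inA v - in1 v else 0 with htl
  set tu : V → ℕ := fun v => if k v = 2 then T' v - g v - inA v - in1 v else 0 with htu
  have htl2 : ∀ v, k v = 2 → tl v + g v + inA v + in1 v = T v := by
    intro v hv
    have := h2 v hv; have := hinAr v; have := hin1r v
    simp only [htl, hv, if_true]; omega
  have htu2 : ∀ v, k v = 2 → tu v + g v + inA v + in1 v = T' v := by
    intro v hv
    have := h2' v hv; have := hinAr v; have := hin1r v
    simp only [htu, hv, if_true]; omega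
  have htln : ∀ v, k v ≠ 2 → tl v = 0 := fun v hv => by simp only [htl, hv, if_false]
  have htun : ∀ v, k v ≠ 2 → tu v = 0 := fun v hv => by simp only [htu, hv, if_false]
  obtain ⟨J2, hJ2, hJ2c, hJ2v⟩ := exists_two_valued_subgraph N tl tu
    (fun v => by
      by_cases hv : k v = 2
      · have := hN2 v hv; have := htl2 v hv; have := h2 v hv; have := hinAr v; have := hin1r v
        omega
      · have := hNn v hv; have := htln v hv; omega)
    (fun v => by
      by_cases hv : k v = 2
      · have := hN2 v hv; have := htl2 v hv; have := h2 v hv; have := hinAr v; have := hin1r v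
        omega
      · have := hNn v hv; have := htln v hv; omega)
    (fun v => by
      by_cases hv : k v = 2
      · have := hN2 v hv; have := htu2 v hv; have := h2' v hv; have := hinAr v; have := hin1r v
        omega
      · have := hNn v hv; have := htun v hv; omega)
    (fun v => by
      by_cases hv : k v = 2
      · have := hN2 v hv; have := htu2 v hv; have := h2' v hv; have := hinAr v; have := hin1r v
        omega
      · have := hNn v hv; have := htun v hv; omega)
  have hJ2' : ∀ u, ∀ v ∈ J2 u, k u = 2 ∧ G.Adj u v ∧ k v = 0 := by
    intro u v hv
    have h := hJ2 u hv
    simp only [hN] at h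
    split_ifs at h with hu
    · simp only [Finset.mem_filter, Finset.mem_univ, true_and] at h
      exact ⟨hu, h⟩
    · simp at h
  set J : V → Finset V := fun v => if k v = 3 then JA v else if k v = 0 then J0 v else
    if k v = 1 then J1 v else J2 v with hJ
  have e3 : ∀ v, k v = 3 → J v = JA v := fun v h => by simp [hJ, h]
  have e0 : ∀ v, k v = 0 → J v = J0 v := fun v h => by simp [hJ, h]
  have e1 : ∀ v, k v = 1 → J v = J1 v := fun v h => by simp [hJ, h]
  have e2 : ∀ v, k v = 2 → J v = J2 v := fun v h => by simp [hJ, h]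
  have hJall : ∀ u, ∀ v ∈ J u, G.Adj u v ∧ ((k u = 3 ∧ k v ≠ 3 ∧ R u v) ∨ (k u = 0 ∧ k v = 1) ∨
      (k u = 1 ∧ k v = 2) ∨ (k u = 2 ∧ k v = 0)) := by
    intro u v hv
    rcases hk u with h | h | h | h
    · rw [e0 u h] at hv; exact ⟨(hJ0 u v hv).1, Or.inr (Or.inl ⟨h, (hJ0 u v hv).2⟩)⟩
    · rw [e1 u h] at hv; exact ⟨(hJ1 u v hv).1, Or.inr (Or.inr (Or.inl ⟨h, (hJ1 u v hv).2⟩))⟩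
    · rw [e2 u h] at hv
      exact ⟨(hJ2' u v hv).2.1, Or.inr (Or.inr (Or.inr ⟨h, (hJ2' u v hv).2.2⟩))⟩
    · rw [e3 u h] at hv; exact ⟨(hJA u v hv).1, Or.inl ⟨h, (hJA u v hv).2⟩⟩
  set base : V → V → Prop := fun u v => thr u v ∧ ((k u = 3 ∧ k v = 3) ∨
    ((k u = 3 ∨ k v = 3) ∧ ¬ R u v)) with hbase
  have hbsymm : ∀ u v, base u v → base v u := by
    rintro u v ⟨h, h'⟩
    refine ⟨hthr _ _ h, h'.imp (fun h => h.symm) fun h => ⟨h.1.symm, fun h' => h.2 (hR _ _ h')⟩⟩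
  have hdeg := nbrCount_pickGraph G base hbsymm J (fun u v hv => (hJall u v hv).1)
    -- The allowed directions 3 → {0, 1, 2} and 0 → 1 → 2 → 0 never contain a pair of classes
    -- together with its reverse.
    (fun u v hv hu => by
      have h1 := (hJall u v hv).2
      have h2 := (hJall v u hu).2
      omega)
    (fun u v hv hb => by
      have h1 := (hJall u v hv).2
      obtain ⟨-, hb⟩ := hb
      rcases h1 with h1 | h1 | h1 | h1
      · rcases hb with hb | hb
        · exact h1.2.1 hb.2
        · exact hb.2 h1.2.2
      all_goals omega)
  have hbase3 : ∀ v, k v = 3 → nbrCount G v (base v) = f v := by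
    intro v hv
    refine nbrCount_congr _ _ fun u _ => ?_
    simp only [hbase, hv, true_and, true_or]
    tauto
  have hbasen : ∀ v, k v ≠ 3 → nbrCount G v (base v) = g v := by
    intro v hv
    refine nbrCount_congr _ _ fun u _ => ?_
    simp only [hbase, hv, false_and, false_or]
    tauto
  -- in-degrees
  have hsplit : ∀ v (i j : ℕ), i ≠ j → (∀ u, v ∈ J u → k u = i ∨ k u = j) →
      (Finset.univ.filter fun u => v ∈ J u).card =
        (Finset.univ.filter fun u => k u = i ∧ v ∈ J u).card +
        (Finset.univ.filter fun u => k u = j ∧ v ∈ J u).card := by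
    intro v i j hij h
    rw [← Finset.card_union_of_disjoint]
    · congr 1
      ext u
      simp only [Finset.mem_filter, Finset.mem_univ, true_and, Finset.mem_union]
      have := h u
      tauto
    · rw [Finset.disjoint_left]
      intro u hu hu'
      simp only [Finset.mem_filter, Finset.mem_univ, true_and] at hu hu'
      omega
  have hinJ : ∀ (i : ℕ) (J' : V → Finset V), (∀ u, k u = i → J u = J' u) → ∀ v,
      (Finset.univ.filter fun u => k u = i ∧ v ∈ J u) =
      (Finset.univ.filter fun u => k u = i ∧ v ∈ J' u) := by
    intro i J' h v
    refine Finset.filter_congr fun u _ => and_congr_right fun hu => ?_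
    rw [h u hu]
  refine ⟨pickGraph G base hbsymm J, fun u v h => h.1, ?_, ?_, ?_⟩
  · rintro v (hv | hv)
    · rw [hdeg v, hbase3 v hv, e3 v hv, hJAc v, if_pos hv]
      have h0 : (Finset.univ.filter fun u => v ∈ J u) = ∅ := by
        rw [Finset.filter_eq_empty_iff]
        intro u _ hu
        have := (hJall u v hu).2
        omega
      have := hA v hv
      rw [h0, Finset.card_empty]; omega
    · rw [hdeg v, hbasen v (by omega), e1 v hv, hJ1c v, if_pos hv,
        hsplit v 3 0 (by norm_num) (fun u hu => by have := (hJall u v hu).2; omega),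
        hinJ 3 JA e3, hinJ 0 J0 e0]
      change g v + _ + (inA v + in0 v) = _
      have := h1 v hv; have := hinAr v; have := hin0r v
      omega
  · intro v hv
    rw [hdeg v, hbasen v (by omega), e0 v hv, hJ0c v, if_pos hv,
        hsplit v 3 2 (by norm_num) (fun u hu => by have := (hJall u v hu).2; omega),
        hinJ 3 JA e3, hinJ 2 J2 e2]
    have hc1 : (Finset.univ.filter fun u => k u = 2 ∧ v ∈ J2 u) =
        Finset.univ.filter fun u => v ∈ J2 u := by
      refine Finset.filter_congr fun u _ => ?_
      exact ⟨fun h => h.2, fun h => ⟨(hJ2' u v h).1, h⟩⟩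
    have hc2 : (Finset.univ.filter fun u => v ∈ N u).card = D 2 v := by
      simp only [hD, nbrCount]
      congr 1
      refine Finset.filter_congr fun u _ => ?_
      by_cases hu : k u = 2
      · simp [hN, hu, hv, G.adj_comm]
      · simp [hN, hu]
    have hc3 := hJ2v v
    rw [hc2] at hc3
    rw [hc1]
    change T v ≤ g v + _ + (inA v + _) + 1 ∧ g v + _ + (inA v + _) ≤ _
    have := h0 v hv; have := hinAr v
    omega
  · intro v hv
    rw [hdeg v, hbasen v (by omega), e2 v hv,
        hsplit v 3 1 (by norm_num) (fun u hu => by have := (hJall u v hu).2; omega),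
        hinJ 3 JA e3, hinJ 1 J1 e1]
    change (_ ≤ g v + _ + (inA v + in1 v) + 1 ∧ g v + _ + (inA v + in1 v) ≤ _) ∨
      (_ ≤ g v + _ + (inA v + in1 v) + 1 ∧ g v + _ + (inA v + in1 v) ≤ _)
    have := hJ2c v; have := htl2 v hv; have := htu2 v hv
    omega

end Assembly

/-! ### Chernoff bounds for random labels, in counting form -/

open Classical in
/-- Chernoff's bound for a sum of independent indicators, in counting form. -/
theorem card_filter_le_exp {V X : Type*} [Fintype V] [Fintype X] [Nonempty X]
    (B : V → Finset X) {l μ s : ℝ} (hl0 : 0 ≤ l) (hl1 : l ≤ 1)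
    (hμ : ∑ v, ((B v).card : ℝ) / Fintype.card X ≤ μ) :
    ((Finset.univ.filter fun ω : V → X =>
      μ + s ≤ ((Finset.univ.filter fun v => ω v ∈ B v).card : ℝ)).card : ℝ) ≤
      (Fintype.card X : ℝ) ^ Fintype.card V * Real.exp (-(l * s) + l ^ 2 * μ) := by
  have hX : (0 : ℝ) < Fintype.card X := by exact_mod_cast Fintype.card_pos
  have hprod : ∑ ω : V → X, Real.exp (l * ((Finset.univ.filter fun v => ω v ∈ B v).card : ℝ))
      = ∏ v, ∑ x, Real.exp (l * if x ∈ B v then 1 else 0) := by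
    rw [Finset.prod_univ_sum, Fintype.piFinset_univ]
    refine Finset.sum_congr rfl fun ω _ => ?_
    rw [← Real.exp_sum, ← Finset.mul_sum, Finset.card_filter]
    push_cast
    rfl
  have hfac : ∀ v, ∑ x, Real.exp (l * if x ∈ B v then 1 else 0) ≤
      (Fintype.card X : ℝ) * Real.exp ((l + l ^ 2) * (((B v).card : ℝ) / Fintype.card X)) := by
    intro v
    have h1 : ∀ x, Real.exp (l * if x ∈ B v then 1 else 0)
        = 1 + if x ∈ B v then Real.exp l - 1 else 0 := by
      intro x; split_ifs <;> simp
    have h2 : Real.exp l - 1 ≤ l + l ^ 2 := by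
      have := Real.abs_exp_sub_one_sub_id_le (x := l) (by rw [abs_of_nonneg hl0]; exact hl1)
      linarith [(abs_le.1 this).2]
    simp_rw [h1]
    rw [Finset.sum_add_distrib, Finset.sum_ite_mem, Finset.univ_inter]
    simp only [Finset.sum_const, Finset.card_univ, nsmul_eq_mul, mul_one]
    have h3 := Real.add_one_le_exp ((l + l ^ 2) * (((B v).card : ℝ) / Fintype.card X))
    calc (Fintype.card X : ℝ) + (B v).card * (Real.exp l - 1)
        ≤ (Fintype.card X : ℝ) + (B v).card * (l + l ^ 2) := by gcongr
      _ = (Fintype.card X : ℝ) * ((l + l ^ 2) * (((B v).card : ℝ) / Fintype.card X) + 1) := by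
          field_simp; ring
      _ ≤ _ := by gcongr
  have hmgf : ∑ ω : V → X, Real.exp (l * ((Finset.univ.filter fun v => ω v ∈ B v).card : ℝ)) ≤
      (Fintype.card X : ℝ) ^ Fintype.card V * Real.exp ((l + l ^ 2) * μ) := by
    rw [hprod]
    calc ∏ v, ∑ x, Real.exp (l * if x ∈ B v then 1 else 0)
        ≤ ∏ v : V, ((Fintype.card X : ℝ) *
            Real.exp ((l + l ^ 2) * (((B v).card : ℝ) / Fintype.card X))) :=
          Finset.prod_le_prod (fun v _ => Finset.sum_nonneg fun x _ => (Real.exp_pos _).le)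
            fun v _ => hfac v
      _ = (Fintype.card X : ℝ) ^ Fintype.card V *
            Real.exp ((l + l ^ 2) * ∑ v, ((B v).card : ℝ) / Fintype.card X) := by
          rw [Finset.prod_mul_distrib, ← Real.exp_sum, ← Finset.mul_sum]
          simp
      _ ≤ _ := by gcongr
  set bad := Finset.univ.filter fun ω : V → X =>
      μ + s ≤ ((Finset.univ.filter fun v => ω v ∈ B v).card : ℝ) with hbad
  have hlow : (bad.card : ℝ) * Real.exp (l * (μ + s)) ≤
      ∑ ω : V → X, Real.exp (l * ((Finset.univ.filter fun v => ω v ∈ B v).card : ℝ)) := by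
    rw [← nsmul_eq_mul, ← Finset.sum_const]
    calc ∑ ω ∈ bad, Real.exp (l * (μ + s))
        ≤ ∑ ω ∈ bad, Real.exp (l * ((Finset.univ.filter fun v => ω v ∈ B v).card : ℝ)) := by
          refine Finset.sum_le_sum fun ω hω => ?_
          have := (Finset.mem_filter.1 hω).2
          gcongr
      _ ≤ _ := Finset.sum_le_sum_of_subset_of_nonneg (Finset.subset_univ _)
          fun _ _ _ => (Real.exp_pos _).le
  have h := hlow.trans hmgf
  rw [← le_div_iff₀ (Real.exp_pos _), mul_div_assoc, ← Real.exp_sub] at h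
  refine h.trans (le_of_eq ?_)
  congr 2
  ring

-- Union bound over the upper tails: the exponentials bound the proportions of bad labellings, and
-- these sum to less than 1.
open Classical in
theorem exists_avoiding {V X E : Type*} [Fintype V] [Fintype X] [Nonempty X] [Fintype E]
    (B : E → V → Finset X) (l μ s : E → ℝ) (hl0 : ∀ e, 0 ≤ l e) (hl1 : ∀ e, l e ≤ 1)
    (hμ : ∀ e, ∑ v, ((B e v).card : ℝ) / Fintype.card X ≤ μ e)
    (hsum : ∑ e, Real.exp (-(l e * s e) + l e ^ 2 * μ e) < 1) :
    ∃ ω : V → X, ∀ e, ((Finset.univ.filter fun v => ω v ∈ B e v).card : ℝ) < μ e + s e := by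
  by_contra hcon
  push Not at hcon
  have hX : (0 : ℝ) < Fintype.card X := by exact_mod_cast Fintype.card_pos
  set bad : E → Finset (V → X) := fun e => Finset.univ.filter fun ω : V → X =>
      μ e + s e ≤ ((Finset.univ.filter fun v => ω v ∈ B e v).card : ℝ) with hbad
  have h1 : (Finset.univ : Finset (V → X)) ⊆ Finset.univ.biUnion bad := by
    intro ω _
    obtain ⟨e, he⟩ := hcon ω
    simp only [Finset.mem_biUnion, Finset.mem_univ, true_and]
    exact ⟨e, by simpa [hbad] using he⟩
  have h2 : (Fintype.card X : ℝ) ^ Fintype.card V ≤ ∑ e, ((bad e).card : ℝ) := by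
    have := (Finset.card_le_card h1).trans Finset.card_biUnion_le
    rw [Finset.card_univ, Fintype.card_fun] at this
    exact_mod_cast this
  have h3 : ∑ e, ((bad e).card : ℝ) ≤ (Fintype.card X : ℝ) ^ Fintype.card V *
      ∑ e, Real.exp (-(l e * s e) + l e ^ 2 * μ e) := by
    rw [Finset.mul_sum]
    exact Finset.sum_le_sum fun e _ => card_filter_le_exp (B e) (hl0 e) (hl1 e) (hμ e)
  have h4 : (0 : ℝ) < (Fintype.card X : ℝ) ^ Fintype.card V := by positivity
  nlinarith

open Classical in
/-- There is a labelling of the vertices for which all neighbourhoods contain about the expected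
number of labels from each set of a given family, and finitely many further counts are not much
larger than expected. -/
theorem exists_labelling {V X ι κ : Type*} [Fintype V] [Fintype X] [Nonempty X] [Fintype ι]
    [Fintype κ] (G : SimpleGraph V) (S : ι → Finset X) (B : κ → V → Finset X) (l μ s : κ → ℝ)
    (hl0 : ∀ e, 0 ≤ l e) (hl1 : ∀ e, l e ≤ 1)
    (hμ : ∀ e, ∑ v, ((B e v).card : ℝ) / Fintype.card X ≤ μ e)
    {τ δ : ℝ} (hτ0 : 0 ≤ τ) (hτ1 : τ ≤ 1) (hδ : ∀ v, δ ≤ nbrCount G v (fun _ => True))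
    (hsum : 2 * Fintype.card V * Fintype.card ι * Real.exp (-(τ ^ 2 * δ / 4)) +
      ∑ e, Real.exp (-(l e * s e) + l e ^ 2 * μ e) < 1) :
    ∃ ω : V → X, (∀ v i, |(nbrCount G v (fun u => ω u ∈ S i) : ℝ) -
        nbrCount G v (fun _ => True) * (((S i).card : ℝ) / Fintype.card X)| ≤
          τ * nbrCount G v (fun _ => True)) ∧
      ∀ e, ((Finset.univ.filter fun v => ω v ∈ B e v).card : ℝ) ≤ μ e + s e := by
  have hX : (0 : ℝ) < Fintype.card X := by exact_mod_cast Fintype.card_pos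
  set d : V → ℝ := fun v => nbrCount G v (fun _ => True) with hd
  -- Complements supply the lower tails: too few labels in `S i` means too many in its complement.
  let S' : ι × Bool → Finset X := fun i => if i.2 then S i.1 else (S i.1)ᶜ
  let B₁ : V × ι × Bool → V → Finset X := fun e u => if G.Adj e.1 u then S' e.2 else ∅
  have hB₁ : ∀ e : V × ι × Bool, ∑ u, ((B₁ e u).card : ℝ) / Fintype.card X =
      d e.1 * (((S' e.2).card : ℝ) / Fintype.card X) := by
    intro e
    have : ∀ u, ((B₁ e u).card : ℝ) / Fintype.card X =
        if G.Adj e.1 u then ((S' e.2).card : ℝ) / Fintype.card X else 0 := by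
      intro u; simp only [B₁]; split_ifs <;> simp
    simp_rw [this]
    rw [← Finset.sum_filter, Finset.sum_const, nsmul_eq_mul]
    simp only [hd, nbrCount, and_true]
  obtain ⟨ω, hω⟩ := exists_avoiding (E := (V × ι × Bool) ⊕ κ) (Sum.elim B₁ B)
    -- With parameter τ/2 and deviation τd, the exponent is at most -τ²d/2 + τ²d/4 = -τ²d/4.
    (Sum.elim (fun _ => τ / 2) l)
    (Sum.elim (fun e => d e.1 * (((S' e.2).card : ℝ) / Fintype.card X)) μ)
    (Sum.elim (fun e => τ * d e.1) s)
    (by rintro (e | e)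
        · simp only [Sum.elim_inl]; linarith
        · exact hl0 e)
    (by rintro (e | e)
        · simp only [Sum.elim_inl]; linarith
        · exact hl1 e)
    (by rintro (e | e)
        · simp only [Sum.elim_inl]; exact (hB₁ e).le
        · exact hμ e)
    (by
      rw [Fintype.sum_sum_type]
      simp only [Sum.elim_inl, Sum.elim_inr]
      refine lt_of_le_of_lt (add_le_add_left ?_ _) hsum
      have : ∀ e : V × ι × Bool, Real.exp (-(τ / 2 * (τ * d e.1)) +
          (τ / 2) ^ 2 * (d e.1 * (((S' e.2).card : ℝ) / Fintype.card X))) ≤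
          Real.exp (-(τ ^ 2 * δ / 4)) := by
        intro e
        rw [Real.exp_le_exp]
        have h1 : ((S' e.2).card : ℝ) / Fintype.card X ≤ 1 := by
          rw [div_le_one hX]; exact_mod_cast Finset.card_le_univ _
        have h2 : δ ≤ d e.1 := hδ e.1
        have h3 : 0 ≤ d e.1 := Nat.cast_nonneg _
        have h4 : d e.1 * (((S' e.2).card : ℝ) / Fintype.card X) ≤ d e.1 :=
          mul_le_of_le_one_right h3 h1
        nlinarith [mul_le_mul_of_nonneg_left h4 (sq_nonneg τ),
          mul_le_mul_of_nonneg_left h2 (sq_nonneg τ)]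
      refine (Finset.sum_le_sum fun e _ => this e).trans (le_of_eq ?_)
      simp only [Finset.sum_const, Finset.card_univ, nsmul_eq_mul, Fintype.card_prod,
        Fintype.card_bool]
      push_cast
      ring)
  have hcnt : ∀ v i b, (nbrCount G v (fun u => ω u ∈ S' (i, b)) : ℝ) <
      d v * (((S' (i, b)).card : ℝ) / Fintype.card X) + τ * d v := by
    intro v i b
    refine lt_of_le_of_lt (le_of_eq ?_) (hω (Sum.inl (v, i, b)))
    unfold nbrCount
    congr 2
    ext u
    simp only [Sum.elim_inl, B₁, Finset.mem_filter, Finset.mem_univ, true_and]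
    split_ifs with h <;> simp [h]
  refine ⟨ω, fun v i => ?_, fun e => (hω (Sum.inr e)).le⟩
  have h1 := hcnt v i true
  have h2 := hcnt v i false
  simp only [S', if_true, Bool.false_eq_true, if_false] at h1 h2
  have h3 : (nbrCount G v (fun u => ω u ∈ S i) : ℝ) + nbrCount G v (fun u => ω u ∈ (S i)ᶜ) = d v := by
    simp only [hd, nbrCount]
    rw [← Nat.cast_add, ← Finset.card_union_of_disjoint]
    · congr 2
      ext u
      simp only [Finset.mem_union, Finset.mem_filter, Finset.mem_univ, true_and, Finset.mem_compl]
      tauto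
    · rw [Finset.disjoint_left]
      intro u hu hu'
      simp only [Finset.mem_filter, Finset.mem_univ, true_and, Finset.mem_compl] at hu hu'
      exact hu'.2 hu.2
  have h4 : (((S i)ᶜ.card : ℕ) : ℝ) / Fintype.card X = 1 - ((S i).card : ℝ) / Fintype.card X := by
    rw [Finset.card_compl, Nat.cast_sub (Finset.card_le_univ _), sub_div, div_self hX.ne']
  rw [h4] at h2
  rw [abs_le]
  constructor <;> nlinarith

/-! ### Slots, and the deterministic part of the construction -/

/-- Distributing the elements of a set over slots in consecutive blocks. -/
theorem exists_slots {V : Type*} [Finite V] (p : V → Prop) (j : V → ℕ) (w m : ℕ)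
    (h : ∀ i, {v | p v ∧ j v = i}.ncard ≤ w * m) :
    ∃ t : V → ℕ, (∀ v, p v → j v * w ≤ t v ∧ t v < (j v + 1) * w) ∧
      ∀ i, {v | p v ∧ t v = i}.ncard ≤ m := by
  classical
  have hfin : ∀ i, ∃ e : V → ℕ, (∀ v, p v ∧ j v = i → e v < w * m) ∧
      ∀ v v', (p v ∧ j v = i) → (p v' ∧ j v' = i) → e v = e v' → v = v' := by
    intro i
    have := (Set.toFinite {v | p v ∧ j v = i}).to_subtype
    let e := Finite.equivFinOfCardEq (Nat.card_coe_set_eq {v | p v ∧ j v = i})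
    refine ⟨fun v => if hv : p v ∧ j v = i then e ⟨v, hv⟩ else 0, fun v hv => ?_, ?_⟩
    · beta_reduce; rw [dif_pos hv]; exact (e ⟨v, hv⟩).2.trans_le (h i)
    · intro v v' hv hv' hvv
      beta_reduce at hvv
      rw [dif_pos hv, dif_pos hv'] at hvv
      have := e.injective (Fin.ext hvv)
      simpa using this
  choose e he hinj using hfin
  -- The elements of block j are numbered and cut into runs of m; at most w runs are needed, one for
  -- each slot of the block.
  refine ⟨fun v => j v * w + e (j v) v / m, fun v hv => ?_, fun i => ?_⟩
  · have h1 := he (j v) v ⟨hv, rfl⟩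
    have h2 : e (j v) v / m < w := Nat.div_lt_of_lt_mul (by rwa [mul_comm m w])
    constructor
    · exact Nat.le_add_right _ _
    · beta_reduce; rw [add_mul, one_mul]; omega
  · rcases Nat.eq_zero_or_pos m with rfl | hm
    · have : {v | p v ∧ j v * w + e (j v) v / 0 = i} = ∅ := by
        ext v
        simp only [Set.mem_ofPred_eq, Set.mem_empty_iff_false, iff_false]
        rintro ⟨hv, -⟩
        have := he (j v) v ⟨hv, rfl⟩
        omega
      rw [this]; simp
    have key : ∀ v, p v → j v * w + e (j v) v / m = i → j v = i / w ∧ e (j v) v / m = i % w := by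
      intro v hv hi
      have h1 := he (j v) v ⟨hv, rfl⟩
      have h2 : e (j v) v / m < w := Nat.div_lt_of_lt_mul (by rwa [mul_comm m w])
      have h3 : i / w = j v ∧ i % w = e (j v) v / m := by
        rw [Nat.div_mod_unique (lt_of_le_of_lt (Nat.zero_le _) h2)]
        exact ⟨by rw [mul_comm w, add_comm]; exact hi, h2⟩
      exact ⟨h3.1.symm, h3.2.symm⟩
    calc {v | p v ∧ j v * w + e (j v) v / m = i}.ncard
        ≤ ((Finset.Ico (i % w * m) ((i % w + 1) * m) : Finset ℕ) : Set ℕ).ncard := by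
          refine Set.ncard_le_ncard_of_injOn (fun v => e (i / w) v) ?_ ?_ (Finset.finite_toSet _)
          · rintro v ⟨hv, hi⟩
            obtain ⟨h1, h2⟩ := key v hv hi
            rw [h1] at h2
            simp only [Finset.coe_Ico, Set.mem_Ico]
            rw [← h2]
            exact ⟨Nat.div_mul_le_self _ _, by rw [mul_comm]; exact Nat.lt_mul_div_succ _ hm⟩
          · rintro v ⟨hv, hi⟩ v' ⟨hv', hi'⟩ hvv
            exact hinj _ v v' ⟨hv, (key v hv hi).1⟩ ⟨hv', (key v' hv' hi').1⟩ hvv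
      _ = m := by
          rw [Set.ncard_coe_finset, Nat.card_Ico, add_mul, one_mul]; omega

theorem floor_window {z L : ℝ} (hL : 0 < L) (hz : 0 ≤ z) :
    (⌊z / L⌋₊ : ℝ) * L ≤ z ∧ z < ((⌊z / L⌋₊ : ℝ) + 1) * L :=
  ⟨by rw [← le_div_iff₀ hL]; exact Nat.floor_le (div_nonneg hz hL.le),
    by rw [← div_lt_iff₀ hL]; exact Nat.lt_floor_add_one _⟩

/-- Deterministic core of the construction: if the labels behave like random ones, then all vertices
can be sent to prescribed slots. -/
theorem exists_subgraph_of_typical {V : Type*} [Fintype V] (G : SimpleGraph V) (k : V → ℕ)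
    (hk : ∀ v, k v = 0 ∨ k v = 1 ∨ k v = 2 ∨ k v = 3) (R thr : V → V → Prop)
    (hR : ∀ u v, R u v → R v u) (hthr : ∀ u v, thr u v → thr v u) (ξ d : V → ℝ)
    (hξ0 : ∀ v, 0 ≤ ξ v) {p ρ σ τ δ : ℝ} (hp : 0 < p) (hp1 : p ≤ 1 / 200)
    (hρ : ρ = 73 * p * (p / 32)) (hρ1 : ρ ≤ 1) (hσ : 0 ≤ σ) (hτ : τ = p ^ 2 / 16)
    (hδ : ∀ v, δ ≤ d v) (hδ0 : 0 < δ)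
    (hf : ∀ v, k v = 3 → |(nbrCount G v (fun u => (k u = 3 ∨ ¬ R v u) ∧ thr v u) : ℝ) -
      ξ v * (1 - ρ) * d v| ≤ τ * d v)
    (hrA : ∀ v, k v = 3 → (ρ - τ) * d v ≤ (nbrCount G v (fun u => k u ≠ 3 ∧ R v u) : ℝ))
    (hg : ∀ v, |(nbrCount G v (fun u => k u = 3 ∧ ¬ R v u ∧ thr v u) : ℝ) -
      ξ v * σ * d v| ≤ τ * d v)
    (hr : ∀ v, (nbrCount G v (fun u => k u = 3 ∧ R v u) : ℝ) ≤ (p / 32 + τ) * d v)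
    (hD0 : ∀ v, |(nbrCount G v (fun u => k u = 0) : ℝ) - 8 * p * d v| ≤ τ * d v)
    (hD1 : ∀ v, |(nbrCount G v (fun u => k u = 1) : ℝ) - p * d v| ≤ τ * d v)
    (hD2 : ∀ v, |(nbrCount G v (fun u => k u = 2) : ℝ) - 64 * p * d v| ≤ τ * d v)
    (w w' mA mC : ℕ) (hw0 : 0 < w) (hw : (w : ℝ) ≤ p ^ 2 * δ / 2) (hw0' : 0 < w')
    (hw' : 32 * (w' : ℝ) ≤ p * δ / 10)
    (hmA : ∀ j : ℕ, {v | k v = 3 ∧ ⌊(ξ v * (1 - ρ) + ρ / 2) * d v / w⌋₊ = j}.ncard ≤ w * mA)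
    (hm0 : ∀ j : ℕ,
      {v | k v = 0 ∧ ⌊(ξ v * σ + 65 / 2 * p) * d v / (32 * w')⌋₊ = j}.ncard ≤ w' * mC)
    (hm1 : ∀ j : ℕ,
      {v | k v = 1 ∧ ⌊(ξ v * σ + 32 * p) * d v / (32 * w')⌋₊ = j}.ncard ≤ w' * mC)
    (hm2 : ∀ j : ℕ,
      {v | k v = 2 ∧ ⌊(ξ v * σ + 7 / 2 * p) * d v / (32 * w')⌋₊ = j}.ncard ≤ w' * mC)
    (hm3 : ∀ j : ℕ,
      {v | k v = 2 ∧ ⌊(ξ v * σ + 11 / 2 * p) * d v / (32 * w')⌋₊ = j}.ncard ≤ w' * mC) :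
    ∃ H ≤ G, ∀ t, degCount H t ≤ mA + mC := by
  classical
  obtain ⟨tA, htA, htAm⟩ := exists_slots _ _ w mA hmA
  obtain ⟨t0, ht0, ht0m⟩ := exists_slots _ _ w' mC hm0
  obtain ⟨t1, ht1, ht1m⟩ := exists_slots _ _ w' mC hm1
  obtain ⟨t2, ht2, ht2m⟩ := exists_slots _ _ w' mC hm2
  obtain ⟨t3, ht3, ht3m⟩ := exists_slots _ _ w' mC hm3
  have hd0 : ∀ v, 0 < d v := fun v => hδ0.trans_le (hδ v)
  have hw'R : (1 : ℝ) ≤ w' := by exact_mod_cast hw0'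
  -- real bounds for the slots of the classes 0, 1, 2
  have hslot : ∀ (v : V) (c : ℝ) (s i : ℕ), 0 ≤ c → i ≤ 3 →
      (⌊(ξ v * σ + c * p) * d v / (32 * w')⌋₊ * w' ≤ s ∧
        s < (⌊(ξ v * σ + c * p) * d v / (32 * w')⌋₊ + 1) * w') →
      (ξ v * σ + c * p) * d v - p * d v / 10 ≤ ((32 * s + 8 * i + 3 : ℕ) : ℝ) ∧
        ((32 * s + 8 * i + 3 : ℕ) : ℝ) ≤ (ξ v * σ + c * p) * d v + p * d v / 10 := by
    intro v c s i hc hi hs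
    have hz : 0 ≤ (ξ v * σ + c * p) * d v :=
      mul_nonneg (add_nonneg (mul_nonneg (hξ0 v) hσ) (mul_nonneg hc hp.le)) (hd0 v).le
    have hfl := floor_window (L := 32 * (w' : ℝ)) (by positivity) hz
    set j := ⌊(ξ v * σ + c * p) * d v / (32 * w')⌋₊
    have h1 : (j : ℝ) * w' ≤ s := by exact_mod_cast hs.1
    have h2 : (s : ℝ) + 1 ≤ ((j : ℝ) + 1) * w' := by exact_mod_cast hs.2
    have h3 : (i : ℝ) ≤ 3 := by exact_mod_cast hi
    have h4 : (0 : ℝ) ≤ i := Nat.cast_nonneg _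
    have h5 : p * δ ≤ p * d v := mul_le_mul_of_nonneg_left (hδ v) hp.le
    push_cast
    constructor <;> nlinarith
  have hpd : ∀ v, 320 ≤ p * d v := fun v => by
    have h5 : p * δ ≤ p * d v := mul_le_mul_of_nonneg_left (hδ v) hp.le
    linarith
  have hτd : ∀ v, τ * d v ≤ p * d v / 3200 ∧ 0 ≤ τ * d v := by
    intro v
    rw [hτ]
    have : p ^ 2 / 16 ≤ p / 3200 := by nlinarith
    have := mul_le_mul_of_nonneg_right this (hd0 v).le
    exact ⟨by linarith, by have := hd0 v; positivity⟩
  obtain ⟨H, hHG, hH3, hH0, hH2⟩ := exists_completion G k hk R thr hR hthr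
    -- A target 32s + 8i + 3 met with error between -1 and +2 stays in the i-th octet of its block
    -- of 32. The achieved degree therefore determines the family i (class 0, class 1, and the two
    -- targets of class 2) and the slot s. The window centres in the hypotheses lie well inside the
    -- ranges allowed by `exists_completion`; for class 0, 65p/2 is half-way between 32p (half of
    -- the edges to class 2) and 33p.
    (fun v => if k v = 3 then tA v else if k v = 0 then 32 * t0 v + 8 * 0 + 3 else
      if k v = 1 then 32 * t1 v + 8 * 1 + 3 else 32 * t2 v + 8 * 2 + 3)
    (fun v => 32 * t3 v + 8 * 3 + 3)
    (by
      intro v hv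
      simp only [hv, if_true]
      have h1 := abs_le.1 (hf v hv)
      have h2 := hrA v hv
      have h3 := htA v hv
      have hz : 0 ≤ (ξ v * (1 - ρ) + ρ / 2) * d v :=
        mul_nonneg (add_nonneg (mul_nonneg (hξ0 v) (by linarith)) (by rw [hρ]; positivity))
          (hd0 v).le
      have hfl := floor_window (L := (w : ℝ)) (by positivity) hz
      set j := ⌊(ξ v * (1 - ρ) + ρ / 2) * d v / w⌋₊
      have h4 : (j : ℝ) * w ≤ tA v := by exact_mod_cast h3.1
      have h5 : (tA v : ℝ) ≤ ((j : ℝ) + 1) * w := by exact_mod_cast h3.2.le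
      have h6 : p ^ 2 * δ ≤ p ^ 2 * d v := mul_le_mul_of_nonneg_left (hδ v) (by positivity)
      have h7 : τ * d v = p ^ 2 * d v / 16 := by rw [hτ]; ring
      have h8 : ρ * d v = 73 / 32 * (p ^ 2 * d v) := by rw [hρ]; ring
      have h9 : 0 ≤ p ^ 2 * d v := by have := hd0 v; positivity
      rw [← Nat.cast_le (α := ℝ), ← Nat.cast_le (α := ℝ)]
      push_cast
      constructor <;> nlinarith)
    (by
      intro v hv
      simp only [hv, if_true, show (0 : ℕ) ≠ 3 by norm_num, if_false]
      have hs := hslot v (65 / 2) _ 0 (by norm_num) (by norm_num) (ht0 v hv)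
      have h1 := abs_le.1 (hg v)
      have h2 := hr v
      have h3 := abs_le.1 (hD2 v)
      have h4 := abs_le.1 (hD1 v)
      have h5 := hτd v
      have h6 := hpd v
      set D2 := nbrCount G v (fun u => k u = 2)
      have h7 : ((D2 / 2 : ℕ) : ℝ) ≤ D2 / 2 := Nat.cast_div_le
      have h8 : (D2 : ℝ) ≤ 2 * ((D2 / 2 : ℕ) : ℝ) + 1 := by
        have : D2 ≤ 2 * (D2 / 2) + 1 := by omega
        exact_mod_cast this
      set T := 32 * t0 v + 8 * 0 + 3
      rw [← Nat.cast_le (α := ℝ), ← Nat.cast_le (α := ℝ)]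
      simp only [Nat.cast_add]
      constructor <;> linarith)
    (by
      intro v hv
      simp only [hv, if_true, show (1 : ℕ) ≠ 3 by norm_num, show (1 : ℕ) ≠ 0 by norm_num, if_false]
      have hs := hslot v 32 _ 1 (by norm_num) (by norm_num) (ht1 v hv)
      have h1 := abs_le.1 (hg v)
      have h2 := hr v
      have h3 := abs_le.1 (hD2 v)
      have h4 := abs_le.1 (hD0 v)
      have h5 := hτd v
      have h6 := hpd v
      set T := 32 * t1 v + 8 * 1 + 3
      rw [← Nat.cast_le (α := ℝ), ← Nat.cast_le (α := ℝ)]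
      simp only [Nat.cast_add]
      constructor <;> linarith)
    (by
      intro v hv
      simp only [hv, show (2 : ℕ) ≠ 3 by norm_num, show (2 : ℕ) ≠ 0 by norm_num,
        show (2 : ℕ) ≠ 1 by norm_num, if_false]
      have hs := hslot v (7 / 2) _ 2 (by norm_num) (by norm_num) (ht2 v hv)
      have h1 := abs_le.1 (hg v)
      have h2 := hr v
      have h3 := abs_le.1 (hD1 v)
      have h4 := abs_le.1 (hD0 v)
      have h5 := hτd v
      have h6 := hpd v
      set T := 32 * t2 v + 8 * 2 + 3
      rw [← Nat.cast_le (α := ℝ), ← Nat.cast_le (α := ℝ)]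
      simp only [Nat.cast_add, Nat.cast_mul, Nat.cast_ofNat]
      constructor <;> linarith)
    (by
      intro v hv
      have hs := hslot v (11 / 2) _ 3 (by norm_num) (by norm_num) (ht3 v hv)
      have h1 := abs_le.1 (hg v)
      have h2 := hr v
      have h3 := abs_le.1 (hD1 v)
      have h4 := abs_le.1 (hD0 v)
      have h5 := hτd v
      have h6 := hpd v
      set T := 32 * t3 v + 8 * 3 + 3
      rw [← Nat.cast_le (α := ℝ), ← Nat.cast_le (α := ℝ)]
      simp only [Nat.cast_add, Nat.cast_mul, Nat.cast_ofNat]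
      constructor <;> linarith)
  refine ⟨H, hHG, fun t => ?_⟩
  -- the class and slot of a vertex outside class 3 are determined by its degree
  obtain ⟨c, s, hcs⟩ : ∃ (c : ℕ) (s : V → ℕ), {v | k v = c ∧ s v = t / 32}.ncard ≤ mC ∧
      ∀ v, k v ≠ 3 → nbrCount H v (fun _ => True) = t → k v = c ∧ s v = t / 32 := by
    have key : ∀ v, k v ≠ 3 → nbrCount H v (fun _ => True) = t →
        (k v = 0 ∧ t % 32 / 8 = 0 ∧ t0 v = t / 32) ∨ (k v = 1 ∧ t % 32 / 8 = 1 ∧ t1 v = t / 32) ∨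
        (k v = 2 ∧ t % 32 / 8 = 2 ∧ t2 v = t / 32) ∨
        (k v = 2 ∧ t % 32 / 8 = 3 ∧ t3 v = t / 32) := by
      intro v hv ht
      rcases hk v with h | h | h | h
      · have := hH0 v h
        simp only [h, if_true, show (0 : ℕ) ≠ 3 by norm_num, if_false] at this
        omega
      · have := hH3 v (Or.inr h)
        simp only [h, if_true, show (1 : ℕ) ≠ 3 by norm_num, show (1 : ℕ) ≠ 0 by norm_num,
          if_false] at this
        omega
      · have := hH2 v h
        simp only [h, show (2 : ℕ) ≠ 3 by norm_num, show (2 : ℕ) ≠ 0 by norm_num,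
          show (2 : ℕ) ≠ 1 by norm_num, if_false] at this
        omega
      · exact absurd h hv
    have h4 : t % 32 / 8 = 0 ∨ t % 32 / 8 = 1 ∨ t % 32 / 8 = 2 ∨ t % 32 / 8 = 3 := by omega
    rcases h4 with h4 | h4 | h4 | h4
    · exact ⟨0, t0, ht0m _, fun v hv ht => by have := key v hv ht; omega⟩
    · exact ⟨1, t1, ht1m _, fun v hv ht => by have := key v hv ht; omega⟩
    · exact ⟨2, t2, ht2m _, fun v hv ht => by have := key v hv ht; omega⟩
    · exact ⟨2, t3, ht3m _, fun v hv ht => by have := key v hv ht; omega⟩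
  rw [degCount_eq, ← Set.ncard_coe_finset]
  calc ((Finset.univ.filter fun v => nbrCount H v (fun _ => True) = t : Finset V) : Set V).ncard
      ≤ ({v | k v = 3 ∧ tA v = t} ∪ {v | k v = c ∧ s v = t / 32}).ncard := by
        refine Set.ncard_le_ncard (fun v hv => ?_) (Set.toFinite _)
        simp only [Finset.coe_filter, Finset.mem_univ, true_and, Set.mem_ofPred_eq] at hv
        by_cases h : k v = 3
        · left
          have := hH3 v (Or.inl h)
          simp only [h, if_true] at this
          exact ⟨h, by omega⟩
        · exact Or.inr (hcs.2 v h hv)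
    _ ≤ mA + mC := (Set.ncard_union_le _ _).trans (add_le_add (htAm t) hcs.1)

/-! ### Label probabilities and the numerical estimates for windows -/

theorem card_filter_fin (m a b : ℕ) (hb : b ≤ m) :
    (Finset.univ.filter fun x : Fin m => a ≤ (x : ℕ) ∧ (x : ℕ) < b).card = b - a := by
  rw [← Finset.card_map Fin.valEmbedding, ← Nat.card_Ico]
  congr 1
  ext y
  simp only [Finset.mem_map, Finset.mem_filter, Finset.mem_univ, true_and, Fin.valEmbedding_apply,
    Finset.mem_Ico]
  constructor
  · rintro ⟨x, hx, rfl⟩; exact hx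
  · rintro ⟨h1, h2⟩; exact ⟨⟨y, by omega⟩, ⟨h1, h2⟩, rfl⟩

/-- The number of grid points `x / M` whose affine image lies in a given window of length `L`. -/
theorem card_window_le (M j : ℕ) (hM : 0 < M) {α β d L : ℝ} (hα : 0 < α) (hβ : 0 ≤ β) (hd : 0 < d)
    (hL : 0 < L) :
    ((Finset.univ.filter fun x : Fin M =>
      ⌊(((x : ℕ) : ℝ) / M * α + β) * d / L⌋₊ = j).card : ℝ) / M ≤ L / (α * d) + 1 / M := by
  set S := Finset.univ.filter fun x : Fin M =>
      ⌊(((x : ℕ) : ℝ) / M * α + β) * d / L⌋₊ = j with hS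
  have hMR : (0 : ℝ) < M := by exact_mod_cast hM
  rcases S.eq_empty_or_nonempty with h0 | h0
  · rw [h0]; simp; positivity
  have hwin : ∀ x ∈ S, (j : ℝ) * L ≤ (((x : ℕ) : ℝ) / M * α + β) * d ∧
      (((x : ℕ) : ℝ) / M * α + β) * d < ((j : ℝ) + 1) * L := by
    intro x hx
    have := floor_window (z := (((x : ℕ) : ℝ) / M * α + β) * d) hL (by positivity)
    rwa [(Finset.mem_filter.1 hx).2] at this
  set a := S.min' h0
  set b := S.max' h0
  have hab : (a : ℕ) ≤ b := S.min'_le_max' h0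
  have hcard : S.card ≤ (b : ℕ) - a + 1 := by
    calc S.card ≤ (Finset.Icc a b).card := Finset.card_le_card fun x hx =>
          Finset.mem_Icc.2 ⟨S.min'_le x hx, S.le_max' x hx⟩
      _ = _ := by rw [Fin.card_Icc]; omega
  have h1 := (hwin a (S.min'_mem h0)).1
  have h2 := (hwin b (S.max'_mem h0)).2
  have h3 : (((b : ℕ) : ℝ) - (a : ℕ)) / M ≤ L / (α * d) := by
    rw [le_div_iff₀ (by positivity)]
    have : (((b : ℕ) : ℝ) - (a : ℕ)) / M * (α * d) =
      (((b : ℕ) : ℝ) / M * α + β) * d - (((a : ℕ) : ℝ) / M * α + β) * d := by ring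
    rw [this]; linarith
  have h4 : (S.card : ℝ) ≤ ((b : ℕ) : ℝ) - (a : ℕ) + 1 := by
    rw [← Nat.cast_sub hab]; exact_mod_cast hcard
  calc (S.card : ℝ) / M ≤ (((b : ℕ) : ℝ) - (a : ℕ) + 1) / M := by gcongr
    _ = (((b : ℕ) : ℝ) - (a : ℕ)) / M + 1 / M := by ring
    _ ≤ _ := by gcongr

/-- Bounds the expected number of vertices of a class, of density at most γ, whose target lies in
the j-th window; 1/M is the cost of a discrete label. -/
theorem sum_window_le {V Y : Type*} [Fintype V] [Fintype Y] (M j : ℕ) (hM : 0 < M) {α β δ L γ : ℝ}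
    (hα : 0 < α) (hβ : 0 ≤ β) (hδ : 0 < δ) (hL : 0 < L) (d : V → ℝ) (hd : ∀ v, δ ≤ d v)
    (K : Finset Y) (hK : (K.card : ℝ) / Fintype.card Y ≤ γ) :
    ∑ v, ((((Finset.univ.filter fun x : Fin M =>
      ⌊(((x : ℕ) : ℝ) / M * α + β) * d v / L⌋₊ = j) ×ˢ K).card : ℕ) : ℝ) /
        Fintype.card (Fin M × Y) ≤ Fintype.card V * ((L / (α * δ) + 1 / M) * γ) := by
  rw [← nsmul_eq_mul]
  refine Finset.sum_le_card_nsmul _ _ _ fun v _ => ?_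
  rw [Finset.card_product, Fintype.card_prod, Fintype.card_fin, Nat.cast_mul, Nat.cast_mul,
    mul_div_mul_comm]
  have hdv : 0 < d v := hδ.trans_le (hd v)
  have h1 := card_window_le M j hM hα hβ hdv hL
  have h2 : L / (α * d v) ≤ L / (α * δ) := by
    have := hd v
    gcongr
  exact mul_le_mul (h1.trans (by linarith)) hK (by positivity) (by positivity)

/-- The class of a vertex with colour `c`: the colour `0` gives class `1`, the next eight colours
give class `0`, the next 64 colours give class `2`, all others give class `3`. -/
def colourClass (c : ℕ) : ℕ := if c < 1 then 1 else if c < 9 then 0 else if c < 73 then 2 else 3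

theorem colourClass_cases (c : ℕ) : colourClass c = 0 ∨ colourClass c = 1 ∨ colourClass c = 2 ∨
    colourClass c = 3 := by
  unfold colourClass; split_ifs <;> simp

theorem card_colourClass (P : ℕ) (hP : 73 ≤ P) :
    (Finset.univ.filter fun c : Fin P => colourClass c = 0).card = 8 ∧
    (Finset.univ.filter fun c : Fin P => colourClass c = 1).card = 1 ∧
    (Finset.univ.filter fun c : Fin P => colourClass c = 2).card = 64 ∧
    (Finset.univ.filter fun c : Fin P => colourClass c = 3).card = P - 73 ∧
    (Finset.univ.filter fun c : Fin P => colourClass c ≠ 3).card = 73 := by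
  have key : ∀ (q : ℕ → Prop) [DecidablePred q] (a b : ℕ), b ≤ P →
      (∀ c, c < P → (q c ↔ a ≤ c ∧ c < b)) →
      (Finset.univ.filter fun c : Fin P => q c).card = b - a := by
    intro q _ a b hb h
    rw [← card_filter_fin P a b hb]
    congr 1
    exact Finset.filter_congr fun c _ => h c c.2
  refine ⟨key (fun c => colourClass c = 0) 1 9 (by omega) ?_,
    key (fun c => colourClass c = 1) 0 1 (by omega) ?_,
    key (fun c => colourClass c = 2) 9 73 (by omega) ?_,
    key (fun c => colourClass c = 3) 73 P le_rfl ?_,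
    key (fun c => colourClass c ≠ 3) 0 73 (by omega) ?_⟩ <;>
  · intro c hc
    unfold colourClass
    split_ifs <;> simp <;> omega

/-- Colour and residue are independent, with a fixed residue having probability 1/Q = p/32. These
are the densities 1 - ρ, ρ, σ of the main construction and the reserved density seen from the small
classes. -/
theorem card_filter_colour (P Q : ℕ) (hP : 200 ≤ P) (hQ : Q = 32 * P) {p : ℝ} (hp : p = 1 / P)
    (i : Fin Q) :
    (((Finset.univ.filter fun z : Fin P × Fin Q => colourClass z.1 = 3 ∨ z.2 ≠ i).card : ℕ) : ℝ) /
      Fintype.card (Fin P × Fin Q) = 1 - 73 * p * (p / 32) ∧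
    (((Finset.univ.filter fun z : Fin P × Fin Q => colourClass z.1 ≠ 3 ∧ z.2 = i).card : ℕ) : ℝ) /
      Fintype.card (Fin P × Fin Q) = 73 * p * (p / 32) ∧
    (((Finset.univ.filter fun z : Fin P × Fin Q => colourClass z.1 = 3 ∧ z.2 ≠ i).card : ℕ) : ℝ) /
      Fintype.card (Fin P × Fin Q) = (1 - 73 * p) * (1 - p / 32) ∧
    (((Finset.univ.filter fun z : Fin P × Fin Q => colourClass z.1 = 3 ∧ z.2 = i).card : ℕ) : ℝ) /
      Fintype.card (Fin P × Fin Q) = (1 - 73 * p) * (p / 32) := by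
  have hPR : (0 : ℝ) < P := by exact_mod_cast (by omega : 0 < P)
  have hX : (Fintype.card (Fin P × Fin Q) : ℝ) = P * (32 * P) := by
    simp [hQ]
  obtain ⟨-, -, -, h3, h3'⟩ := card_colourClass P (by omega)
  have e1 : (Finset.univ.filter fun z : Fin P × Fin Q => colourClass z.1 ≠ 3 ∧ z.2 = i) =
      (Finset.univ.filter fun c : Fin P => colourClass c ≠ 3) ×ˢ {i} := by
    ext z; simp [-Finset.product_singleton]
  have e2 : (Finset.univ.filter fun z : Fin P × Fin Q => colourClass z.1 = 3 ∧ z.2 ≠ i) =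
      (Finset.univ.filter fun c : Fin P => colourClass c = 3) ×ˢ {i}ᶜ := by
    ext z; simp
  have e3 : (Finset.univ.filter fun z : Fin P × Fin Q => colourClass z.1 = 3 ∧ z.2 = i) =
      (Finset.univ.filter fun c : Fin P => colourClass c = 3) ×ˢ {i} := by
    ext z; simp [-Finset.product_singleton]
  have e0 : (Finset.univ.filter fun z : Fin P × Fin Q => colourClass z.1 = 3 ∨ z.2 ≠ i) =
      (Finset.univ.filter fun z : Fin P × Fin Q => colourClass z.1 ≠ 3 ∧ z.2 = i)ᶜ := by
    ext z; simp; tauto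
  have c1 : ((P - 73 : ℕ) : ℝ) = P - 73 := by rw [Nat.cast_sub (by omega)]; simp
  have c2 : ((Q - 1 : ℕ) : ℝ) = 32 * P - 1 := by rw [Nat.cast_sub (by omega), hQ]; simp
  refine ⟨?_, ?_, ?_, ?_⟩
  · rw [e0, Finset.card_compl, Nat.cast_sub (Finset.card_le_univ _), hX, e1, Finset.card_product,
      h3', hp]
    simp only [Finset.card_singleton]
    field_simp
    push_cast
    ring
  · rw [e1, hX, Finset.card_product, h3', hp]
    simp only [Finset.card_singleton]
    field_simp
    push_cast
    ring
  · rw [e2, hX, Finset.card_product, h3, Finset.card_compl, Finset.card_singleton, Fintype.card_fin,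
      Nat.cast_mul, c1, c2, hp]
    field_simp
  · rw [e3, hX, Finset.card_product, h3, Finset.card_singleton, mul_one, c1, hp]
    field_simp

theorem card_filter_class (P Q : ℕ) (hQ : 0 < Q) (hP : 200 ≤ P) {p : ℝ} (hp : p = 1 / P) :
    (((Finset.univ.filter fun z : Fin P × Fin Q => colourClass z.1 = 0).card : ℕ) : ℝ) /
      Fintype.card (Fin P × Fin Q) = 8 * p ∧
    (((Finset.univ.filter fun z : Fin P × Fin Q => colourClass z.1 = 1).card : ℕ) : ℝ) /
      Fintype.card (Fin P × Fin Q) = p ∧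
    (((Finset.univ.filter fun z : Fin P × Fin Q => colourClass z.1 = 2).card : ℕ) : ℝ) /
      Fintype.card (Fin P × Fin Q) = 64 * p ∧
    (((Finset.univ.filter fun z : Fin P × Fin Q => colourClass z.1 = 3).card : ℕ) : ℝ) /
      Fintype.card (Fin P × Fin Q) = 1 - 73 * p := by
  have hPR : (0 : ℝ) < P := by exact_mod_cast (by omega : 0 < P)
  have hQR : (0 : ℝ) < Q := by exact_mod_cast hQ
  have hX : (Fintype.card (Fin P × Fin Q) : ℝ) = P * Q := by simp
  obtain ⟨h0, h1, h2, h3, -⟩ := card_colourClass P (by omega)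
  have c1 : ((P - 73 : ℕ) : ℝ) = P - 73 := by rw [Nat.cast_sub (by omega)]; simp
  have e : ∀ i, (Finset.univ.filter fun z : Fin P × Fin Q => colourClass z.1 = i) =
      (Finset.univ.filter fun c : Fin P => colourClass c = i) ×ˢ Finset.univ := by
    intro i; ext z; simp
  simp only [e, Finset.card_product, h0, h1, h2, h3, hX, Finset.card_univ, Fintype.card_fin, hp,
    Nat.cast_mul, c1]
  refine ⟨?_, ?_, ?_, ?_⟩ <;> field_simp <;> norm_num

theorem nbrCount_le_card {V : Type*} [Fintype V] (G : SimpleGraph V) (v : V) (p : V → Prop) :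
    nbrCount G v p ≤ Fintype.card V := Finset.card_le_univ _

/-- The missing 73p in the density of class 3 pays for the factor 1/(1-ρ) and for the grid error,
and still leaves a factor 1 - p. Half of that gain is later spent on deviations. -/
theorem main_window_mean {n w δ M p ρ : ℝ} (hn : 0 ≤ n) (hδ : 0 < δ) (hw : 0 ≤ w) (hM : 0 ≤ M)
    (hp0 : 0 < p) (hp1 : p ≤ 1 / 200) (hρ0 : 0 < ρ) (hρp : ρ ≤ p / 80)
    (hM1 : 1 / M ≤ p * (w / δ)) :
    n * ((w / ((1 - ρ) * δ) + 1 / M) * (1 - 73 * p)) ≤ n * w / δ * (1 - p) := by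
  have hρ1 : 0 < 1 - ρ := by linarith
  have h1 : w / ((1 - ρ) * δ) * (1 - 73 * p) ≤ w / δ * (1 - 2 * p) := by
    have e : w / ((1 - ρ) * δ) * (1 - 73 * p) = w / δ * ((1 - 73 * p) / (1 - ρ)) := by
      field_simp
    rw [e]
    have : (1 - 73 * p) / (1 - ρ) ≤ 1 - 2 * p := by
      rw [div_le_iff₀ hρ1]; nlinarith
    gcongr
  have h2 : 1 / M * (1 - 73 * p) ≤ p * (w / δ) :=
    le_trans (mul_le_of_le_one_right (by positivity) (by linarith)) hM1
  calc n * ((w / ((1 - ρ) * δ) + 1 / M) * (1 - 73 * p))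
      = n * (w / ((1 - ρ) * δ) * (1 - 73 * p) + 1 / M * (1 - 73 * p)) := by ring
    _ ≤ n * (w / δ * (1 - 2 * p) + p * (w / δ)) := by gcongr
    _ = _ := by ring

/-- The window factor 32/σ ≤ 160/3 plus the grid error is at most 64, and 4096 = 64 · 64 with class
density at most 64p. -/
theorem class_window_mean {n w w' δ M p σ : ℝ} (hδ : 0 < δ) (hn : 0 ≤ n) (hw' : 0 ≤ w')
    (hp0 : 0 < p) (hp1 : p ≤ 1 / 200) (hσ : 3 / 5 ≤ σ) (hww : w ≤ 2 * w')
    (hM1 : 1 / M ≤ p * (w / δ)) :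
    n * ((32 * w' / (σ * δ) + 1 / M) * (64 * p)) ≤ 4096 * p * (n * w' / δ) := by
  have h3 : 0 ≤ w' / δ := by positivity
  have h1 : 32 * w' / (σ * δ) ≤ 160 / 3 * (w' / δ) := by
    rw [mul_comm σ, ← div_div, div_le_iff₀ (by linarith), mul_div_assoc]
    nlinarith
  have h2 : 1 / M ≤ w' / δ := by
    refine hM1.trans ?_
    have h4 : p * (w / δ) ≤ p * (2 * w' / δ) := by gcongr
    have h5 : p * (2 * w' / δ) = 2 * p * (w' / δ) := by ring
    nlinarith
  calc n * ((32 * w' / (σ * δ) + 1 / M) * (64 * p))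
      ≤ n * ((64 * (w' / δ)) * (64 * p)) := by gcongr; linarith
    _ = _ := by ring

/-- With X = nw/δ, parameter p/4 and deviation pX/2, the exponent is at most -p²X/16; here X ≥ w ≥
p²δ/4, so it is of order p⁴δ. -/
theorem main_window_exponent {n w δ p Λ : ℝ} (hδ : 0 < δ) (hδn : δ ≤ n) (hw0 : 0 ≤ w)
    (hp0 : 0 < p) (hw : p ^ 2 * δ / 4 ≤ w) (hΛ : 8 * Λ ≤ p ^ 4 * δ / 1024) :
    -(p / 4 * (n * w / δ * (p / 2))) + (p / 4) ^ 2 * (n * w / δ * (1 - p)) ≤ -(8 * Λ) := by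
  have h0 : 0 ≤ p ^ 4 * δ := by positivity
  have h1 : w ≤ n * w / δ := by
    rw [le_div_iff₀ hδ, mul_comm]; gcongr
  have h2 : p ^ 2 * (p ^ 2 * δ / 4) ≤ p ^ 2 * (n * w / δ) :=
    mul_le_mul_of_nonneg_left (hw.trans h1) (by positivity)
  have h3 : 0 ≤ p ^ 2 * (n * w / δ) * p := by have := hδ.trans_le hδn; positivity
  nlinarith

/-- For the small classes constant factors are harmless, so the deviation is taken equal to the
bound on the mean, with parameter 1/2. -/
theorem class_window_exponent {n w w' δ p Λ : ℝ} (hδ : 0 < δ) (hδn : δ ≤ n) (hw0 : 0 ≤ w)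
    (hw0' : 0 ≤ w') (hp0 : 0 < p) (hp1 : p ≤ 1 / 200) (hww : w ≤ 2 * w')
    (hw : p ^ 2 * δ / 4 ≤ w) (hΛ : 8 * Λ ≤ p ^ 4 * δ / 1024) :
    -(1 / 2 * (4096 * p * (n * w' / δ))) + (1 / 2) ^ 2 * (4096 * p * (n * w' / δ)) ≤
      -(8 * Λ) := by
  have h0 : 0 ≤ p ^ 4 * δ := by positivity
  have h1 : w' ≤ n * w' / δ := by
    rw [le_div_iff₀ hδ, mul_comm]; gcongr
  have h2 : p ^ 2 * (p ^ 2 * δ / 4) ≤ p * (2 * w') := by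
    have h : p ^ 2 ≤ p := by nlinarith
    calc p ^ 2 * (p ^ 2 * δ / 4) ≤ p ^ 2 * w := by gcongr
      _ ≤ p * (2 * w') := by gcongr
  have h3 : p * w' ≤ p * (n * w' / δ) := by gcongr
  nlinarith

/-! ### The random construction for degrees well above the logarithm -/

set_option maxHeartbeats 1000000 in
open Classical in
/-- The main construction, for graphs whose minimum degree is at least a power of `log n`. -/
theorem exists_subgraph_of_large_degree {V : Type*} [Fintype V] (G : SimpleGraph V) (δ P : ℕ)
    (hP : 200 ≤ P) (hδ : ∀ v, δ ≤ nbrCount G v (fun _ => True)) (hn : 2 ≤ Fintype.card V)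
    (hbig : 8192 * (P : ℝ) ^ 4 * Real.log (Fintype.card V) ≤ δ) :
    ∃ H ≤ G, ∀ t, degCount H t ≤ ⌈(Fintype.card V : ℝ) / ((δ : ℝ) + 1)⌉₊ +
      (⌊8192 * (Fintype.card V : ℝ) / (P * δ)⌋₊ + 1) := by
  set n := Fintype.card V with hn'
  obtain ⟨v₀⟩ : Nonempty V := Fintype.card_pos_iff.1 (by omega)
  have hδn : δ ≤ n := (hδ v₀).trans (nbrCount_le_card _ _ _)
  have hnR : (2 : ℝ) ≤ n := by exact_mod_cast hn
  have hδnR : (δ : ℝ) ≤ n := by exact_mod_cast hδn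
  have hPR : (200 : ℝ) ≤ P := by exact_mod_cast hP
  have hlog : (0.69 : ℝ) ≤ Real.log n := by
    have h1 := Real.log_two_gt_d9
    have h2 := Real.log_le_log (by norm_num) hnR
    linarith
  obtain ⟨p, hp⟩ : ∃ p : ℝ, p = 1 / P := ⟨_, rfl⟩
  have hp0 : 0 < p := by rw [hp]; positivity
  have hpP : p * P = 1 := by rw [hp]; field_simp
  have hp1 : p ≤ 1 / 200 := by nlinarith
  have hδ4 : 5000 * (P : ℝ) ^ 4 ≤ δ := by
    have : 8192 * (P : ℝ) ^ 4 * 0.69 ≤ 8192 * (P : ℝ) ^ 4 * Real.log n := by gcongr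
    have h0 : 0 ≤ (P : ℝ) ^ 4 := by positivity
    linarith
  have hP4 : 200 ^ 3 * (P : ℝ) ≤ (P : ℝ) ^ 4 := by
    have : (200 : ℝ) ^ 3 ≤ (P : ℝ) ^ 3 := by gcongr
    nlinarith
  have hδ0 : (0 : ℝ) < δ := by linarith
  -- Since τ²δ/4 = p⁴δ/1024, this makes each bad neighbourhood count have probability at most n⁻⁸;
  -- the window events obey the same bound.
  have hpδ : 8 * Real.log n ≤ p ^ 4 * δ / 1024 := by
    have : p ^ 4 * (8192 * (P : ℝ) ^ 4 * Real.log n) ≤ p ^ 4 * δ := by gcongr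
    have h2 : p ^ 4 * (8192 * (P : ℝ) ^ 4 * Real.log n) = (p * P) ^ 4 * 8192 * Real.log n := by ring
    rw [h2, hpP] at this
    linarith
  have hp2δ : 5000 * 200 ^ 2 ≤ p ^ 2 * δ := by
    have h1 : p ^ 2 * (5000 * (P : ℝ) ^ 4) ≤ p ^ 2 * δ := by gcongr
    have h2 : p ^ 2 * (5000 * (P : ℝ) ^ 4) = (p * P) ^ 2 * 5000 * (P : ℝ) ^ 2 := by ring
    rw [h2, hpP] at h1
    have h3 : (200 : ℝ) ^ 2 ≤ (P : ℝ) ^ 2 := by gcongr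
    linarith
  have hpδ1 : 200 * (p ^ 2 * δ) ≤ p * δ := by
    have : p * (p * δ) ≤ 1 / 200 * (p * δ) := by gcongr
    nlinarith
  -- the parameters
  obtain ⟨ρ, hρ⟩ : ∃ ρ : ℝ, ρ = 73 * p * (p / 32) := ⟨_, rfl⟩
  obtain ⟨σ, hσ⟩ : ∃ σ : ℝ, σ = (1 - 73 * p) * (1 - p / 32) := ⟨_, rfl⟩
  obtain ⟨τ, hτ⟩ : ∃ τ : ℝ, τ = p ^ 2 / 16 := ⟨_, rfl⟩
  have hρ0 : 0 < ρ := by rw [hρ]; positivity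
  have hρp : ρ ≤ p / 80 := by rw [hρ]; nlinarith
  have hσ0 : 3 / 5 ≤ σ := by rw [hσ]; nlinarith
  have hσ1 : σ ≤ 1 - 73 * p := by rw [hσ]; nlinarith
  have hτ0 : 0 ≤ τ := by rw [hτ]; positivity
  have hτp : τ ≤ p := by rw [hτ]; nlinarith
  obtain ⟨Q, hQ⟩ : ∃ Q, Q = 32 * P := ⟨_, rfl⟩
  have hQn : Q ≤ n := by
    have : (Q : ℝ) ≤ n := by rw [hQ]; push_cast; linarith
    exact_mod_cast this
  -- n² labels make the grid error 1/M at most pw/δ, while the number of events in the union bound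
  -- remains O(n⁴).
  obtain ⟨M, hM⟩ : ∃ M, M = n ^ 2 := ⟨_, rfl⟩
  have hM0 : 0 < M := by rw [hM]; positivity
  have hMR : (0 : ℝ) < M := by exact_mod_cast hM0
  obtain ⟨w, hw⟩ : ∃ w, w = ⌊p ^ 2 * δ / 2⌋₊ := ⟨_, rfl⟩
  obtain ⟨w', hw'⟩ : ∃ w', w' = ⌊p * δ / 320⌋₊ := ⟨_, rfl⟩
  have hw1 : (w : ℝ) ≤ p ^ 2 * δ / 2 := by rw [hw]; exact Nat.floor_le (by positivity)
  have hw2 : p ^ 2 * δ / 4 ≤ w := by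
    have := Nat.lt_floor_add_one (p ^ 2 * δ / 2)
    rw [← hw] at this
    linarith
  have hw1' : 32 * (w' : ℝ) ≤ p * δ / 10 := by
    have : (w' : ℝ) ≤ p * δ / 320 := by rw [hw']; exact Nat.floor_le (by positivity)
    linarith
  have hw2' : p * δ / 640 ≤ w' := by
    have := Nat.lt_floor_add_one (p * δ / 320)
    rw [← hw'] at this
    linarith
  have hwpos : 1 ≤ (w : ℝ) := by linarith
  have hwpos' : 1 ≤ (w' : ℝ) := by linarith
  obtain ⟨d, hd⟩ : ∃ d : V → ℝ, d = fun v => (nbrCount G v (fun _ => True) : ℝ) := ⟨_, rfl⟩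
  have hδd : ∀ v, (δ : ℝ) ≤ d v := fun v => by rw [hd]; beta_reduce; exact_mod_cast hδ v
  have hdn : ∀ v, d v ≤ n := fun v => by
    rw [hd]; beta_reduce; exact_mod_cast nbrCount_le_card G v _
  have hd0 : ∀ v, 0 < d v := fun v => hδ0.trans_le (hδd v)
  -- the families of label sets
  let U : ℕ → Finset (Fin M) := fun ℓ => Finset.univ.filter fun x => M ≤ (x : ℕ) + ℓ
  -- A vertex labelled ℓ accepts exactly ℓ of the M labels, so its threshold probability is exactly
  -- ξ = ℓ/M.
  have hU : ∀ ℓ : Fin M, ((U ℓ).card : ℝ) = (ℓ : ℕ) := by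
    intro ℓ
    have h1 := card_filter_fin M (M - ℓ) M le_rfl
    have h2 : U ℓ = Finset.univ.filter fun x : Fin M => M - ℓ ≤ (x : ℕ) ∧ (x : ℕ) < M := by
      refine Finset.filter_congr fun x _ => ?_
      have := x.2; have := ℓ.2
      omega
    rw [h2, h1]
    have := ℓ.2
    congr 1; omega
  -- The seven kinds are the seven neighbourhood counts required by `exists_subgraph_of_typical`.
  -- The sets depend on the random label and residue of the vertex itself, so all values of these
  -- are included in the union bound.
  let S : Fin M × Fin Q × Fin 7 → Finset (Fin M × (Fin P × Fin Q)) := fun e =>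
    ![U e.1 ×ˢ Finset.univ.filter fun z => colourClass z.1 = 3 ∨ z.2 ≠ e.2.1,
      Finset.univ ×ˢ Finset.univ.filter fun z => colourClass z.1 ≠ 3 ∧ z.2 = e.2.1,
      U e.1 ×ˢ Finset.univ.filter fun z => colourClass z.1 = 3 ∧ z.2 ≠ e.2.1,
      Finset.univ ×ˢ Finset.univ.filter fun z => colourClass z.1 = 3 ∧ z.2 = e.2.1,
      Finset.univ ×ˢ Finset.univ.filter fun z => colourClass z.1 = 0,
      Finset.univ ×ˢ Finset.univ.filter fun z => colourClass z.1 = 1,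
      Finset.univ ×ˢ Finset.univ.filter fun z => colourClass z.1 = 2] e.2.2
  have hratio : ∀ (A : Finset (Fin M)) (Z : Finset (Fin P × Fin Q)),
      (((A ×ˢ Z).card : ℕ) : ℝ) / Fintype.card (Fin M × (Fin P × Fin Q)) =
        (A.card : ℝ) / M * ((Z.card : ℝ) / Fintype.card (Fin P × Fin Q)) := by
    intro A Z
    rw [Finset.card_product, Fintype.card_prod, Fintype.card_fin, Nat.cast_mul, Nat.cast_mul,
      mul_div_mul_comm]
  have hratio' : ∀ (Z : Finset (Fin P × Fin Q)),
      ((((Finset.univ : Finset (Fin M)) ×ˢ Z).card : ℕ) : ℝ) /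
        Fintype.card (Fin M × (Fin P × Fin Q)) =
        (Z.card : ℝ) / Fintype.card (Fin P × Fin Q) := by
    intro Z
    rw [hratio, Finset.card_univ, Fintype.card_fin, div_self hMR.ne', one_mul]
  -- Five window families: the main class, class 0, class 1, and the lower and upper targets of
  -- class 2.
  let α : Fin 5 → ℝ := ![1 - ρ, σ, σ, σ, σ]
  let β : Fin 5 → ℝ := ![ρ / 2, 65 / 2 * p, 32 * p, 7 / 2 * p, 11 / 2 * p]
  let γ : Fin 5 → ℝ := ![1 - 73 * p, 64 * p, 64 * p, 64 * p, 64 * p]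
  let W : Fin 5 → ℝ := ![w, 32 * w', 32 * w', 32 * w', 32 * w']
  let μ : Fin 5 → ℝ := ![n * w / δ * (1 - p), 4096 * p * (n * w' / δ), 4096 * p * (n * w' / δ),
    4096 * p * (n * w' / δ), 4096 * p * (n * w' / δ)]
  let s : Fin 5 → ℝ := ![n * w / δ * (p / 2), 4096 * p * (n * w' / δ), 4096 * p * (n * w' / δ),
    4096 * p * (n * w' / δ), 4096 * p * (n * w' / δ)]
  let l : Fin 5 → ℝ := ![p / 4, 1 / 2, 1 / 2, 1 / 2, 1 / 2]
  let cl : Fin 5 → ℕ := ![3, 0, 1, 2, 2]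
  have hα : ∀ m, 0 < α m := by
    intro m; fin_cases m
    · change 0 < 1 - ρ; linarith
    all_goals change 0 < σ; linarith
  have hβ : ∀ m, 0 ≤ β m := by
    intro m; fin_cases m
    · change 0 ≤ ρ / 2; positivity
    · change 0 ≤ 65 / 2 * p; positivity
    · change 0 ≤ 32 * p; positivity
    · change 0 ≤ 7 / 2 * p; positivity
    · change 0 ≤ 11 / 2 * p; positivity
  have hαβ : ∀ m, α m + β m ≤ 1 := by
    intro m; fin_cases m
    · change 1 - ρ + ρ / 2 ≤ 1; linarith
    · change σ + 65 / 2 * p ≤ 1; linarith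
    · change σ + 32 * p ≤ 1; linarith
    · change σ + 7 / 2 * p ≤ 1; linarith
    · change σ + 11 / 2 * p ≤ 1; linarith
  have hW : ∀ m, 1 ≤ W m := by
    intro m; fin_cases m
    · exact hwpos
    all_goals change 1 ≤ 32 * (w' : ℝ); linarith
  have hl : ∀ m, 0 ≤ l m ∧ l m ≤ 1 := by
    intro m; fin_cases m
    · change 0 ≤ p / 4 ∧ p / 4 ≤ 1; constructor <;> linarith
    all_goals change 0 ≤ (1 / 2 : ℝ) ∧ (1 / 2 : ℝ) ≤ 1; norm_num
  obtain ⟨hc0, hc1, hc2, hc3⟩ := card_filter_class P Q (by omega) hP hp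
  have hγ : ∀ m, (((Finset.univ.filter fun z : Fin P × Fin Q => colourClass z.1 = cl m).card : ℕ) : ℝ)
      / Fintype.card (Fin P × Fin Q) ≤ γ m := by
    intro m; fin_cases m
    · exact hc3.le
    · refine hc0.le.trans ?_; change _ ≤ 64 * p; linarith
    · refine hc1.le.trans ?_; change _ ≤ 64 * p; linarith
    · exact hc2.le
    · exact hc2.le
  have hM1 : 1 / (M : ℝ) ≤ p * (w / δ) := by
    have h1 : 1 / (n : ℝ) ≤ p := by
      rw [hp]
      refine one_div_le_one_div_of_le (by positivity) ?_
      linarith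
    have h2 : 1 / (n : ℝ) ≤ w / δ := by gcongr
    calc 1 / (M : ℝ) = 1 / (n : ℝ) * (1 / n) := by rw [hM]; push_cast; ring
      _ ≤ _ := by gcongr
  have hww : (w : ℝ) ≤ 2 * w' := by linarith
  have hμ : ∀ m, (n : ℝ) * ((W m / (α m * δ) + 1 / M) * γ m) ≤ μ m := by
    have hC := class_window_mean (n := n) hδ0 (Nat.cast_nonneg _) (Nat.cast_nonneg _) hp0 hp1 hσ0
      hww hM1
    intro m; fin_cases m
    · exact main_window_mean (Nat.cast_nonneg _) hδ0 (Nat.cast_nonneg _) hMR.le hp0 hp1 hρ0 hρp hM1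
    all_goals exact hC
  have hexp : ∀ m, -(l m * s m) + l m ^ 2 * μ m ≤ -(8 * Real.log n) := by
    have hC := class_window_exponent hδ0 hδnR (Nat.cast_nonneg _) (Nat.cast_nonneg _) hp0 hp1 hww hw2
      hpδ
    intro m; fin_cases m
    · exact main_window_exponent hδ0 hδnR (Nat.cast_nonneg _) hp0 hw2 hpδ
    all_goals exact hC
  let B : Fin (n + 1) × Fin 5 → V → Finset (Fin M × (Fin P × Fin Q)) := fun e v =>
    (Finset.univ.filter fun x : Fin M =>
      ⌊(((x : ℕ) : ℝ) / M * α e.2 + β e.2) * d v / W e.2⌋₊ = (e.1 : ℕ)) ×ˢ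
      (Finset.univ.filter fun z : Fin P × Fin Q => colourClass z.1 = cl e.2)
  have : Nonempty (Fin M × (Fin P × Fin Q)) :=
    ⟨(⟨0, hM0⟩, ⟨0, by omega⟩, ⟨0, by omega⟩)⟩
  obtain ⟨ω, hω, hB⟩ := exists_labelling G S B (fun e => l e.2) (fun e => μ e.2) (fun e => s e.2)
    (fun e => (hl e.2).1) (fun e => (hl e.2).2)
    (fun e => (sum_window_le M e.1 hM0 (hα e.2) (hβ e.2) hδ0 (zero_lt_one.trans_le (hW e.2)) d hδd _
      (hγ e.2)).trans (hμ e.2))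
    hτ0 (hτp.trans (by linarith)) (δ := δ) (fun v => by exact_mod_cast hδ v)
    (by
      have h1 : Real.exp (-(τ ^ 2 * δ / 4)) ≤ Real.exp (-(8 * Real.log n)) := by
        rw [Real.exp_le_exp, hτ]
        linarith
      have h2 : ∑ e : Fin (n + 1) × Fin 5, Real.exp (-(l e.2 * s e.2) + l e.2 ^ 2 * μ e.2) ≤
          ((n + 1) * 5) * Real.exp (-(8 * Real.log n)) := by
        refine (Finset.sum_le_card_nsmul _ _ _ fun e _ => Real.exp_le_exp.2 (hexp e.2)).trans
          (le_of_eq ?_)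
        rw [Finset.card_univ, nsmul_eq_mul, Fintype.card_prod, Fintype.card_fin, Fintype.card_fin]
        push_cast
        ring
      have h3 : Real.exp (-(8 * Real.log n)) = 1 / (n : ℝ) ^ 8 := by
        rw [Real.exp_neg, show 8 * Real.log n = ((8 : ℕ) : ℝ) * Real.log n by norm_num,
          Real.exp_nat_mul, Real.exp_log (by linarith), one_div]
      have h4 : (Fintype.card (Fin M × Fin Q × Fin 7) : ℝ) ≤ 7 * (n : ℝ) ^ 3 := by
        simp only [Fintype.card_prod, Fintype.card_fin]
        push_cast
        rw [hM]
        push_cast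
        have : (Q : ℝ) ≤ n := by exact_mod_cast hQn
        calc (n : ℝ) ^ 2 * (Q * 7) ≤ (n : ℝ) ^ 2 * (n * 7) := by gcongr
          _ = _ := by ring
      have hn3 : (10 : ℝ) ≤ n := by linarith
      calc _ ≤ 2 * (n : ℝ) * (7 * (n : ℝ) ^ 3) * Real.exp (-(8 * Real.log n)) +
            ((n + 1) * 5) * Real.exp (-(8 * Real.log n)) := by
            refine add_le_add ?_ h2
            gcongr
        _ = (14 * (n : ℝ) ^ 4 + 5 * (n + 1)) / (n : ℝ) ^ 8 := by rw [h3]; ring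
        _ < 1 := by
            rw [div_lt_one (by positivity)]
            have h5 : (10 : ℝ) ^ 4 ≤ (n : ℝ) ^ 4 := by gcongr
            have h6 : (n : ℝ) ≤ (n : ℝ) ^ 4 := le_self_pow₀ (by linarith) (by norm_num)
            have h7 : (10 : ℝ) ^ 4 * (n : ℝ) ^ 4 ≤ (n : ℝ) ^ 4 * (n : ℝ) ^ 4 := by gcongr
            have h8 : (n : ℝ) ^ 8 = (n : ℝ) ^ 4 * (n : ℝ) ^ 4 := by ring
            linarith)
  have hκ : ∀ (m : Fin 5) (j : ℕ) (c : ℕ), c = cl m →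
      (({v | colourClass (ω v).2.1 = c ∧
        ⌊((((ω v).1 : ℕ) : ℝ) / M * α m + β m) * d v / W m⌋₊ = j}.ncard : ℕ) : ℝ) ≤ μ m + s m := by
    rintro m j _ rfl
    -- Windows with index above n are empty, because targets are at most n and window lengths at
    -- least 1; n + 1 values of j suffice.
    by_cases hj : j < n + 1
    · refine le_trans (le_of_eq ?_) (hB (⟨j, hj⟩, m))
      rw [← Set.ncard_coe_finset]
      congr 2
      ext v
      simp only [B, Finset.coe_filter, Finset.mem_univ, true_and, Finset.mem_product,
        Finset.mem_filter, Set.mem_ofPred_eq]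
      exact and_comm
    · have h0 : {v | colourClass (ω v).2.1 = cl m ∧
        ⌊((((ω v).1 : ℕ) : ℝ) / M * α m + β m) * d v / W m⌋₊ = j} = ∅ := by
        ext v
        simp only [Set.mem_ofPred_eq, Set.mem_empty_iff_false, iff_false]
        rintro ⟨-, h⟩
        apply hj
        have h1 : (((ω v).1 : ℕ) : ℝ) / M ≤ 1 := by
          rw [div_le_one hMR]; exact_mod_cast (ω v).1.2.le
        have h2 : ((((ω v).1 : ℕ) : ℝ) / M * α m + β m) * d v / W m ≤ n := by
          rw [div_le_iff₀ (zero_lt_one.trans_le (hW m))]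
          have h3 : (((ω v).1 : ℕ) : ℝ) / M * α m + β m ≤ 1 := by
            have := mul_le_mul_of_nonneg_right h1 (hα m).le
            linarith [hαβ m]
          calc _ ≤ 1 * (n : ℝ) := mul_le_mul h3 (hdn v) (hd0 v).le zero_le_one
            _ = n * 1 := by ring
            _ ≤ n * W m := by gcongr; exact hW m
        have := Nat.floor_le_of_le h2
        omega
      rw [h0, Set.ncard_empty, Nat.cast_zero]
      exact (Nat.cast_nonneg _).trans (hB (⟨0, by omega⟩, m))
  have hA : ∀ j : ℕ, {v | colourClass (ω v).2.1 = 3 ∧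
      ⌊((((ω v).1 : ℕ) : ℝ) / M * (1 - ρ) + ρ / 2) * d v / w⌋₊ = j}.ncard ≤
        w * ⌈(n : ℝ) / ((δ : ℝ) + 1)⌉₊ := by
    intro j
    have h1 := hκ 0 j 3 rfl
    change _ ≤ n * w / δ * (1 - p) + n * w / δ * (p / 2) at h1
    rw [← Nat.cast_le (α := ℝ)]
    refine h1.trans ?_
    push_cast
    -- The remaining factor 1 - p/2 turns δ into δ + 1, because pδ/2 ≥ 1.
    calc n * w / δ * (1 - p) + n * w / δ * (p / 2) = w * (n / δ * (1 - p / 2)) := by ring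
      _ ≤ w * (n / ((δ : ℝ) + 1)) := by
          gcongr
          rw [le_div_iff₀ (by positivity)]
          have e : n / δ * (1 - p / 2) * ((δ : ℝ) + 1) = n * ((1 - p / 2) * (δ + 1) / δ) := by ring
          rw [e]
          refine mul_le_of_le_one_right (Nat.cast_nonneg _) ?_
          rw [div_le_one hδ0]
          have e' : (1 - p / 2) * ((δ : ℝ) + 1) = δ + 1 - p * δ / 2 - p / 2 := by ring
          linarith
      _ ≤ _ := by gcongr; exact Nat.le_ceil _
  have hC : ∀ x : ℕ, (x : ℝ) ≤ 4096 * p * (n * w' / δ) + 4096 * p * (n * w' / δ) →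
      x ≤ w' * (⌊8192 * (n : ℝ) / (P * δ)⌋₊ + 1) := by
    intro x hx
    rw [← Nat.cast_le (α := ℝ)]
    refine hx.trans ?_
    push_cast
    calc 4096 * p * (n * w' / δ) + 4096 * p * (n * w' / δ) = w' * (8192 * n / (P * δ)) := by
          rw [hp]; field_simp; ring
      _ ≤ _ := by gcongr; exact (Nat.lt_floor_add_one _).le
  obtain ⟨hz0, hz1, hz2, hz3⟩ : _ ∧ _ ∧ _ ∧ _ := ⟨fun i => (card_filter_colour P Q hP hQ hp i).1,
    fun i => (card_filter_colour P Q hP hQ hp i).2.1,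
    fun i => (card_filter_colour P Q hP hQ hp i).2.2.1,
    fun i => (card_filter_colour P Q hP hQ hp i).2.2.2⟩
  have hprod : ∀ (v : V) (i : Fin 7) (q : V → Prop) (r : ℝ),
      (∀ u, q u ↔ ω u ∈ S ((ω v).1, (ω v).2.2, i)) →
      ((S ((ω v).1, (ω v).2.2, i)).card : ℝ) / Fintype.card (Fin M × (Fin P × Fin Q)) = r →
      |(nbrCount G v q : ℝ) - r * d v| ≤ τ * d v := by
    intro v i q r hq hr
    have h := hω v ((ω v).1, (ω v).2.2, i)
    rw [hr, mul_comm, ← nbrCount_congr G v fun u _ => hq u] at h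
    rw [hd]
    exact h
  refine exists_subgraph_of_typical (p := p) (ρ := ρ) (σ := σ) (τ := τ) (δ := δ) G (fun v => colourClass (ω v).2.1)
    (fun v => colourClass_cases _) (fun u v => (ω u).2.2 = (ω v).2.2)
    (fun u v => M ≤ ((ω u).1 : ℕ) + (ω v).1) (fun u v h => h.symm) (fun u v h => by omega)
    (fun v => ((ω v).1 : ℕ) / M) d (fun v => by positivity) hp0 hp1 hρ (by linarith)
    (by linarith) hτ hδd hδ0 ?_ ?_ ?_ ?_ ?_ ?_ ?_ w w' _ _ (by exact_mod_cast hwpos) hw1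
    (by exact_mod_cast hwpos') hw1' hA (fun j => hC _ (hκ 1 j 0 rfl))
    (fun j => hC _ (hκ 2 j 1 rfl)) (fun j => hC _ (hκ 3 j 2 rfl)) (fun j => hC _ (hκ 4 j 2 rfl))
  · intro v _
    refine hprod v 0 _ _ (fun u => ?_) ?_
    · change _ ↔ ω u ∈ U (ω v).1 ×ˢ Finset.univ.filter
        fun z : Fin P × Fin Q => colourClass z.1 = 3 ∨ z.2 ≠ (ω v).2.2
      simp only [Finset.mem_product, Finset.mem_filter, Finset.mem_univ, true_and, U, ne_eq,
        eq_comm (a := (ω v).2.2), add_comm ((ω v).1 : ℕ)]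
      exact and_comm
    · refine (hratio _ _).trans ?_
      rw [hU, hz0, ← hρ]
  · intro v _
    have h := hprod v 1 (fun u => colourClass (ω u).2.1 ≠ 3 ∧ (ω v).2.2 = (ω u).2.2) ρ
      (fun u => by
        change _ ↔ ω u ∈ Finset.univ ×ˢ Finset.univ.filter
          fun z : Fin P × Fin Q => colourClass z.1 ≠ 3 ∧ z.2 = (ω v).2.2
        simp only [Finset.mem_product, Finset.mem_filter, Finset.mem_univ, true_and,
          eq_comm (a := (ω v).2.2)])
      ((hratio' _).trans (by rw [hz1, ← hρ]))
    have := (abs_le.1 h).1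
    linarith
  · intro v
    refine hprod v 2 _ _ (fun u => ?_) ?_
    · change _ ↔ ω u ∈ U (ω v).1 ×ˢ Finset.univ.filter
        fun z : Fin P × Fin Q => colourClass z.1 = 3 ∧ z.2 ≠ (ω v).2.2
      simp only [Finset.mem_product, Finset.mem_filter, Finset.mem_univ, true_and, U, ne_eq,
        eq_comm (a := (ω v).2.2), add_comm ((ω v).1 : ℕ)]
      tauto
    · refine (hratio _ _).trans ?_
      rw [hU, hz2, ← hσ]
  · intro v
    have h := hprod v 3 (fun u => colourClass (ω u).2.1 = 3 ∧ (ω v).2.2 = (ω u).2.2)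
      ((1 - 73 * p) * (p / 32))
      (fun u => by
        change _ ↔ ω u ∈ Finset.univ ×ˢ Finset.univ.filter
          fun z : Fin P × Fin Q => colourClass z.1 = 3 ∧ z.2 = (ω v).2.2
        simp only [Finset.mem_product, Finset.mem_filter, Finset.mem_univ, true_and,
          eq_comm (a := (ω v).2.2)])
      ((hratio' _).trans (by rw [hz3]))
    have h1 := (abs_le.1 h).2
    have h2 : (1 - 73 * p) * (p / 32) * d v ≤ p / 32 * d v := by
      have := hd0 v
      gcongr
      exact mul_le_of_le_one_left (by positivity) (by linarith)
    linarith
  · intro v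
    refine hprod v 4 _ _ (fun u => ?_) ((hratio' _).trans hc0)
    change _ ↔ ω u ∈ Finset.univ ×ˢ Finset.univ.filter
      fun z : Fin P × Fin Q => colourClass z.1 = 0
    simp
  · intro v
    refine hprod v 5 _ _ (fun u => ?_) ((hratio' _).trans hc1)
    change _ ↔ ω u ∈ Finset.univ ×ˢ Finset.univ.filter
      fun z : Fin P × Fin Q => colourClass z.1 = 1
    simp
  · intro v
    refine hprod v 6 _ _ (fun u => ?_) ((hratio' _).trans hc2)
    change _ ↔ ω u ∈ Finset.univ ×ˢ Finset.univ.filter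
      fun z : Fin P × Fin Q => colourClass z.1 = 2
    simp

theorem nbrCount_true_eq_degree {V : Type*} [Fintype V] (G : SimpleGraph V) [DecidableRel G.Adj]
    (v : V) : nbrCount G v (fun _ => True) = G.degree v := by
  classical
  unfold nbrCount
  rw [← SimpleGraph.card_neighborFinset_eq_degree, SimpleGraph.neighborFinset_eq_filter]
  congr 1
  ext u
  simp

theorem minDegree_le_nbrCount {V : Type*} [Fintype V] (G : SimpleGraph V) [DecidableRel G.Adj]
    (v : V) : G.minDegree ≤ nbrCount G v (fun _ => True) := by
  rw [nbrCount_true_eq_degree]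
  exact G.minDegree_le_degree v

/-! ### Choice of the parameter and the bounds for large minimum degree -/

/-- The main construction with the best choice of its parameter. -/
theorem exists_subgraph_of_log_le {V : Type*} [Fintype V] (G : SimpleGraph V) (δ : ℕ)
    (hδ : ∀ v, δ ≤ nbrCount G v (fun _ => True)) (hn : 2 ≤ Fintype.card V)
    (hbig : 16000000000000 * Real.log (Fintype.card V) ≤ δ) :
    ∃ H ≤ G, maxDegCount H ≤ ⌈(Fintype.card V : ℝ) / ((δ : ℝ) + 1)⌉₊ +
      ⌊163840 * (Real.log (Fintype.card V) / δ) ^ (1 / 4 : ℝ) *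
        ((Fintype.card V : ℝ) / δ)⌋₊ + 1 := by
  set n : ℝ := (Fintype.card V : ℝ) with hn'
  set L := Real.log n with hL
  have hnR : (2 : ℝ) ≤ n := by rw [hn']; exact_mod_cast hn
  have hL0 : 0 < L := Real.log_pos (by linarith)
  have hδ0 : (0 : ℝ) < δ := by linarith
  set y : ℝ := (L / δ) ^ (1 / 4 : ℝ) with hy
  have hy0 : 0 < y := by positivity
  have hy4 : y ^ 4 = L / δ := by
    rw [hy, ← Real.rpow_natCast, ← Real.rpow_mul (by positivity)]
    norm_num
  have hy1 : y ≤ 1 / 2000 := by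
    refine le_of_pow_le_pow_left₀ (n := 4) (by norm_num) (by norm_num) ?_
    rw [hy4, div_le_iff₀ hδ0]
    linarith
  -- Nearly the largest P with 8192 P⁴ ln n ≤ δ. The constant 16·10¹² = 2000⁴ in the hypothesis
  -- ensures P ≥ 200, and P ≥ 1/(20y) yields 163840 = 20 · 8192.
  set P := ⌊1 / (10 * y)⌋₊ with hP
  have hx : 200 ≤ 1 / (10 * y) := by rw [le_div_iff₀ (by positivity)]; linarith
  have hP1 : 200 ≤ P := Nat.le_floor (by exact_mod_cast hx)
  have hP2 : (P : ℝ) ≤ 1 / (10 * y) := Nat.floor_le (by positivity)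
  have hP3 : 1 / (20 * y) ≤ P := by
    have h1 := Nat.lt_floor_add_one (1 / (10 * y))
    have h2 : 1 / (10 * y) = 2 * (1 / (20 * y)) := by field_simp; norm_num
    rw [← hP] at h1
    linarith
  obtain ⟨H, hH, hHt⟩ := exists_subgraph_of_large_degree G δ P hP1 hδ hn (by
    change 8192 * (P : ℝ) ^ 4 * L ≤ δ
    have h1 : (P : ℝ) ^ 4 ≤ (1 / (10 * y)) ^ 4 := by gcongr
    have h2 : (1 / (10 * y)) ^ 4 = δ / (10000 * L) := by
      rw [div_pow, mul_pow, hy4]; field_simp; norm_num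
    rw [h2, le_div_iff₀ (by positivity)] at h1
    have h3 : 0 ≤ (P : ℝ) ^ 4 * L := by positivity
    linarith)
  refine ⟨H, hH, (maxDegCount_le_iff _ _).2 fun t => (hHt t).trans ?_⟩
  rw [add_assoc]
  gcongr
  change 8192 * n / (P * δ) ≤ _
  calc 8192 * n / (P * δ) ≤ 8192 * n / (1 / (20 * y) * δ) := by gcongr
    _ = _ := by field_simp; norm_num

/-- `hlt` says precisely that the error term of `exists_subgraph_of_log_le` is below 1, so its floor
vanishes. -/
theorem exists_subgraph_of_small_ratio {V : Type*} [Fintype V] (G : SimpleGraph V) (δ : ℕ)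
    (hδ : ∀ v, δ ≤ nbrCount G v (fun _ => True)) (hn : 2 ≤ Fintype.card V)
    (hbig : 16000000000000 * Real.log (Fintype.card V) ≤ δ)
    (hlt : 163840 * Real.log (Fintype.card V) ^ (1 / 4 : ℝ) * Fintype.card V <
      (δ : ℝ) ^ (5 / 4 : ℝ)) :
    ∃ H ≤ G, maxDegCount H ≤ ⌈(Fintype.card V : ℝ) / ((δ : ℝ) + 1)⌉₊ + 2 := by
  obtain ⟨H, hH, h⟩ := exists_subgraph_of_log_le G δ hδ hn hbig
  refine ⟨H, hH, h.trans ?_⟩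
  have hnR : (2 : ℝ) ≤ Fintype.card V := by exact_mod_cast hn
  have hL0 : 0 < Real.log (Fintype.card V) := Real.log_pos (by linarith)
  have hδ0 : (0 : ℝ) < δ := by linarith
  have h0 : ⌊163840 * (Real.log (Fintype.card V) / δ) ^ (1 / 4 : ℝ) *
        ((Fintype.card V : ℝ) / δ)⌋₊ = 0 := by
    rw [Nat.floor_eq_zero, Real.div_rpow hL0.le hδ0.le]
    have e : (δ : ℝ) ^ (5 / 4 : ℝ) = δ ^ (1 / 4 : ℝ) * δ := by
      rw [← Real.rpow_add_one hδ0.ne']; norm_num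
    rw [e] at hlt
    have : 163840 * (Real.log (Fintype.card V) ^ (1 / 4 : ℝ) / δ ^ (1 / 4 : ℝ)) *
        ((Fintype.card V : ℝ) / δ) = 163840 * Real.log (Fintype.card V) ^ (1 / 4 : ℝ) *
        Fintype.card V / (δ ^ (1 / 4 : ℝ) * δ) := by field_simp
    rw [this, div_lt_one (by positivity)]
    exact hlt
  omega

theorem eventually_log_ge (c : ℝ) : ∀ᶠ n : ℕ in atTop, c ≤ Real.log n :=
  (Real.tendsto_log_atTop.comp tendsto_natCast_atTop_atTop).eventually_ge_atTop c

theorem eventually_mul_log_le_rpow (c : ℝ) {a : ℝ} (ha : 0 < a) :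
    ∀ᶠ n : ℕ in atTop, c * Real.log n ≤ (n : ℝ) ^ a := by
  have h := (isLittleO_log_rpow_atTop ha).bound (show (0 : ℝ) < 1 / (|c| + 1) by positivity)
  filter_upwards [tendsto_natCast_atTop_atTop.eventually h, eventually_ge_atTop 1] with n hn hn1
  have h1 : (1 : ℝ) ≤ n := by exact_mod_cast hn1
  have h2 := Real.log_nonneg h1
  rw [Real.norm_of_nonneg h2, Real.norm_of_nonneg (by positivity)] at hn
  have h3 : c * Real.log n ≤ (|c| + 1) * Real.log n := by
    gcongr; linarith [le_abs_self c]
  refine h3.trans ?_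
  have h4 := mul_le_mul_of_nonneg_left hn (show 0 ≤ |c| + 1 by positivity)
  refine h4.trans (le_of_eq ?_)
  field_simp

/-- Compares the constant and logarithmic factor of the construction with the weaker explicit ones
of part (3). -/
theorem quarter_root_bound {L : ℝ} (hL : 16000000000000 ≤ L) :
    163840 * L ^ (1 / 4 : ℝ) < 2016 * L := by
  have hL0 : 0 < L := by linarith
  set a := L ^ (1 / 4 : ℝ) with ha
  have ha0 : 0 < a := by positivity
  have ha4 : a ^ 4 = L := by
    rw [ha, ← Real.rpow_natCast, ← Real.rpow_mul hL0.le]; norm_num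
  have h100 : 100 ≤ a := by
    refine le_of_pow_le_pow_left₀ (n := 4) (by norm_num) ha0.le ?_
    rw [ha4]; norm_num; linarith
  rw [← ha4]
  have h3 : (100 : ℝ) ^ 3 ≤ a ^ 3 := by gcongr
  have : (100 : ℝ) ^ 3 * a ≤ a ^ 3 * a := by gcongr
  nlinarith

/-- The explicit bound, for the range in which the minimum degree is at least a power of `log n`. -/
theorem explicit_bound {ε : ℝ} (hε : 0 < ε) (hε1 : ε < 1 / 4) :
    ∃ N : ℕ, ∀ (V : Type*) [Fintype V] (G : SimpleGraph V) (δ : ℕ)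
      (_ : ∀ v, δ ≤ nbrCount G v (fun _ => True)), N ≤ Fintype.card V →
      Real.log (Fintype.card V) ^ (2 / ε) * Real.log (Real.log (Fintype.card V)) ^ (1 / ε) ≤ δ →
      ∃ H ≤ G, maxDegCount H ≤ ⌈(Fintype.card V : ℝ) / δ + 5 * √((Fintype.card V : ℝ) / δ *
          Real.log (Fintype.card V)) / (δ : ℝ) ^ (1 / 4 : ℝ)⌉₊ +
        ⌊2016 * (Fintype.card V : ℝ) * Real.log (Fintype.card V) *
          Real.log (Real.log (Fintype.card V)) / (δ : ℝ) ^ (1 + ε)⌋₊ + 1 := by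
  obtain ⟨N, hN⟩ := eventually_atTop.1 (eventually_log_ge 16000000000000)
  refine ⟨max N 2, fun V _ G δ hδ hNn hbig => ?_⟩
  have hn : 2 ≤ Fintype.card V := (le_max_right _ _).trans hNn
  have hL := hN _ ((le_max_left _ _).trans hNn)
  set n : ℝ := (Fintype.card V : ℝ) with hn'
  set L := Real.log n with hL'
  have hL0 : 0 < L := by linarith
  have hLL : 1 ≤ Real.log L := by
    rw [Real.le_log_iff_exp_le hL0]
    have := Real.exp_one_lt_d9
    linarith
  have hδL : L ^ 2 ≤ δ := by
    refine le_trans ?_ hbig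
    have h1 : L ^ (2 : ℝ) ≤ L ^ (2 / ε) := by
      refine Real.rpow_le_rpow_of_exponent_le (by linarith) ?_
      rw [le_div_iff₀ hε]; linarith
    have h2 : 1 ≤ Real.log L ^ (1 / ε) := Real.one_le_rpow hLL (by positivity)
    rw [Real.rpow_two] at h1
    calc L ^ 2 ≤ L ^ (2 / ε) * 1 := by linarith
      _ ≤ _ := by gcongr
  have hδbig : 16000000000000 * L ≤ δ := by nlinarith
  have hδ0 : (0 : ℝ) < δ := by linarith
  have hδ1 : (1 : ℝ) ≤ δ := by linarith
  obtain ⟨H, hH, h⟩ := exists_subgraph_of_log_le G δ hδ hn hδbig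
  refine ⟨H, hH, h.trans ?_⟩
  have hn0 : 0 ≤ n := Nat.cast_nonneg _
  gcongr ?_ + ?_ + 1
  · refine Nat.ceil_mono ?_
    have h1 : n / ((δ : ℝ) + 1) ≤ n / δ := by gcongr; linarith
    have h2 : 0 ≤ 5 * √(n / δ * L) / (δ : ℝ) ^ (1 / 4 : ℝ) := by positivity
    exact h1.trans (by linarith)
  · refine Nat.floor_mono ?_
    -- The construction gains δ^{1/4}, so every ε < 1/4 is covered. The square-root term and the
    -- factor ln ln n ≥ 1 are pure slack.
    have hq : (δ : ℝ) ^ ε ≤ (δ : ℝ) ^ (1 / 4 : ℝ) :=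
      Real.rpow_le_rpow_of_exponent_le hδ1 hε1.le
    have hq0 : 0 < (δ : ℝ) ^ ε := by positivity
    rw [Real.div_rpow hL0.le hδ0.le, Real.rpow_add hδ0, Real.rpow_one]
    have h1 := (quarter_root_bound hL).le
    calc 163840 * (L ^ (1 / 4 : ℝ) / (δ : ℝ) ^ (1 / 4 : ℝ)) * (n / δ)
        = 163840 * L ^ (1 / 4 : ℝ) / (δ : ℝ) ^ (1 / 4 : ℝ) * (n / δ) := by ring
      _ ≤ 2016 * L / (δ : ℝ) ^ ε * (n / δ) := by gcongr
      _ = 2016 * n * L * 1 / (δ * (δ : ℝ) ^ ε) := by field_simp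
      _ ≤ _ := by gcongr

/-- As ε < 1/4, the hypothesis bounds a multiple of n ln n by δ^{5/4}. This both makes δ ≥ n^{4/5},
far above ln n, and makes the error term less than 1. -/
theorem dense_bound :
    ∃ N : ℕ, ∀ (V : Type*) [Fintype V] (G : SimpleGraph V) (δ : ℕ)
      (_ : ∀ v, δ ≤ nbrCount G v (fun _ => True)), N ≤ Fintype.card V →
      ∀ ε : ℝ, 0 < ε → ε < 1 / 4 →
      2016 * (Fintype.card V : ℝ) * Real.log (Fintype.card V) *
          Real.log (Real.log (Fintype.card V)) < (δ : ℝ) ^ (1 + ε) →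
      ∃ H ≤ G, maxDegCount H ≤ ⌈(Fintype.card V : ℝ) / ((δ : ℝ) + 1)⌉₊ + 2 := by
  obtain ⟨N, hN⟩ := eventually_atTop.1 (eventually_log_ge 16000000000000)
  obtain ⟨N', hN'⟩ := eventually_atTop.1
    (eventually_mul_log_le_rpow 16000000000000 (a := 4 / 5) (by norm_num))
  refine ⟨max (max N N') 2, fun V _ G δ hδ hNn ε hε hε1 hlt => ?_⟩
  have hn : 2 ≤ Fintype.card V := (le_max_right _ _).trans hNn
  have hL := hN _ ((le_max_left _ _).trans ((le_max_left _ _).trans hNn))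
  have hL2 := hN' _ ((le_max_right _ _).trans ((le_max_left _ _).trans hNn))
  have hn1 : (1 : ℝ) ≤ Fintype.card V := by exact_mod_cast (by omega : 1 ≤ Fintype.card V)
  set n : ℝ := (Fintype.card V : ℝ) with hn'
  set L := Real.log n with hL'
  have hL0 : 0 < L := by linarith
  have hLL : 1 ≤ Real.log L := by
    rw [Real.le_log_iff_exp_le hL0]
    have := Real.exp_one_lt_d9
    linarith
  have h1 : 2016 * n * L ≤ 2016 * n * L * Real.log L := le_mul_of_one_le_right (by positivity) hLL
  have hδ1 : (1 : ℝ) ≤ δ := by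
    rcases Nat.eq_zero_or_pos δ with h | h
    · rw [h, Nat.cast_zero, Real.zero_rpow (by linarith)] at hlt
      have : 0 < 2016 * n * L := by positivity
      linarith
    · exact_mod_cast h
  have h2 : (δ : ℝ) ^ (1 + ε) ≤ (δ : ℝ) ^ (5 / 4 : ℝ) :=
    Real.rpow_le_rpow_of_exponent_le hδ1 (by linarith)
  refine exists_subgraph_of_small_ratio G δ hδ hn ?_ ?_
  · refine hL2.trans ?_
    have h3 : n ≤ (δ : ℝ) ^ (5 / 4 : ℝ) := by nlinarith
    calc n ^ (4 / 5 : ℝ) ≤ ((δ : ℝ) ^ (5 / 4 : ℝ)) ^ (4 / 5 : ℝ) := by gcongr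
      _ = δ := by rw [← Real.rpow_mul (by linarith)]; norm_num
  · have h3 := quarter_root_bound hL
    have h4 : 163840 * L ^ (1 / 4 : ℝ) * n < 2016 * L * n := by gcongr
    linarith

/-- The exponent 1.24 falls short of 5/4 by 1/100, and δ^{1/100} eventually exceeds the remaining
factor (ln n)^{1/4}. -/
theorem very_dense_bound :
    ∃ N : ℕ, ∀ (V : Type*) [Fintype V] (G : SimpleGraph V) (δ : ℕ)
      (_ : ∀ v, δ ≤ nbrCount G v (fun _ => True)), N ≤ Fintype.card V →
      (Fintype.card V : ℝ) ≤ (δ : ℝ) ^ (1.24 : ℝ) →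
      ∃ H ≤ G, maxDegCount H ≤ ⌈(Fintype.card V : ℝ) / ((δ : ℝ) + 1)⌉₊ + 2 := by
  obtain ⟨N, hN⟩ := eventually_atTop.1 (eventually_log_ge 1)
  -- 1.24/31 = 1/25, whose quarter is the spare exponent 1/100; 163841 instead of 163840 provides
  -- strictness.
  obtain ⟨N', hN'⟩ := eventually_atTop.1
    (eventually_mul_log_le_rpow (163841 ^ 4) (a := 1 / 31) (by norm_num))
  refine ⟨max (max N N') 2, fun V _ G δ hδ hNn hle => ?_⟩
  have hn : 2 ≤ Fintype.card V := (le_max_right _ _).trans hNn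
  have hL := hN _ ((le_max_left _ _).trans ((le_max_left _ _).trans hNn))
  have hL2 := hN' _ ((le_max_right _ _).trans ((le_max_left _ _).trans hNn))
  have hn1 : (1 : ℝ) ≤ Fintype.card V := by exact_mod_cast (by omega : 1 ≤ Fintype.card V)
  set n : ℝ := (Fintype.card V : ℝ) with hn'
  set L := Real.log n with hL'
  have hL0 : 0 < L := by linarith
  have hδ1 : (1 : ℝ) ≤ δ := by
    rcases Nat.eq_zero_or_pos δ with h | h
    · rw [h, Nat.cast_zero, Real.zero_rpow (by norm_num)] at hle
      linarith
    · exact_mod_cast h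
  have h3 : 163841 ^ 4 * L ≤ (δ : ℝ) ^ (1 / 25 : ℝ) := by
    refine hL2.trans ?_
    calc n ^ (1 / 31 : ℝ) ≤ ((δ : ℝ) ^ (1.24 : ℝ)) ^ (1 / 31 : ℝ) := by gcongr
      _ = _ := by rw [← Real.rpow_mul (by linarith)]; norm_num
  refine exists_subgraph_of_small_ratio G δ hδ hn ?_ ?_
  · have h4 : (δ : ℝ) ^ (1 / 25 : ℝ) ≤ (δ : ℝ) ^ (1 : ℝ) :=
      Real.rpow_le_rpow_of_exponent_le hδ1 (by norm_num)
    rw [Real.rpow_one] at h4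
    change 16000000000000 * L ≤ δ
    nlinarith
  · have h5 : 163841 * L ^ (1 / 4 : ℝ) ≤ (δ : ℝ) ^ (1 / 100 : ℝ) := by
      calc 163841 * L ^ (1 / 4 : ℝ) = (163841 ^ 4 * L) ^ (1 / 4 : ℝ) := by
            rw [Real.mul_rpow (by norm_num) hL0.le, ← Real.rpow_natCast, ← Real.rpow_mul (by norm_num)]
            norm_num
        _ ≤ ((δ : ℝ) ^ (1 / 25 : ℝ)) ^ (1 / 4 : ℝ) := by gcongr
        _ = _ := by rw [← Real.rpow_mul (by linarith)]; norm_num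
    have h6 : (0 : ℝ) < L ^ (1 / 4 : ℝ) := by positivity
    have h7 : (δ : ℝ) ^ (5 / 4 : ℝ) = (δ : ℝ) ^ (1 / 100 : ℝ) * (δ : ℝ) ^ (1.24 : ℝ) := by
      rw [← Real.rpow_add (by linarith)]; norm_num
    change 163840 * L ^ (1 / 4 : ℝ) * n < _
    rw [h7]
    have h8 : 163840 * L ^ (1 / 4 : ℝ) < (δ : ℝ) ^ (1 / 100 : ℝ) := by linarith
    calc 163840 * L ^ (1 / 4 : ℝ) * n < (δ : ℝ) ^ (1 / 100 : ℝ) * n := by gcongr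
      _ ≤ _ := by gcongr

/-- The asymptotic bound when the minimum degree is at least a small power of `n`. -/
theorem asymptotic_bound_of_large_degree {V : Type*} [Fintype V] (G : SimpleGraph V) (δ : ℕ)
    (hδ : ∀ v, δ ≤ nbrCount G v (fun _ => True)) (hn : 2 ≤ Fintype.card V)
    (hlog : 16000000000000 * Real.log (Fintype.card V) ≤ (Fintype.card V : ℝ) ^ (1 / 20 : ℝ))
    (hbig : (Fintype.card V : ℝ) ^ (1 / 20 : ℝ) ≤ δ) :
    ∃ H ≤ G, (maxDegCount H : ℝ) ≤ (1 + 327680 * (Real.log (Fintype.card V) /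
      (Fintype.card V : ℝ) ^ (1 / 20 : ℝ)) ^ (1 / 4 : ℝ)) *
        (⌈(Fintype.card V : ℝ) / ((δ : ℝ) + 1)⌉₊ : ℝ) + 2 := by
  obtain ⟨H, hH, h⟩ := exists_subgraph_of_log_le G δ hδ hn (hlog.trans hbig)
  refine ⟨H, hH, ?_⟩
  set n : ℝ := (Fintype.card V : ℝ) with hn'
  have hn2 : (2 : ℝ) ≤ n := by rw [hn']; exact_mod_cast hn
  set L := Real.log n with hL
  have hL0 : 0 < L := Real.log_pos (by linarith)
  have hδ0 : (0 : ℝ) < δ := by linarith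
  have hδ1 : (1 : ℝ) ≤ δ := by exact_mod_cast hδ0
  have h1 : (maxDegCount H : ℝ) ≤ (⌈n / ((δ : ℝ) + 1)⌉₊ : ℝ) +
      (⌊163840 * (L / δ) ^ (1 / 4 : ℝ) * (n / δ)⌋₊ : ℝ) + 1 := by exact_mod_cast h
  have h2 : (⌊163840 * (L / δ) ^ (1 / 4 : ℝ) * (n / δ)⌋₊ : ℝ) ≤
      163840 * (L / δ) ^ (1 / 4 : ℝ) * (n / δ) := Nat.floor_le (by positivity)
  have h3 : n / δ ≤ 2 * (⌈n / ((δ : ℝ) + 1)⌉₊ : ℝ) := by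
    have := Nat.le_ceil (n / ((δ : ℝ) + 1))
    have h4 : n / δ ≤ 2 * (n / ((δ : ℝ) + 1)) := by
      rw [← mul_div_assoc, div_le_div_iff₀ hδ0 (by linarith)]
      nlinarith
    linarith
  have h4 : 163840 * (L / δ) ^ (1 / 4 : ℝ) * (n / δ) ≤
      163840 * (L / n ^ (1 / 20 : ℝ)) ^ (1 / 4 : ℝ) * (2 * (⌈n / ((δ : ℝ) + 1)⌉₊ : ℝ)) := by
    gcongr
  linarith

/-! ### Second moments and independence, in counting form -/

section Chebyshev

open Classical in
/-- Chebyshev's inequality in counting form, for events of which most pairs are not positively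
correlated. -/
theorem card_mul_sq_le_of_second_moment {V Ω : Type*} [Fintype V] [Fintype Ω] [Nonempty Ω]
    [DecidableEq Ω] (E : V → Finset Ω) (near : V → V → Prop) (B : ℝ)
    (hB : ((Finset.univ.filter fun e : V × V => near e.1 e.2).card : ℝ) ≤ B)
    (hE : ∀ v w, ¬ near v w → (E v ∩ E w).card * Fintype.card Ω ≤ (E v).card * (E w).card)
    {m t : ℝ} (ht : 0 ≤ t) (hm : (∑ v, ((E v).card : ℝ)) ≤ m * Fintype.card Ω) :
    ((Finset.univ.filter fun ω : Ω =>
      m + t ≤ ((Finset.univ.filter fun v => ω ∈ E v).card : ℝ)).card : ℝ) * t ^ 2 ≤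
      B * Fintype.card Ω := by
  have hN : (0 : ℝ) < Fintype.card Ω := by exact_mod_cast Fintype.card_pos
  set N : ℝ := (Fintype.card Ω : ℝ) with hNdef
  set X : Ω → ℝ := fun ω => ((Finset.univ.filter fun v => ω ∈ E v).card : ℝ) with hX
  have hXs : ∀ ω, X ω = ∑ v, if ω ∈ E v then (1 : ℝ) else 0 := by
    intro ω; simp [hX]
  set S : ℝ := ∑ v, ((E v).card : ℝ) with hS
  have h1 : ∑ ω, X ω = S := by
    simp_rw [hXs]
    rw [Finset.sum_comm]
    simp [hS]
  have h2 : ∑ ω, X ω ^ 2 = ∑ v, ∑ w, ((E v ∩ E w).card : ℝ) := by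
    simp_rw [hXs, sq, Finset.sum_mul_sum]
    rw [Finset.sum_comm]
    refine Finset.sum_congr rfl fun v _ => ?_
    rw [Finset.sum_comm]
    refine Finset.sum_congr rfl fun w _ => ?_
    rw [← Finset.filter_mem_eq_inter, Finset.card_filter]
    push_cast
    rw [← Finset.sum_filter_add_sum_filter_not Finset.univ (fun ω => ω ∈ E v)]
    rw [Finset.filter_mem_eq_inter, Finset.univ_inter]
    rw [Finset.sum_eq_zero (s := Finset.univ.filter fun ω => ω ∉ E v), add_zero]
    · exact Finset.sum_congr rfl fun ω hω => by simp [hω]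
    · intro ω hω
      simp only [Finset.mem_filter, Finset.mem_univ, true_and] at hω
      simp [hω]
  -- Pairs that are not near contribute no more than under independence, and each near pair
  -- contributes at most N; hence the variance is at most B.
  have h3 : N * ∑ ω, X ω ^ 2 ≤ S ^ 2 + N ^ 2 * B := by
    rw [h2, Finset.mul_sum]
    simp_rw [Finset.mul_sum]
    have h4 : ∀ v w, N * ((E v ∩ E w).card : ℝ) ≤ ((E v).card : ℝ) * (E w).card +
        N ^ 2 * if near v w then 1 else 0 := by
      intro v w
      by_cases h : near v w
      · have h5 : ((E v ∩ E w).card : ℝ) ≤ N := by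
          rw [hNdef]; exact_mod_cast Finset.card_le_univ _
        have h6 : (0 : ℝ) ≤ ((E v).card : ℝ) * (E w).card := by positivity
        simp only [h, if_true]
        nlinarith
      · have h5 : ((E v ∩ E w).card : ℝ) * N ≤ ((E v).card : ℝ) * (E w).card := by
          rw [hNdef]; exact_mod_cast hE v w h
        simp only [h, if_false, mul_zero, add_zero]
        linarith
    refine (Finset.sum_le_sum fun v _ => Finset.sum_le_sum fun w _ => h4 v w).trans ?_
    simp_rw [Finset.sum_add_distrib]
    rw [← Finset.sum_mul_sum, ← sq]
    simp_rw [← Finset.mul_sum]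
    have h7 : ∑ v, ∑ w, (if near v w then (1 : ℝ) else 0) =
        ((Finset.univ.filter fun e : V × V => near e.1 e.2).card : ℝ) := by
      rw [Finset.card_filter, ← Finset.univ_product_univ, Finset.sum_product]
      push_cast
      rfl
    rw [h7]
    gcongr
  have h5 : ∑ ω, (X ω - S / N) ^ 2 ≤ N * B := by
    have e : ∑ ω, (X ω - S / N) ^ 2 = ∑ ω, X ω ^ 2 - S ^ 2 / N := by
      have : ∀ ω, (X ω - S / N) ^ 2 = X ω ^ 2 - 2 * (S / N) * X ω + (S / N) ^ 2 := fun ω => by ring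
      simp_rw [this]
      rw [Finset.sum_add_distrib, Finset.sum_sub_distrib, ← Finset.mul_sum, h1]
      simp only [Finset.sum_const, Finset.card_univ, nsmul_eq_mul]
      rw [← hNdef]
      field_simp
      ring
    rw [e, sub_le_iff_le_add, ← mul_le_mul_iff_right₀ hN]
    refine h3.trans (le_of_eq ?_)
    field_simp
    ring
  set bad := Finset.univ.filter fun ω : Ω => m + t ≤ X ω with hbad
  have h6 : S / N ≤ m := by rw [div_le_iff₀ hN]; exact hm
  calc (bad.card : ℝ) * t ^ 2 = ∑ ω ∈ bad, t ^ 2 := by rw [Finset.sum_const, nsmul_eq_mul]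
    _ ≤ ∑ ω ∈ bad, (X ω - S / N) ^ 2 := by
        refine Finset.sum_le_sum fun ω hω => ?_
        have := (Finset.mem_filter.1 hω).2
        gcongr
        linarith
    _ ≤ ∑ ω, (X ω - S / N) ^ 2 :=
        Finset.sum_le_sum_of_subset_of_nonneg (Finset.subset_univ _) fun _ _ _ => sq_nonneg _
    _ ≤ B * N := by rw [mul_comm]; exact h5

open Classical in
/-- Events depending on disjoint sets of coordinates are independent. -/
theorem card_inter_mul_le {I A : Type*} [Fintype I] [DecidableEq I] [Fintype A]
    [DecidableEq (I → A)] (E F : Finset (I → A)) (S T : Finset I) (hST : Disjoint S T)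
    (hE : ∀ ω ω' : I → A, (∀ i ∈ S, ω i = ω' i) → ω ∈ E → ω' ∈ E)
    (hF : ∀ ω ω' : I → A, (∀ i ∈ T, ω i = ω' i) → ω ∈ F → ω' ∈ F) :
    (E ∩ F).card * Fintype.card (I → A) ≤ E.card * F.card := by
  rw [← Finset.card_univ, ← Finset.card_product, ← Finset.card_product]
  -- Exchanging the S-coordinates of two points maps (E ∩ F) × Ω into E × F: the first image agrees
  -- with the old first point on S, the second agrees with it off S, hence on T.
  refine Finset.card_le_card_of_injOn (fun e => (S.piecewise e.1 e.2, S.piecewise e.2 e.1)) ?_ ?_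
  · rintro ⟨a, b⟩ h
    simp only [Finset.coe_product, Set.mem_prod, Finset.mem_coe, Finset.mem_inter] at h ⊢
    refine ⟨hE a _ (fun i hi => ?_) h.1.1, hF a _ (fun i hi => ?_) h.1.2⟩
    · rw [Finset.piecewise_eq_of_mem _ _ _ hi]
    · rw [Finset.piecewise_eq_of_notMem _ _ _ fun h => Finset.disjoint_left.1 hST h hi]
  · rintro ⟨a, b⟩ _ ⟨a', b'⟩ _ h
    simp only [Prod.mk.injEq] at h
    have h1 := fun i => congrFun h.1 i
    have h2 := fun i => congrFun h.2 i
    simp only [Finset.piecewise] at h1 h2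
    ext i
    · have := h1 i; have := h2 i
      dsimp only
      split_ifs at * <;> simp_all
    · have := h1 i; have := h2 i
      dsimp only
      split_ifs at * <;> simp_all

end Chebyshev

/-! ### Ranks of random labels are nearly uniform -/

section Rank

-- A tie has probability at most 1/M: overwriting coordinate s by an arbitrary value loses nothing,
-- since the old value is read off from t.
open Classical in
theorem card_filter_eq_mul_le {I : Type*} [Fintype I] [DecidableEq I]
    (M : ℕ) {s t : I} (hst : s ≠ t) :
    (Finset.univ.filter fun ω : I → Fin M => ω s = ω t).card * M ≤ Fintype.card (I → Fin M) := by
  have hM : (Finset.univ.filter fun ω : I → Fin M => ω s = ω t).card * M =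
      ((Finset.univ.filter fun ω : I → Fin M => ω s = ω t) ×ˢ
        (Finset.univ : Finset (Fin M))).card := by
    rw [Finset.card_product, Finset.card_univ, Fintype.card_fin]
  rw [hM, ← Finset.card_univ]
  refine Finset.card_le_card_of_injOn (fun e => Function.update e.1 s e.2) (by simp) ?_
  rintro ⟨ω, a⟩ h ⟨ω', a'⟩ h' heq
  simp only [Finset.coe_product, Set.mem_prod, Finset.coe_filter, Finset.mem_univ, true_and,
    Set.mem_ofPred_eq] at h h'
  have h1 := fun i => congrFun heq i
  have ha : a = a' := by simpa using h1 s
  have hne : ∀ i, i ≠ s → ω i = ω' i := fun i hi => by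
    have := h1 i
    simp only [Function.update_of_ne hi] at this
    exact this
  have hω : ω = ω' := by
    ext i
    by_cases hi : i = s
    · rw [hi, h.1, h'.1, hne t hst.symm]
    · rw [hne i hi]
  rw [ha, hω]

open Classical in
/-- The rank of a given coordinate among `S` is nearly uniformly distributed. -/
theorem card_rank_eq_mul_le {I : Type*} [Fintype I] [DecidableEq I]
    (M k : ℕ) (S : Finset I) (c : I) (hc : c ∈ S) :
    (Finset.univ.filter fun ω : I → Fin M => (S.filter fun t => ω t < ω c).card = k).card *
      S.card * M ≤ Fintype.card (I → Fin M) * (M + S.card ^ 3) := by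
  -- By exchangeability the events "s has rank k" for s in S are equally likely. Without ties at
  -- most one of them occurs, which gives 1/|S| up to the probability of a tie.
  set E : I → Finset (I → Fin M) := fun s =>
    Finset.univ.filter fun ω : I → Fin M => (S.filter fun t => ω t < ω s).card = k with hE
  have hswap : ∀ s ∈ S, (E s).card = (E c).card := by
    intro s hs
    refine Finset.card_bij (fun ω _ => ω ∘ Equiv.swap s c) ?_ ?_ ?_
    · intro ω hω
      simp only [hE, Finset.mem_filter, Finset.mem_univ, true_and, Function.comp_apply,
        Equiv.swap_apply_right] at hω ⊢
      rw [← hω]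
      refine Finset.card_bij (fun t _ => Equiv.swap s c t) ?_ ?_ ?_
      · intro t ht
        simp only [Finset.mem_filter] at ht ⊢
        refine ⟨?_, ht.2⟩
        rw [Equiv.swap_apply_def]
        split_ifs
        exacts [hc, hs, ht.1]
      · intro t _ t' _ h; exact (Equiv.swap s c).injective h
      · intro t ht
        simp only [Finset.mem_filter] at ht
        refine ⟨Equiv.swap s c t, ?_, Equiv.swap_apply_self _ _ _⟩
        simp only [Finset.mem_filter, Equiv.swap_apply_self]
        refine ⟨?_, ht.2⟩
        rw [Equiv.swap_apply_def]
        split_ifs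
        exacts [hc, hs, ht.1]
    · intro ω _ ω' _ h
      ext i
      have := congrFun h (Equiv.swap s c i)
      simp only [Function.comp_apply, Equiv.swap_apply_self] at this
      rw [this]
    · intro ω hω
      refine ⟨ω ∘ Equiv.swap s c, ?_, by ext i; simp⟩
      simp only [hE, Finset.mem_filter, Finset.mem_univ, true_and, Function.comp_apply,
        Equiv.swap_apply_left] at hω ⊢
      rw [← hω]
      refine Finset.card_bij (fun t _ => Equiv.swap s c t) ?_ ?_ ?_
      · intro t ht
        simp only [Finset.mem_filter] at ht ⊢
        refine ⟨?_, ht.2⟩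
        rw [Equiv.swap_apply_def]
        split_ifs
        exacts [hc, hs, ht.1]
      · intro t _ t' _ h; exact (Equiv.swap s c).injective h
      · intro t ht
        simp only [Finset.mem_filter] at ht
        refine ⟨Equiv.swap s c t, ?_, Equiv.swap_apply_self _ _ _⟩
        simp only [Finset.mem_filter, Equiv.swap_apply_self]
        refine ⟨?_, ht.2⟩
        rw [Equiv.swap_apply_def]
        split_ifs
        exacts [hc, hs, ht.1]
  have h1 : (E c).card * S.card = ∑ ω : I → Fin M, (S.filter fun s => ω ∈ E s).card := by
    simp_rw [Finset.card_filter]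
    rw [Finset.sum_comm]
    simp_rw [← Finset.card_filter, Finset.filter_mem_eq_inter, Finset.univ_inter]
    rw [Finset.sum_congr rfl hswap, Finset.sum_const, smul_eq_mul, mul_comm]
  have h2 : ∀ ω : I → Fin M, (S.filter fun s => ω ∈ E s).card ≤
      1 + S.card * ∑ e ∈ S.offDiag, if ω e.1 = ω e.2 then 1 else 0 := by
    intro ω
    by_cases hinj : ∀ s ∈ S, ∀ t ∈ S, s ≠ t → ω s ≠ ω t
    · refine le_add_right (Finset.card_le_one.2 fun s hs t ht => ?_)
      simp only [hE, Finset.mem_filter, Finset.mem_univ, true_and] at hs ht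
      by_contra hne
      have key : ∀ s t, s ∈ S → t ∈ S → ω s < ω t →
          (S.filter fun r => ω r < ω s).card < (S.filter fun r => ω r < ω t).card := by
        intro s t hs ht hlt
        refine Finset.card_lt_card ⟨fun r hr => ?_, fun hsub => ?_⟩
        · simp only [Finset.mem_filter] at hr ⊢
          exact ⟨hr.1, hr.2.trans hlt⟩
        · have := hsub (Finset.mem_filter.2 ⟨hs, hlt⟩)
          simp at this
      rcases lt_or_gt_of_ne (hinj s hs.1 t ht.1 hne) with h | h
      · have := key s t hs.1 ht.1 h; omega
      · have := key t s ht.1 hs.1 h; omega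
    · push Not at hinj
      obtain ⟨s, hs, t, ht, hne, heq⟩ := hinj
      have h3 : 1 ≤ ∑ e ∈ S.offDiag, if ω e.1 = ω e.2 then 1 else 0 := by
        refine le_trans ?_ (Finset.single_le_sum (f := fun e : I × I =>
          if ω e.1 = ω e.2 then 1 else 0) (fun _ _ => Nat.zero_le _)
          (Finset.mem_offDiag.2 ⟨hs, ht, hne⟩ : (s, t) ∈ S.offDiag))
        simp [heq]
      have h4 := Finset.card_filter_le S (fun s => ω ∈ E s)
      nlinarith
  have h3 : (∑ ω : I → Fin M, ∑ e ∈ S.offDiag, if ω e.1 = ω e.2 then 1 else 0) * M ≤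
      S.card ^ 2 * Fintype.card (I → Fin M) := by
    rw [Finset.sum_comm, Finset.sum_mul]
    refine (Finset.sum_le_card_nsmul _ _ (Fintype.card (I → Fin M)) fun e he => ?_).trans ?_
    · rw [← Finset.card_filter]
      exact card_filter_eq_mul_le M (Finset.mem_offDiag.1 he).2.2
    · rw [smul_eq_mul, Finset.offDiag_card]
      gcongr
      rw [sq]; exact Nat.sub_le _ _
  calc (E c).card * S.card * M
      ≤ (∑ ω : I → Fin M, (1 + S.card * ∑ e ∈ S.offDiag, if ω e.1 = ω e.2 then 1 else 0)) * M := by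
        rw [h1]; gcongr with ω; exact h2 ω
    _ = Fintype.card (I → Fin M) * M + S.card *
          ((∑ ω : I → Fin M, ∑ e ∈ S.offDiag, if ω e.1 = ω e.2 then 1 else 0) * M) := by
        rw [Finset.sum_add_distrib, ← Finset.mul_sum]
        simp only [Finset.sum_const, Finset.card_univ, smul_eq_mul, mul_one]
        ring
    _ ≤ Fintype.card (I → Fin M) * M + S.card * (S.card ^ 2 * Fintype.card (I → Fin M)) := by
        gcongr
    _ = _ := by ring

open Classical in
/-- The number of coordinates in `T` whose sum with the coordinate `c` is at least `M` is nearly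
uniformly distributed. -/
theorem card_threshold_eq_mul_le {I : Type*} [Fintype I] [DecidableEq I]
    (M k : ℕ) (T : Finset I) (c : I)
    (hc : c ∉ T) :
    (Finset.univ.filter fun ω : I → Fin M =>
      (T.filter fun t => M ≤ (ω c : ℕ) + ω t).card = k).card * (T.card + 1) * M ≤
      Fintype.card (I → Fin M) * (M + (T.card + 1) ^ 3) := by
  have h := card_rank_eq_mul_le M k (insert c T) c (Finset.mem_insert_self _ _)
  rw [Finset.card_insert_of_notMem hc] at h
  refine le_trans (le_of_eq ?_) h
  congr 2
  -- Reversing the labels on T turns the condition M ≤ ω c + ω t into the comparison of ω t with ω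
  -- c, so the threshold count becomes a rank in `insert c T`.
  refine Finset.card_bij (fun ω _ i => if i ∈ T then (ω i).rev else ω i) ?_ ?_ ?_
  · intro ω hω
    simp only [Finset.mem_filter, Finset.mem_univ, true_and, hc, if_false] at hω ⊢
    rw [← hω, Finset.filter_insert]
    simp only [hc, if_false, lt_irrefl]
    congr 1
    refine Finset.filter_congr fun t ht => ?_
    simp only [ht, if_true, Fin.lt_def, Fin.val_rev]
    have := (ω t).2
    omega
  · intro ω _ ω' _ h
    ext i
    have := congrFun h i
    by_cases hi : i ∈ T <;> simp only [hi, if_true, if_false] at this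
    · rw [Fin.rev_injective this]
    · rw [this]
  · intro ω hω
    refine ⟨fun i => if i ∈ T then (ω i).rev else ω i, ?_, ?_⟩
    · simp only [Finset.mem_filter, Finset.mem_univ, true_and, hc, if_false] at hω ⊢
      rw [← hω, Finset.filter_insert]
      simp only [lt_irrefl, if_false]
      congr 1
      refine Finset.filter_congr fun t ht => ?_
      simp only [ht, if_true, Fin.lt_def, Fin.val_rev]
      have := (ω t).2
      omega
    · ext i
      by_cases hi : i ∈ T <;> simp [hi]

end Rank

/-! ### Small minimum degree -/

section Sparse

open Classical in
theorem nbrCount_true {V : Type*} [Fintype V] (G : SimpleGraph V) (v : V) :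
    nbrCount G v (fun _ => True) = (Finset.univ.filter (G.Adj v)).card := by
  unfold nbrCount
  congr 1
  ext u
  simp

open Classical in
theorem nbrCount_deleteEdges_le {V : Type*} [Fintype V] (G : SimpleGraph V) (u v w : V) :
    nbrCount G w (fun _ => True) ≤ nbrCount (G.deleteEdges {s(u, v)}) w (fun _ => True) + 1 := by
  have hadj : ∀ x, (G.deleteEdges {s(u, v)}).Adj w x ↔ G.Adj w x ∧ ¬ s(w, x) = s(u, v) := by simp
  generalize G.deleteEdges {s(u, v)} = F at hadj ⊢
  rw [nbrCount_true, nbrCount_true]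
  refine (Finset.card_le_card (t := insert (if w = u then v else u)
    (Finset.univ.filter (F.Adj w))) ?_).trans (Finset.card_insert_le _ _)
  intro x hx
  simp only [Finset.mem_filter, Finset.mem_univ, true_and, Finset.mem_insert, hadj] at hx ⊢
  by_cases h : s(w, x) = s(u, v)
  · left
    rcases Sym2.eq_iff.1 h with ⟨h1, h2⟩ | ⟨h1, h2⟩
    · simp [h1, h2]
    · split_ifs with h3
      · rw [h2, ← h3, h1]
      · exact h2
  · exact Or.inr ⟨hx, h⟩

theorem nbrCount_deleteEdges_of_ne {V : Type*} [Fintype V] (G : SimpleGraph V) {u v w : V}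
    (hu : w ≠ u) (hv : w ≠ v) :
    nbrCount (G.deleteEdges {s(u, v)}) w (fun _ => True) = nbrCount G w (fun _ => True) := by
  classical
  unfold nbrCount
  congr 1
  ext x
  simp only [Finset.mem_filter, Finset.mem_univ, true_and, and_true, SimpleGraph.deleteEdges_adj,
    Set.mem_singleton_iff, and_iff_left_iff_imp]
  intro _ h
  rcases Sym2.eq_iff.1 h with h | h
  exacts [hu h.1, hv h.1]

/-- Among the spanning subgraphs of minimum degree at least `δ`, a minimal one has in every edge a
vertex of degree `δ`. -/
theorem exists_edge_minimal {V : Type*} [Fintype V] (G : SimpleGraph V) (δ : ℕ)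
    (hδ : ∀ v, δ ≤ nbrCount G v fun _ => True) :
    ∃ F ≤ G, (∀ v, δ ≤ nbrCount F v fun _ => True) ∧
      ∀ u v, F.Adj u v → nbrCount F u (fun _ => True) = δ ∨ nbrCount F v (fun _ => True) = δ := by
  obtain ⟨F, hF⟩ := (Set.toFinite {F : SimpleGraph V | F ≤ G ∧
    ∀ v, δ ≤ nbrCount F v fun _ => True}).exists_minimal ⟨G, le_rfl, hδ⟩
  refine ⟨F, hF.1.1, hF.1.2, fun u v huv => ?_⟩
  by_contra! h
  have hu := lt_of_le_of_ne (hF.1.2 u) h.1.symm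
  have hv := lt_of_le_of_ne (hF.1.2 v) h.2.symm
  have hle : F.deleteEdges {s(u, v)} ≤ F := SimpleGraph.deleteEdges_le _
  have := hF.2 (y := F.deleteEdges {s(u, v)}) ⟨hle.trans hF.1.1, fun w => ?_⟩ hle
  · have := this huv
    simp at this
  · by_cases h1 : w = u
    · have := nbrCount_deleteEdges_le F u v w
      subst h1; omega
    · by_cases h2 : w = v
      · have := nbrCount_deleteEdges_le F u v w
        subst h2; omega
      · rw [nbrCount_deleteEdges_of_ne F h1 h2]; exact hF.1.2 w

/-- The edges of `G` whose two labels have sum at least `M`. -/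
def thresholdGraph {V : Type*} (G : SimpleGraph V) (M : ℕ) (lab : V → V → ℕ) : SimpleGraph V where
  Adj u v := G.Adj u v ∧ M ≤ lab u v + lab v u
  symm := ⟨fun _ _ h => ⟨h.1.symm, by rw [add_comm]; exact h.2⟩⟩
  loopless := ⟨fun u h => G.loopless.irrefl u h.1⟩

-- A vertex of degree at least L > δ has only neighbours of degree exactly δ; count the edges
-- between the two kinds.
open Classical in
theorem card_heavy_mul_le {V : Type*} [Fintype V] (G : SimpleGraph V) (δ L : ℕ) (hL : δ < L)
    (hmin : ∀ u v, G.Adj u v → nbrCount G u (fun _ => True) = δ ∨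
      nbrCount G v (fun _ => True) = δ) :
    (Finset.univ.filter fun v => L ≤ nbrCount G v fun _ => True).card * L ≤
      Fintype.card V * δ := by
  refine (Finset.card_mul_le_card_mul (t := Finset.univ.filter fun v =>
    nbrCount G v (fun _ => True) = δ) (n := δ) G.Adj ?_ ?_).trans
    (Nat.mul_le_mul_right _ (Finset.card_le_univ _))
  · intro v hv
    simp only [Finset.mem_filter, Finset.mem_univ, true_and] at hv
    refine hv.trans (Finset.card_le_card fun u hu => ?_)
    simp only [Finset.mem_filter, Finset.mem_univ, true_and, and_true,
      Finset.mem_bipartiteAbove] at hu ⊢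
    refine ⟨(hmin v u hu).resolve_left (by omega), hu⟩
  · intro u hu
    simp only [Finset.mem_filter, Finset.mem_univ, true_and] at hu
    refine (Finset.card_le_card fun v hv => ?_).trans hu.le
    simp only [Finset.mem_filter, Finset.mem_univ, true_and, and_true,
      Finset.mem_bipartiteBelow] at hv ⊢
    exact hv.2.symm

open Classical in
/-- The coordinate holding the label of `v` seen from `u`: vertices satisfying `light` have a single
label, the others have one label for each neighbour. -/
noncomputable def labelIndex {V : Type*} (light : V → Prop) (u v : V) : V × V :=
  if light v then (v, v) else (v, u)

theorem labelIndex_fst {V : Type*} (light : V → Prop) (u v : V) :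
    (labelIndex light u v).1 = v := by
  unfold labelIndex; split_ifs <;> rfl

theorem labelIndex_injective {V : Type*} (light : V → Prop) (u : V) :
    Function.Injective (labelIndex light u) := fun v w h => by
  rw [← labelIndex_fst light u v, h, labelIndex_fst]

open Classical in
/-- The coordinates, other than the one of `v` itself, which determine the degree of `v`. -/
noncomputable def nbrCoords {V : Type*} [Fintype V] (G : SimpleGraph V) (light : V → Prop) (v : V) :
    Finset (V × V) :=
  (Finset.univ.filter (G.Adj v)).image (labelIndex light v)

open Classical in
theorem card_nbrCoords {V : Type*} [Fintype V] (G : SimpleGraph V) (light : V → Prop) (v : V) :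
    (nbrCoords G light v).card = nbrCount G v fun _ => True := by
  rw [nbrCount_true, nbrCoords]
  rw [Finset.card_image_of_injective _ (labelIndex_injective light v)]

theorem mem_nbrCoords {V : Type*} [Fintype V] (G : SimpleGraph V) (light : V → Prop) (v : V)
    (i : V × V) : i ∈ nbrCoords G light v ↔ G.Adj v i.1 ∧ i = labelIndex light v i.1 := by
  classical
  unfold nbrCoords
  simp only [Finset.mem_image, Finset.mem_filter, Finset.mem_univ, true_and]
  constructor
  · rintro ⟨u, hu, rfl⟩
    rw [labelIndex_fst]; exact ⟨hu, rfl⟩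
  · rintro ⟨h, h'⟩
    exact ⟨i.1, h, h'.symm⟩

-- A light vertex shows the same label to all its neighbours, so its degree is the threshold count
-- of one coordinate against distinct others, the form needed for the rank argument.
open Classical in
theorem nbrCount_thresholdGraph {V : Type*} [Fintype V] (G : SimpleGraph V) (light : V → Prop)
    {M : ℕ} (ω : V × V → Fin M) {v : V} (hv : light v) :
    nbrCount (thresholdGraph G M fun u v => (ω (labelIndex light u v) : ℕ)) v (fun _ => True) =
      ((nbrCoords G light v).filter fun i => M ≤ (ω (v, v) : ℕ) + ω i).card := by
  rw [nbrCount_true, nbrCoords]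
  rw [Finset.filter_image, Finset.card_image_of_injective _ (labelIndex_injective light v),
    Finset.filter_filter]
  congr 1
  refine Finset.filter_congr fun u _ => ?_
  have : labelIndex light u v = (v, v) := by simp [labelIndex, hv]
  simp only [thresholdGraph, this]
  rw [add_comm]

open Classical in
/-- Few pairs of light vertices have dependent degrees. -/
theorem card_near_le {V : Type*} [Fintype V] (G : SimpleGraph V) (L : ℕ) (light : V → Prop)
    (hlight : ∀ v, light v → nbrCount G v (fun _ => True) + 1 ≤ L) :
    (Finset.univ.filter fun e : V × V => light e.1 ∧ light e.2 ∧
      ¬ Disjoint (insert (e.1, e.1) (nbrCoords G light e.1))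
        (insert (e.2, e.2) (nbrCoords G light e.2))).card ≤ Fintype.card V * (L * L) := by
  set B : V → Finset V := fun v => insert v (Finset.univ.filter (G.Adj v)) with hB
  have hBc : ∀ v, light v → (B v).card ≤ L := fun v hv =>
    (Finset.card_insert_le _ _).trans (by rw [← nbrCount_true]; exact hlight v hv)
  rw [Finset.card_filter, ← Finset.univ_product_univ, Finset.sum_product]
  refine (Finset.sum_le_card_nsmul _ _ (L * L) fun v _ => ?_).trans (le_of_eq (by simp))
  rw [← Finset.card_filter]
  by_cases hv : light v
  · refine (Finset.card_le_card (t := ((B v).filter light).biUnion B) ?_).trans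
      ((Finset.card_biUnion_le_card_mul _ _ L fun x hx => hBc x (Finset.mem_filter.1 hx).2).trans
        (Nat.mul_le_mul_right _ ((Finset.card_filter_le _ _).trans (hBc v hv))))
    intro w hw
    simp only [Finset.mem_filter, Finset.mem_univ, true_and, Finset.not_disjoint_iff,
      Finset.mem_insert, mem_nbrCoords] at hw
    obtain ⟨-, hw, i, hi, hi'⟩ := hw
    simp only [hB, Finset.mem_biUnion, Finset.mem_filter, Finset.mem_insert, Finset.mem_univ,
      true_and]
    rcases hi with rfl | ⟨h1, h2⟩
    · refine ⟨v, ⟨Or.inl rfl, hv⟩, ?_⟩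
      rcases hi' with h | ⟨h, -⟩
      · exact Or.inl (Prod.mk.inj h).1.symm
      · exact Or.inr h.symm
    -- A shared coordinate at a light vertex puts w within distance 2 of v through vertices of small
    -- degree. A heavy vertex shows v a coordinate of their own, so sharing it forces w = v.
    · by_cases hi : light i.1
      · refine ⟨i.1, ⟨Or.inr h1, hi⟩, ?_⟩
        rcases hi' with h | ⟨h, -⟩
        · rw [h]; exact Or.inl rfl
        · exact Or.inr h.symm
      · refine ⟨v, ⟨Or.inl rfl, hv⟩, Or.inl ?_⟩
        rcases hi' with h | ⟨-, h⟩
        · rw [h] at hi; exact absurd hw hi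
        · rw [h2] at h
          simpa [labelIndex, hi] using h.symm
  · simp [hv]

-- Union bound over k < L, in the multiplied form in which Chebyshev's inequality delivers its
-- estimates.
open Classical in
theorem exists_forall_notMem {Ω : Type*} [Fintype Ω] (bad : ℕ → Finset Ω) (L : ℕ) {s c : ℝ}
    (hs : 0 ≤ s) (hbad : ∀ k, ((bad k).card : ℝ) * s ≤ c) (hc : L * c < Fintype.card Ω * s) :
    ∃ ω, ∀ k < L, ω ∉ bad k := by
  by_contra! h
  have hu : (Finset.range L).biUnion bad = Finset.univ := by
    ext ω
    obtain ⟨k, hk, hω⟩ := h ω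
    simpa using ⟨k, hk, hω⟩
  have h1 : (Fintype.card Ω : ℝ) ≤ ∑ k ∈ Finset.range L, ((bad k).card : ℝ) := by
    rw [← Finset.card_univ, ← hu]
    exact_mod_cast Finset.card_biUnion_le
  have h2 := mul_le_mul_of_nonneg_right h1 hs
  rw [Finset.sum_mul] at h2
  have h3 := Finset.sum_le_card_nsmul (Finset.range L) _ _ fun k _ => hbad k
  rw [nsmul_eq_mul, Finset.card_range] at h3
  linarith

open Classical in
theorem card_threshold_eq_le {I : Type*} [Fintype I] [DecidableEq I]
    {M : ℕ} (hM : 0 < M) (k : ℕ) (T : Finset I)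
    (c : I) (hc : c ∉ T) {δ L : ℕ} (hδ : δ ≤ T.card) (hL : T.card + 1 ≤ L) :
    ((Finset.univ.filter fun ω : I → Fin M =>
      (T.filter fun t => M ≤ (ω c : ℕ) + ω t).card = k).card : ℝ) ≤
      Fintype.card (I → Fin M) * (1 / (δ + 1 : ℝ) + (L : ℝ) ^ 2 / M) := by
  have h1 := card_threshold_eq_mul_le M k T c hc
  generalize (Finset.univ.filter fun ω : I → Fin M =>
      (T.filter fun t => M ≤ (ω c : ℕ) + ω t).card = k).card = a at h1 ⊢
  generalize Fintype.card (I → Fin M) = N at h1 ⊢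
  generalize T.card = D at h1 hδ hL
  have hM' : (0 : ℝ) < M := by exact_mod_cast hM
  have h2 : (a : ℝ) * (D + 1) * M ≤ N * (M + (D + 1) ^ 3) := by exact_mod_cast h1
  have h3 : (D : ℝ) + 1 ≤ L := by exact_mod_cast hL
  have h4 : (δ : ℝ) ≤ D := by exact_mod_cast hδ
  have hD0 : (0 : ℝ) < D + 1 := by positivity
  calc (a : ℝ) = a * (D + 1) * M / ((D + 1) * M) := by field_simp
    _ ≤ N * (M + (D + 1) ^ 3) / ((D + 1) * M) := by gcongr
    _ = N * (1 / (D + 1) + (D + 1) ^ 2 / M) := by field_simp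
    _ ≤ _ := by gcongr

open Classical in
/-- In a graph of minimum degree at least `δ` in which every edge has an end of degree `δ`, random
thresholds give a spanning subgraph with few repeated degrees. -/
theorem exists_subgraph_of_edge_minimal {V : Type*} [Fintype V] (G : SimpleGraph V) (δ L M : ℕ)
    (hL : δ < L) (hM : 0 < M) (hδ : ∀ v, δ ≤ nbrCount G v fun _ => True)
    (hmin : ∀ u v, G.Adj u v → nbrCount G u (fun _ => True) = δ ∨
      nbrCount G v (fun _ => True) = δ)
    {t : ℝ} (ht : 0 < t) (htL : (L : ℝ) * (Fintype.card V * (L * L)) < t ^ 2) :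
    ∃ H ≤ G, ∀ k, (degCount H k : ℝ) ≤ Fintype.card V * (1 / (δ + 1 : ℝ) + (L : ℝ) ^ 2 / M) + t +
      Fintype.card V * δ / (L : ℝ) := by
  have hM' : (0 : ℝ) < M := by exact_mod_cast hM
  have hL' : (0 : ℝ) < L := by exact_mod_cast (Nat.zero_le _).trans_lt hL
  have : Nonempty (Fin M) := ⟨⟨0, hM⟩⟩
  set Ω := V × V → Fin M
  set N : ℝ := (Fintype.card Ω : ℝ) with hN
  have hN0 : 0 < N := by rw [hN]; exact_mod_cast Fintype.card_pos
  set light : V → Prop := fun v => nbrCount G v (fun _ => True) + 1 ≤ L with hlight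
  set T := nbrCoords G light with hT
  set d : V → Ω → ℕ := fun v ω => ((T v).filter fun i => M ≤ (ω (v, v) : ℕ) + ω i).card with hd
  -- Heavy vertices get the empty event; they are few and are simply added at the end.
  set E : ℕ → V → Finset Ω := fun k v =>
    if light v then Finset.univ.filter fun ω => d v ω = k else ∅ with hE
  set near : V → V → Prop := fun v w => light v ∧ light w ∧
    ¬ Disjoint (insert (v, v) (T v)) (insert (w, w) (T w)) with hnear
  have hdep : ∀ k v (ω ω' : Ω), (∀ i ∈ insert (v, v) (T v), ω i = ω' i) → ω ∈ E k v →
      ω' ∈ E k v := by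
    intro k v ω ω' h hω
    by_cases hv : light v
    · simp only [hE, hv, if_true, Finset.mem_filter, Finset.mem_univ, true_and] at hω ⊢
      rw [← hω]
      simp only [hd]
      congr 1
      refine Finset.filter_congr fun i hi => ?_
      rw [h _ (Finset.mem_insert_self _ _), h i (Finset.mem_insert_of_mem hi)]
    · simp [hE, hv] at hω
  have hind : ∀ k v w, ¬ near v w →
      (E k v ∩ E k w).card * Fintype.card Ω ≤ (E k v).card * (E k w).card := by
    intro k v w h
    by_cases hv : light v
    · by_cases hw : light w
      · have hdis : Disjoint (insert (v, v) (T v)) (insert (w, w) (T w)) := by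
          by_contra hc; exact h ⟨hv, hw, hc⟩
        exact card_inter_mul_le _ _ _ _ hdis (hdep k v) (hdep k w)
      · simp [hE, hw]
    · simp [hE, hv]
  have hcard : ∀ k v, ((E k v).card : ℝ) ≤ N * (1 / (δ + 1 : ℝ) + (L : ℝ) ^ 2 / M) := by
    intro k v
    by_cases hv : light v
    · simp only [hE, hv, if_true]
      refine card_threshold_eq_le hM k (T v) (v, v)
        (fun h => G.loopless.irrefl v ((mem_nbrCoords G light v _).1 h).1) ?_ ?_
      · rw [hT, card_nbrCoords]; exact hδ v
      · rw [hT, card_nbrCoords]; exact hv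
    · simp only [hE, hv, if_false, Finset.card_empty, Nat.cast_zero]
      positivity
  set m : ℝ := Fintype.card V * (1 / (δ + 1 : ℝ) + (L : ℝ) ^ 2 / M) with hm
  have hm0 : 0 ≤ m := by positivity
  have hsum : ∀ k, (∑ v, ((E k v).card : ℝ)) ≤ m * Fintype.card Ω := by
    intro k
    refine (Finset.sum_le_card_nsmul _ _ _ fun v _ => hcard k v).trans (le_of_eq ?_)
    rw [nsmul_eq_mul, Finset.card_univ, hm]
    ring
  set bad : ℕ → Finset Ω := fun k => Finset.univ.filter fun ω : Ω =>
    m + t ≤ ((Finset.univ.filter fun v => ω ∈ E k v).card : ℝ) with hbad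
  have hbadc : ∀ k, ((bad k).card : ℝ) * t ^ 2 ≤ (Fintype.card V * (L * L) : ℝ) * N := fun k =>
    card_mul_sq_le_of_second_moment (E k) near _
      (by
        have h := card_near_le G L light fun v hv => hv
        refine le_trans (le_of_eq ?_) (Nat.cast_le.2 h |>.trans (le_of_eq (by push_cast; rfl)))
        congr 2
        ext e
        simp only [Finset.mem_filter, Finset.mem_univ, true_and, hnear, hT]) (hind k) ht.le (hsum k)
  obtain ⟨ω, hω⟩ := exists_forall_notMem bad L (sq_nonneg t) hbadc (by
    rw [← hN, ← mul_assoc, mul_comm N]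
    exact mul_lt_mul_of_pos_right htL hN0)
  have hX : ∀ k, ((Finset.univ.filter fun v => ω ∈ E k v).card : ℝ) ≤ m + t := by
    intro k
    -- A light vertex never has degree L or more, so only L values of k enter the union bound.
    by_cases hk : k < L
    · by_contra! h
      exact hω k hk (Finset.mem_filter.2 ⟨Finset.mem_univ _, h.le⟩)
    · rw [Finset.filter_false_of_mem]
      · simp only [Finset.card_empty, Nat.cast_zero]; positivity
      · intro v _ hv
        by_cases hv' : light v
        · simp only [hE, hv', if_true, Finset.mem_filter, Finset.mem_univ, true_and] at hv
          have h1 : d v ω ≤ (T v).card := Finset.card_filter_le _ _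
          rw [hT, card_nbrCoords] at h1
          have : nbrCount G v (fun _ => True) + 1 ≤ L := hv'
          omega
        · simp [hE, hv'] at hv
  refine ⟨thresholdGraph G M fun u v => (ω (labelIndex light u v) : ℕ), fun u v h => h.1,
    fun k => ?_⟩
  have hheavy : ((Finset.univ.filter fun v => L ≤ nbrCount G v fun _ => True).card : ℝ) ≤
      Fintype.card V * δ / (L : ℝ) := by
    rw [le_div_iff₀ hL']
    exact_mod_cast card_heavy_mul_le G δ L hL hmin
  refine le_trans ?_ (add_le_add (hX k) hheavy)
  rw [degCount_eq]
  norm_cast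
  refine (Finset.card_le_card fun v hv => ?_).trans (Finset.card_union_le _ _)
  simp only [Finset.mem_filter, Finset.mem_univ, true_and, Finset.mem_union] at hv ⊢
  by_cases hv' : light v
  · left
    rw [nbrCount_thresholdGraph G light ω hv'] at hv
    simp only [hE, hv', if_true, Finset.mem_filter, Finset.mem_univ, true_and]
    exact hv
  · right
    have : ¬ nbrCount G v (fun _ => True) + 1 ≤ L := hv'
    omega

/-- With x = n^{1/20}, take L about x³, M = n and t = x^{18}. Then the tie error L², the deviation t
and the heavy vertices, at most nδ/L, total at most 6x^{18}, against a main term n/(δ+1) ≥ x^{19}/2.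
Chebyshev applies because t² = x^{36} exceeds nL³ ≤ 8x^{29}. -/
theorem asymptotic_bound_of_small_degree {V : Type*} [Fintype V] (G : SimpleGraph V) (δ : ℕ)
    (hδ : ∀ v, δ ≤ nbrCount G v fun _ => True)
    (hn : 2 ≤ (Fintype.card V : ℝ) ^ (1 / 20 : ℝ))
    (hsmall : (δ : ℝ) ≤ (Fintype.card V : ℝ) ^ (1 / 20 : ℝ)) :
    ∃ H ≤ G, (maxDegCount H : ℝ) ≤ (1 + 12 / (Fintype.card V : ℝ) ^ (1 / 20 : ℝ)) *
      ⌈(Fintype.card V : ℝ) / (δ + 1)⌉₊ := by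
  obtain ⟨F, hFG, hF, hmin⟩ := exists_edge_minimal G δ hδ
  set x : ℝ := (Fintype.card V : ℝ) ^ (1 / 20 : ℝ) with hx
  have hxn : (Fintype.card V : ℝ) = x ^ 20 := by
    rw [hx, ← Real.rpow_natCast, ← Real.rpow_mul (by positivity)]; norm_num
  have hx0 : 0 < x := by linarith
  have hx1 : 1 ≤ x := by linarith
  have hL1 : x ^ 3 ≤ (⌈x ^ 3⌉₊ : ℝ) := Nat.le_ceil _
  have hL2 : (⌈x ^ 3⌉₊ : ℝ) ≤ 2 * x ^ 3 := by
    have h1 := (Nat.ceil_lt_add_one (pow_nonneg hx0.le 3)).le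
    have h2 : 1 ≤ x ^ 3 := one_le_pow₀ hx1
    linarith
  set L := ⌈x ^ 3⌉₊ with hL
  have hL0 : (0 : ℝ) < L := lt_of_lt_of_le (by positivity) hL1
  have hδL : δ < L := by
    have : x < x ^ 3 := by
      have : 0 < x * (x - 1) * (x + 1) := by
        have : 0 < x - 1 := by linarith
        positivity
      nlinarith
    have : (δ : ℝ) < L := by linarith
    exact_mod_cast this
  have hV : 0 < Fintype.card V := by
    have : (0 : ℝ) < Fintype.card V := by rw [hxn]; positivity
    exact_mod_cast this
  obtain ⟨H, hH, hb⟩ := exists_subgraph_of_edge_minimal F δ L (Fintype.card V) hδL hV hF hmin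
    (t := x ^ 18) (by positivity) (by
      rw [hxn]
      calc (L : ℝ) * (x ^ 20 * (L * L)) ≤ (2 * x ^ 3) * (x ^ 20 * ((2 * x ^ 3) * (2 * x ^ 3))) := by
            gcongr
        _ = 2 ^ 3 * x ^ 29 := by ring
        _ ≤ x ^ 3 * x ^ 29 := by gcongr
        _ = x ^ 32 * 1 := by ring
        _ < x ^ 32 * x ^ 4 := by
            gcongr
            exact one_lt_pow₀ (by linarith) (by norm_num)
        _ = (x ^ 18) ^ 2 := by ring)
  have hceil := Nat.le_ceil ((Fintype.card V : ℝ) / (δ + 1))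
  obtain ⟨k, hk⟩ : ∃ k, maxDegCount H = degCount H k := by
    obtain ⟨k, hk⟩ := Nat.sSup_mem (Set.range_nonempty (degCount H)) (bddAbove_degCount H)
    exact ⟨k, hk.symm⟩
  refine ⟨H, hH.trans hFG, ?_⟩
  rw [hk]
  refine (hb k).trans (le_trans ?_ (mul_le_mul_of_nonneg_left hceil (by positivity)))
  rw [hxn]
  have h1 : x ^ 20 * ((L : ℝ) ^ 2 / x ^ 20) ≤ 4 * x ^ 18 := by
    calc x ^ 20 * ((L : ℝ) ^ 2 / x ^ 20) = (L : ℝ) ^ 2 := by field_simp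
      _ ≤ (2 * x ^ 3) ^ 2 := by gcongr
      _ = 4 * x ^ 6 := by ring
      _ ≤ 4 * x ^ 18 := by gcongr; norm_num
  have h2 : x ^ 20 * δ / (L : ℝ) ≤ x ^ 18 := by
    calc x ^ 20 * δ / (L : ℝ) ≤ x ^ 20 * x / x ^ 3 := by gcongr
      _ = x ^ 18 := by field_simp
  have h3 : 6 * x ^ 18 ≤ 12 / x * (x ^ 20 / (δ + 1)) := by
    calc 6 * x ^ 18 = 12 / x * (x ^ 20 / (2 * x)) := by field_simp; ring
      _ ≤ _ := by gcongr; linarith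
  have h4 : x ^ 20 * (1 / (δ + 1 : ℝ) + (L : ℝ) ^ 2 / x ^ 20) =
      x ^ 20 / (δ + 1) + x ^ 20 * ((L : ℝ) ^ 2 / x ^ 20) := by ring
  have h5 : (1 + 12 / x) * (x ^ 20 / (δ + 1)) = x ^ 20 / (δ + 1) + 12 / x * (x ^ 20 / (δ + 1)) := by
    ring
  rw [h5, h4]
  linarith

end Sparse

/-! ### Combining the two ranges of the minimum degree -/

theorem tendsto_log_div_rpow_rpow {a b : ℝ} (ha : 0 < a) (hb : 0 < b) :
    Tendsto (fun n : ℕ => (Real.log n / (n : ℝ) ^ a) ^ b) atTop (𝓝 0) := by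
  have h := ((isLittleO_log_rpow_atTop ha).tendsto_div_nhds_zero).comp
    (tendsto_natCast_atTop_atTop (R := ℝ))
  have h2 := h.rpow_const (p := b) (Or.inr hb.le)
  rw [Real.zero_rpow hb.ne'] at h2
  exact h2

theorem maxDegCount_le_card {V : Type*} [Fintype V] (G : SimpleGraph V) :
    maxDegCount G ≤ Fintype.card V :=
  (maxDegCount_le_iff G _).2 fun _ => Finset.card_le_univ _

/-- The asymptotic bound, for all minimum degrees. -/
theorem asymptotic_bound :
    ∃ η : ℕ → ℝ, Tendsto η atTop (𝓝 0) ∧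
      ∀ (V : Type*) [Fintype V] (G : SimpleGraph V) (δ : ℕ)
        (_ : ∀ v, δ ≤ nbrCount G v (fun _ => True)),
        ∃ H ≤ G, (maxDegCount H : ℝ) ≤ (1 + η (Fintype.card V)) *
          (⌈(Fintype.card V : ℝ) / ((δ : ℝ) + 1)⌉₊ : ℝ) + 2 := by
  obtain ⟨N, hN⟩ := eventually_atTop.1
    (eventually_mul_log_le_rpow 16000000000000 (a := 1 / 20) (by norm_num))
  obtain ⟨N', hN'⟩ := eventually_atTop.1 (((tendsto_rpow_atTop (show (0 : ℝ) < 1 / 20 by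
    norm_num)).comp (tendsto_natCast_atTop_atTop (R := ℝ))).eventually_ge_atTop 2)
  set e₁ : ℕ → ℝ := fun n => 327680 * (Real.log n / (n : ℝ) ^ (1 / 20 : ℝ)) ^ (1 / 4 : ℝ) with he₁
  set e₂ : ℕ → ℝ := fun n => 12 / (n : ℝ) ^ (1 / 20 : ℝ) with he₂
  set N₀ := max (max N N') 2 with hN₀
  -- For n < N₀ the value η n = n makes the bound trivial with H = G; beyond that the sum of the two
  -- errors serves both ranges of δ.
  refine ⟨fun n => if n < N₀ then (n : ℝ) else e₁ n + e₂ n, ?_, fun V _ G δ hδ => ?_⟩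
  · have h1 : Tendsto e₁ atTop (𝓝 0) := by
      have h := (tendsto_log_div_rpow_rpow (a := 1 / 20) (b := 1 / 4) (by norm_num)
        (by norm_num)).const_mul 327680
      rwa [mul_zero] at h
    have h2 : Tendsto e₂ atTop (𝓝 0) :=
      ((tendsto_rpow_atTop (show (0 : ℝ) < 1 / 20 by norm_num)).comp
        (tendsto_natCast_atTop_atTop (R := ℝ))).const_div_atTop 12
    have h3 := h1.add h2
    rw [add_zero] at h3
    refine h3.congr' ?_
    filter_upwards [eventually_ge_atTop N₀] with n hn
    rw [if_neg (not_lt.2 hn)]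
  · beta_reduce
    by_cases hlt : Fintype.card V < N₀
    · rw [if_pos hlt]
      refine ⟨G, le_rfl, ?_⟩
      have h1 : (maxDegCount G : ℝ) ≤ Fintype.card V := by exact_mod_cast maxDegCount_le_card G
      rcases Nat.eq_zero_or_pos (Fintype.card V) with h0 | h0
      · rw [h0] at h1 ⊢
        refine h1.trans ?_
        push_cast
        positivity
      · have h2 : (1 : ℝ) ≤ (⌈(Fintype.card V : ℝ) / ((δ : ℝ) + 1)⌉₊ : ℝ) := by
          have : 0 < ⌈(Fintype.card V : ℝ) / ((δ : ℝ) + 1)⌉₊ := Nat.ceil_pos.2 (by positivity)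
          exact_mod_cast this
        have h3 : (1 + (Fintype.card V : ℝ)) * 1 ≤ (1 + (Fintype.card V : ℝ)) *
          (⌈(Fintype.card V : ℝ) / ((δ : ℝ) + 1)⌉₊ : ℝ) := by gcongr
        linarith
    · rw [if_neg hlt]
      have hge := not_lt.1 hlt
      have hn2 : 2 ≤ Fintype.card V := (le_max_right _ _).trans hge
      have hlog := hN _ ((le_max_left _ _).trans ((le_max_left _ _).trans hge))
      have hx := hN' _ ((le_max_right _ _).trans ((le_max_left _ _).trans hge))
      have hl0 : 0 ≤ Real.log (Fintype.card V) := Real.log_natCast_nonneg _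
      have h1 : 0 ≤ e₁ (Fintype.card V) := by rw [he₁]; positivity
      have h2 : 0 ≤ e₂ (Fintype.card V) := by rw [he₂]; positivity
      have hc : (0 : ℝ) ≤ (⌈(Fintype.card V : ℝ) / ((δ : ℝ) + 1)⌉₊ : ℝ) := by positivity
      rcases le_total ((Fintype.card V : ℝ) ^ (1 / 20 : ℝ)) δ with hbig | hsmall
      · obtain ⟨H, hH, h⟩ := asymptotic_bound_of_large_degree G δ hδ hn2 hlog hbig
        refine ⟨H, hH, h.trans ?_⟩
        gcongr
        exact le_add_of_nonneg_right h2
      · obtain ⟨H, hH, h⟩ := asymptotic_bound_of_small_degree G δ hδ hx hsmall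
        refine ⟨H, hH, h.trans ((mul_le_mul_of_nonneg_right ?_ hc).trans
          (le_add_of_nonneg_right zero_le_two))⟩
        gcongr
        exact le_add_of_nonneg_left h1

end IrregularSubgraph

theorem theorem1p4 :
    -- asymptotic form; the error term depends on the number of vertices only
    (∃ η : ℕ → ℝ, Tendsto η atTop (𝓝 0) ∧
      ∀ (V : Type u) [Fintype V] (G : SimpleGraph V) [DecidableRel G.Adj],
        ∃ H : SimpleGraph V, H ≤ G ∧
          (IrregularSubgraph.maxDegCount H : ℝ) ≤
            (1 + η (Fintype.card V)) *
              (⌈(Fintype.card V : ℝ) / ((G.minDegree : ℝ) + 1)⌉₊ : ℝ) + 2) ∧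
    -- the case of large minimum degree
    (∃ N : ℕ, ∀ (V : Type u) [Fintype V] (G : SimpleGraph V) [DecidableRel G.Adj],
      N ≤ Fintype.card V →
      (Fintype.card V : ℝ) ≤ (G.minDegree : ℝ) ^ (1.24 : ℝ) →
        ∃ H : SimpleGraph V, H ≤ G ∧
          IrregularSubgraph.maxDegCount H ≤
            ⌈(Fintype.card V : ℝ) / ((G.minDegree : ℝ) + 1)⌉₊ + 2) ∧
    -- explicit form; the threshold for the number of vertices depends on `ε` only
    (∀ ε : ℝ, 0 < ε → ε < 1 / 4 →
      ∃ N : ℕ, ∀ (V : Type u) [Fintype V] (G : SimpleGraph V) [DecidableRel G.Adj] (n δ : ℝ),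
        n = (Fintype.card V : ℝ) → δ = (G.minDegree : ℝ) → N ≤ Fintype.card V →
        (Real.log n ^ (2 / ε) * Real.log (Real.log n) ^ (1 / ε) ≤ δ →
          ∃ H : SimpleGraph V, H ≤ G ∧
            IrregularSubgraph.maxDegCount H ≤
              ⌈n / δ + 5 * √(n / δ * Real.log n) / δ ^ (1 / 4 : ℝ)⌉₊ +
                ⌊2016 * n * Real.log n * Real.log (Real.log n) / δ ^ (1 + ε)⌋₊ + 1) ∧
        (2016 * n * Real.log n * Real.log (Real.log n) < δ ^ (1 + ε) →
          ∃ H : SimpleGraph V, H ≤ G ∧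
            IrregularSubgraph.maxDegCount H ≤ ⌈n / (δ + 1)⌉₊ + 2)) := by
  obtain ⟨η, hη, h⟩ := IrregularSubgraph.asymptotic_bound.{u}
  refine ⟨⟨η, hη, fun V _ G _ =>
    h V G G.minDegree (IrregularSubgraph.minDegree_le_nbrCount G)⟩, ?_, ?_⟩
  · obtain ⟨N, hN⟩ := IrregularSubgraph.very_dense_bound.{u}
    exact ⟨N, fun V _ G _ hn hle =>
      hN V G G.minDegree (IrregularSubgraph.minDegree_le_nbrCount G) hn hle⟩
  · intro ε hε hε1
    obtain ⟨N, hN⟩ := IrregularSubgraph.explicit_bound.{u} hε hε1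
    obtain ⟨N', hN'⟩ := IrregularSubgraph.dense_bound.{u}
    refine ⟨max N N', fun V _ G _ n δ hn hδ hle => ?_⟩
    subst hn hδ
    exact ⟨hN V G G.minDegree (IrregularSubgraph.minDegree_le_nbrCount G)
        ((le_max_left _ _).trans hle),
      hN' V G G.minDegree (IrregularSubgraph.minDegree_le_nbrCount G)
        ((le_max_right _ _).trans hle) ε hε hε1⟩
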